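/- **Theorem 4.2.** Fix $k\in\{1,2,\ldots\}$, let $[k]=\{1,\ldots,k\}$, and let $[k]^{\mathbb N}$ be the space of sequences $x=x^1x^2\cdots$ in $[k]$ with the product $\sigma$-field of the discrete one. Write $x^{[n]}=x^1\cdots x^n$ and, for a finite permutation $\sigma$ of $\mathbb N$ (one that fixes all but finitely many elements), $x^\sigma=x^{\sigma(1)}x^{\sigma(2)}\cdots$. Let $\mathbf X=(X_t,\,t\ge 0)$ be a continuous-time, time-homogeneous Markov process on $[k]^{\mathbb N}$, given with its laws $\mathbb P_x$ for all initial states $x\in[k]^{\mathbb N}$; write $\mathbb P_\mu=\int\mathbb P_x\,\mu(dx)$ for its law with initial distribution $\mu$. Suppose that $\mathbf X$ is * *exchangeable*: for every exchangeable initial distribution and every finite permutation $\sigma$ of $\mathbb N$, the process $(X_t^\sigma,\,t\ge0)$ is a version of $\mathbf X$ (that is, it has the same law on the path space $([k]^{\mathbb N})^{[0,\infty)}$ with its product $\sigma$-field); * *consistent*: for every $n$, the restriction $(X_t^{[n]},\,t\ge0)$ is a time-homogeneous Markov chain on $[k]^{[n]}$ with respect to its own filtration, with almost surely càdlàg paths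 and with a transition function that does not depend on the initial state of $\mathbf X$. Let $[k]^{\mathbb N\otimes k}$ be the space of $k$-tuples $M=(M_1,\ldots,M_k)$ of elements $M_i=M_i^1M_i^2\cdots$ of $[k]^{\mathbb N}$, and let $M^{[n]}=(M_1^{[n]},\ldots,M_k^{[n]})$, which acts as a map $[k]^{[n]}\to[k]^{[n]}$ by $M^{[n]}(x)^j=M_{x^j}^{\,j}$, $1\le j\le n$. Let $\mathrm{id}_k$ be the $k$-tuple with $M_i=iii\cdots$, and $\mathrm{id}_{k,n}=\mathrm{id}_k^{[n]}$; they act as the identity maps. Then there is a measure $\chi$ on $[k]^{\mathbb N\otimes k}$ such that 1. $\chi$ is coset exchangeable: for all finite permutations $\sigma_1,\ldots,\sigma_k$ of $\mathbb N$, $\chi$ is invariant under $(M_1,\ldots,M_k)\mapsto(M_1^{\sigma_1},\ldots,M_k^{\sigma_k})$; 2. $\chi(\{\mathrm{id}_k\})=0$, and $\chi(\{M: M^{[n]}\neq\mathrm{id}_{k,n}\})<\infty$ for every $n$; 3. for every initial distribution $\mu$ on $[k]^{\mathbb N}$, the process $\mathbf X^*_\chi$ with initial distribution $\mu$ exists,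 and it is a version of $\mathbf X$ under $\mathbb P_\mu$, whichever Poisson point process it is built from. Here $\mathbf X^*_\chi=(X^*_t,\,t\ge0)$ with initial distribution $\mu$ is a process built as follows. Let $X_0^*$ have law $\mu$, and let $\mathbf M$ be a Poisson point process on $[0,\infty)\times[k]^{\mathbb N\otimes k}$ with intensity $dt\otimes\chi$, independent of $X^*_0$. Almost surely, for every $n$, the path $t\mapsto X_t^{*[n]}$ is right-continuous with left limits, and for every $t>0$: if $\mathbf M$ has an atom $(t,M_t)$ with $M_t^{[n]}\neq\mathrm{id}_{k,n}$, then $X_t^{*[n]}=M_t^{[n]}(X_{t-}^{*[n]})$; otherwise $X_t^{*[n]}=X_{t-}^{*[n]}$. -/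

import Mathlib

open MeasureTheory ProbabilityTheory Filter Topology
open scoped NNReal ENNReal

namespace CutPaste

/-! ### Colorings and maps

The colors `1, …, k` are the elements of `Fin k`, and the index set `{1, 2, …}` is `ℕ`
(shifted by one, so that `[n] = {1, …, n}` becomes `{0, …, n - 1} = Fin n`). -/

/-- `[k]^ℕ`, with the product σ-algebra of the discrete one on `Fin k`. -/
abbrev Coloring (k : ℕ) : Type := ℕ → Fin k

/-- `[k]^[n]`. -/
abbrev FinColoring (k n : ℕ) : Type := Fin n → Fin k

/-- The restriction `x ↦ x^[n]`. -/
def restrict {k : ℕ} (n : ℕ) (x : Coloring k) : FinColoring k n := fun j => x j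

/-- A finite permutation of `ℕ`: it fixes all but finitely many elements. -/
def IsFinitePerm (σ : Equiv.Perm ℕ) : Prop := {j | σ j ≠ j}.Finite

/-- The relabeling `x^σ = x^{σ(1)} x^{σ(2)} ⋯`. -/
def relabel {k : ℕ} (σ : Equiv.Perm ℕ) (x : Coloring k) : Coloring k := fun j => x (σ j)

/-- `[k]^{ℕ ⊗ k}`: a map is given by its `k` cosets `M_1, …, M_k`, each of them a `k`-coloring
of `ℕ`. `M i j` is the entry `M_i^j`; in the interleaved sequence `M^1 M^2 ⋯` it is the one with
index `i + (j - 1) k` (for `i`, `j` counted from one). -/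
abbrev CosetMap (k : ℕ) : Type := Fin k → Coloring k

/-- `[k]^{[n] ⊗ k}`. -/
abbrev FinCosetMap (k n : ℕ) : Type := Fin k → FinColoring k n

/-- The restriction `M^[n] = (M_1^[n], …, M_k^[n])`. -/
def CosetMap.restrict {k : ℕ} (n : ℕ) (M : CosetMap k) : FinCosetMap k n :=
  fun i => CutPaste.restrict n (M i)

/-- The map `[k]^[n] → [k]^[n]` of `M ∈ [k]^{[n] ⊗ k}`: the `j`th coordinate of the image of `x` is
the entry of the interleaved sequence with index `x^j + (j - 1) k`, that is, the `j`th entry of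
the coset with number `x^j`. -/
def FinCosetMap.act {k n : ℕ} (M : FinCosetMap k n) (x : FinColoring k n) : FinColoring k n :=
  fun j => M (x j) j

/-- The repeating pattern `12⋯k12⋯k⋯`, whose cosets are constant; it acts as the identity map. -/
def idMap (k : ℕ) : CosetMap k := fun i _ => i

/-- The identity map of `[k]^[n]`, as an element of `[k]^{[n] ⊗ k}`. -/
def finIdMap (k n : ℕ) : FinCosetMap k n := fun i _ => i

/-- Coset exchangeability of a (possibly infinite) measure on `[k]^{ℕ ⊗ k}`: invariance under
`(M_1, …, M_k) ↦ (M_1^{σ_1}, …, M_k^{σ_k})` for all finite permutations `σ_1, …, σ_k`. -/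
def IsCosetExchangeable {k : ℕ} (χ : Measure (CosetMap k)) : Prop :=
  ∀ σ : Fin k → Equiv.Perm ℕ, (∀ i, IsFinitePerm (σ i)) →
    χ.map (fun M i => relabel (σ i) (M i)) = χ

/-- `χ({id}) = 0`, and `χ({M : M^[n] ≠ id}) < ∞` for all `n`. -/
def IsRegular {k : ℕ} (χ : Measure (CosetMap k)) : Prop :=
  χ {idMap k} = 0 ∧ ∀ n : ℕ, χ {M | M.restrict n ≠ finIdMap k n} < ∞

/-- An exchangeable law on `[k]^ℕ`. -/
def IsExchangeableLaw {k : ℕ} (μ : Measure (Coloring k)) : Prop :=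
  ∀ σ : Equiv.Perm ℕ, IsFinitePerm σ → μ.map (relabel σ) = μ

/-! ### Markov processes on `[k]^ℕ` -/

/-- The σ-algebra generated by `Y_s`, `s ≤ t`. -/
@[reducible] def pastSigma {Ω E : Type*} [MeasurableSpace E] (Y : ℝ≥0 → Ω → E) (t : ℝ≥0) : MeasurableSpace Ω :=
  ⨆ s : ℝ≥0, ⨆ _ : s ≤ t, MeasurableSpace.comap (Y s) inferInstance

/-- A càdlàg path in a discrete space: it is right-continuous with left limits. In a finite
discrete space these are the right-continuous paths with finitely many jumps in each bounded
interval. -/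
def IsStepPath {E : Type*} (y : ℝ≥0 → E) : Prop :=
  (∀ t, ∀ᶠ s in 𝓝[>] t, y s = y t) ∧ ∀ t, ∃ z, ∀ᶠ s in 𝓝[<] t, y s = z

/-- `(X_t)` is a (time-homogeneous) Markov process on `[k]^ℕ`. As usual it is given together with
its laws for all initial states: `Pr x` is the law `ℙ_x` under which `X_0 = x`, and, under every
`ℙ_x`, the conditional law of `X_{t+s}` given `σ(X_u, u ≤ t)` is the law of `X_s` under
`ℙ_y`, `y = X_t`. -/
structure IsMarkovProcess {k : ℕ} {Ω : Type*} [MeasurableSpace Ω]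
    (Pr : Kernel (Coloring k) Ω) (X : ℝ≥0 → Ω → Coloring k) : Prop where
  prob : ∀ x, IsProbabilityMeasure (Pr x)
  measurable : ∀ t, Measurable (X t)
  init : ∀ x, ∀ᵐ ω ∂(Pr x), X 0 ω = x
  markov : ∀ x s t, ∀ B : Set (Coloring k), MeasurableSet B →
    (Pr x)⟦X (t + s) ⁻¹' B | pastSigma X t⟧ =ᵐ[Pr x] fun ω => (Pr (X t ω)).real (X s ⁻¹' B)

/-- The law on path space, `∫ ℙ_x(X ∈ ·) μ(dx)`, of the process with initial law `μ`. Equality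
of laws on path space (with the product σ-algebra) means that one process is a version of the
other. -/
noncomputable def pathLaw {k : ℕ} {Ω : Type*} [MeasurableSpace Ω]
    (Pr : Kernel (Coloring k) Ω) (X : ℝ≥0 → Ω → Coloring k) (μ : Measure (Coloring k)) :
    Measure (ℝ≥0 → Coloring k) :=
  (μ.bind Pr).map (fun ω t => X t ω)

/-- Exchangeability of the process: for every exchangeable initial law and every finite
permutation `σ`, the process `(X_t^σ)` is a version of `(X_t)`. -/
def IsExchangeable {k : ℕ} {Ω : Type*} [MeasurableSpace Ω]
    (Pr : Kernel (Coloring k) Ω) (X : ℝ≥0 → Ω → Coloring k) : Prop :=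
  ∀ μ : Measure (Coloring k), IsProbabilityMeasure μ → IsExchangeableLaw μ →
    ∀ σ : Equiv.Perm ℕ, IsFinitePerm σ →
      pathLaw Pr (fun t ω => relabel σ (X t ω)) μ = pathLaw Pr X μ

/-- Consistency under subsampling: for every `n`, the restriction `(X_t^[n])` is a
(time-homogeneous) Markov chain on `[k]^[n]`, with respect to its own past. Its paths are almost
surely càdlàg, and its transition function `p` does not depend on the initial state of `X`. -/
def IsConsistent {k : ℕ} {Ω : Type*} [MeasurableSpace Ω]
    (Pr : Kernel (Coloring k) Ω) (X : ℝ≥0 → Ω → Coloring k) : Prop :=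
  ∀ n : ℕ,
    (∀ x, ∀ᵐ ω ∂(Pr x), IsStepPath fun t => restrict n (X t ω)) ∧
    ∃ p : ℝ≥0 → FinColoring k n → FinColoring k n → ℝ,
      ∀ x s t, ∀ y : FinColoring k n,
        (Pr x)⟦{ω | restrict n (X (t + s) ω) = y} | pastSigma (fun u ω => restrict n (X u ω)) t⟧
          =ᵐ[Pr x] fun ω => p s (restrict n (X t ω)) y

/-! ### Poisson point processes and the construction of `X*_χ` -/

/-- A random set of points `N ω ⊆ E` is a Poisson point process with intensity measure `ν`:
the number of points in a measurable set `B` is Poisson distributed with mean `ν B` (and is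
almost surely infinite if `ν B = ∞`), and the numbers of points in disjoint measurable sets are
independent. -/
structure IsPoissonPointProcess {Ω E : Type*} [MeasurableSpace Ω] [MeasurableSpace E]
    (P : Measure Ω) (N : Ω → Set E) (ν : Measure E) : Prop where
  countable : ∀ ω, (N ω).Countable
  measurable : ∀ B, MeasurableSet B → Measurable fun ω => (N ω ∩ B).encard
  poisson : ∀ B, MeasurableSet B → ν B ≠ ∞ →
    P.map (fun ω => (N ω ∩ B).encard) =
      (poissonMeasure (ν B).toNNReal).map (fun m : ℕ => (m : ℕ∞))
  infinite : ∀ B, MeasurableSet B → ν B = ∞ → ∀ᵐ ω ∂P, (N ω ∩ B).encard = ⊤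
  indep : ∀ (m : ℕ) (B : Fin m → Set E), (∀ i, MeasurableSet (B i)) →
    Pairwise (fun i j => Disjoint (B i) (B j)) →
      iIndepFun (fun i ω => (N ω ∩ B i).encard) P

/-- The σ-algebra generated by a random set of points: it is generated by the numbers of points
in measurable sets. -/
@[reducible] noncomputable def pointSigma {Ω E : Type*} [MeasurableSpace E] (N : Ω → Set E) : MeasurableSpace Ω :=
  ⨆ B : Set E, ⨆ _ : MeasurableSet B,
    MeasurableSpace.comap (fun ω => (N ω ∩ B).encard) inferInstance

/-- Lebesgue measure on `[0, ∞)`. -/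
noncomputable def lebesgue : Measure ℝ≥0 := (volume : Measure ℝ).comap ((↑) : ℝ≥0 → ℝ)

/-- The path `y` in `[k]^[n]` is driven by the set of atoms `A`. It is right-continuous and, at
each time `t > 0`, it has a left limit `z = y_{t-}`; if `t` is the time of an atom `(t, M)` with
`M^[n] ≠ id`, then `y_t = M^[n](y_{t-})`; otherwise `y_t = y_{t-}`. -/
def IsDriven {k : ℕ} (n : ℕ) (A : Set (ℝ≥0 × CosetMap k)) (y : ℝ≥0 → FinColoring k n) : Prop :=
  (∀ t, ∀ᶠ s in 𝓝[>] t, y s = y t) ∧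
  ∀ t, 0 < t → ∃ z : FinColoring k n, (∀ᶠ s in 𝓝[<] t, y s = z) ∧
    (∀ M, (t, M) ∈ A → M.restrict n ≠ finIdMap k n → y t = (M.restrict n).act z) ∧
    ((∀ M, (t, M) ∈ A → M.restrict n = finIdMap k n) → y t = z)

/-- `Y` is a process `X*_χ` with initial law `μ`: it is built from a Poisson point process `N`
with intensity `dt ⊗ χ` and an independent initial state with law `μ`, through its finite
restrictions, each of which is driven by the atoms of `N`. -/
structure IsPoissonConstruction {k : ℕ} {Ω : Type*} [MeasurableSpace Ω] (P : Measure Ω)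
    (χ : Measure (CosetMap k)) (μ : Measure (Coloring k))
    (N : Ω → Set (ℝ≥0 × CosetMap k)) (Y : ℝ≥0 → Ω → Coloring k) : Prop where
  poisson : IsPoissonPointProcess P N (lebesgue.prod χ)
  measurable : ∀ t, Measurable (Y t)
  init : P.map (Y 0) = μ
  indep : Indep (pointSigma N) (MeasurableSpace.comap (Y 0) inferInstance) P
  driven : ∀ᵐ ω ∂P, ∀ n, IsDriven n (N ω) fun t => restrict n (Y t ω)

end CutPaste

namespace CutPaste

/-! ### Contraction semigroups -/

/-! Every restriction to `[n]` is a finite-state chain whose transition functions `p n` form a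
semigroup continuous at `0`, so it has jump rates (`IsTransitionSemigroup.exists_rates`). The
measure `χ` must encode the rates of all `n` at once.

The initial law of independent uniform colors is exchangeable and charges every cylinder, so
exchangeability yields a statement about single initial states: the law at time `t` of finitely many
distinct sites depends only on the initial colors of these sites, in order, and is given by `p n`
(`IsExchangeable.real_injective`). Now start from a coloring in which every color has infinitely
many sites. The state at time `t`, read along the sites of each color, is a random coset map with
law `π_t`. The entries `(x j, j)` of this one map have joint law `p n t x ·`, so `π_t` contains the
transition probabilities out of every state `x`. Its law does not depend on which sites of a color
are read, which gives coset exchangeability.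

The rates `π_t / t` converge as `t → 0` on every cylinder that omits the identity. Compactness gives
a limit measure on the maps whose first nontrivial index is `j`, for each `j`, and `χ` is the sum of
these measures (`exists_rate_measure`). By construction, the rate from `x` to `y ≠ x` is `χ {M |
M^[n] x = y}`.

Let a process be driven by a Poisson point process with intensity `dt ⊗ χ`. Cut time into short
windows and, in each window, apply the map of its atom if there is exactly one. The resulting maps
are independent and identically distributed, and their one-step kernel has the same rates as `p n`.
A product formula for contractions (`tendsto_pow_of_semigroup`) shows that the powers of this kernel
converge to `p n`. The error comes from windows with several atoms and has probability `O(1/j)` for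
`j` windows. Hence all finite-dimensional laws agree with those of `X`
(`IsPoissonConstruction.measureReal_finDim`), and they determine the law on path space.

For existence, Poisson samples of the finite pieces of the intensity are superposed. Almost surely
the atoms nontrivial on `[n]` are locally finite with distinct times, so their maps can be composed
in order of time. -/

theorem norm_pow_sub_pow_le_mul {A : Type*} [NormedRing A] {a b : A} (ha : ‖a‖ ≤ 1) (hb : ‖b‖ ≤ 1) (j : ℕ) :
    ‖a ^ j - b ^ j‖ ≤ j * ‖a - b‖ := by
  -- The norm of `1` is not assumed to be at most `1`, so `b ^ i` is bounded only as a factor, never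
  -- alone.
  have hpow : ∀ i : ℕ, ∀ c : A, ‖c * b ^ i‖ ≤ ‖c‖ := by
    intro i
    induction i with
    | zero => simp
    | succ i ih =>
      intro c
      rw [pow_succ', ← mul_assoc]
      exact (ih _).trans ((norm_mul_le _ _).trans (mul_le_of_le_one_right (norm_nonneg _) hb))
  induction j with
  | zero => simp
  | succ j ih =>
    have h : a ^ (j + 1) - b ^ (j + 1) = a * (a ^ j - b ^ j) + (a - b) * b ^ j := by
      rw [pow_succ', pow_succ']; noncomm_ring
    rw [h]
    refine (norm_add_le _ _).trans ?_
    have h1 : ‖a * (a ^ j - b ^ j)‖ ≤ j * ‖a - b‖ :=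
      (norm_mul_le _ _).trans ((mul_le_of_le_one_left (norm_nonneg _) ha).trans ih)
    have h2 := hpow j (a - b)
    push_cast
    linarith

section Semigroup

variable {A : Type*} [NormedRing A] [NormedAlgebra ℝ A]

/-- Let `F x` be the integral of `P` over `[0, x]`. Since `F ε / ε` is close to `1`, `F ε` is
invertible for small `ε`. The semigroup property writes `(P t - 1) * F ε` as a difference of
increments of `F`, which is differentiable; dividing by `t` and cancelling `F ε` gives the limit. -/
theorem semigroup_hasDeriv_zero [CompleteSpace A] {P : ℝ≥0 → A} (h0 : P 0 = 1)
    (hadd : ∀ s t, P (s + t) = P s * P t)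
    (hcont : Tendsto P (𝓝[>] 0) (𝓝 1)) (hnorm : ∀ t, ‖P t‖ ≤ 1) :
    ∃ Q : A, Tendsto (fun t : ℝ≥0 => (t : ℝ)⁻¹ • (P t - 1)) (𝓝[>] 0) (𝓝 Q) := by
  have hcont0 : Tendsto P (𝓝 0) (𝓝 1) := by
    have h : 𝓝 (0 : ℝ≥0) = 𝓝[>] 0 ⊔ pure 0 := by
      rw [← nhdsWithin_univ, ← nhdsWithin_singleton, ← nhdsWithin_union]
      congr 1
      ext x
      simp
    rw [h]
    exact hcont.sup (by rw [tendsto_pure_left]; intro s hs; rw [h0]; exact mem_of_mem_nhds hs)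
  have hbound : ∀ s t : ℝ≥0, ‖P s - P t‖ ≤ ‖P (nndist s t) - 1‖ := by
    have key : ∀ s t : ℝ≥0, s ≤ t → ‖P s - P t‖ ≤ ‖P (nndist s t) - 1‖ := by
      intro s t hst
      have h1 : nndist s t = t - s := by
        ext
        rw [coe_nndist, NNReal.dist_eq, NNReal.coe_sub hst, abs_sub_comm, abs_of_nonneg]
        exact sub_nonneg.2 (by exact_mod_cast hst)
      rw [h1]
      have h2 : P s - P t = P s * (1 - P (t - s)) := by
        rw [mul_sub, ← hadd, add_tsub_cancel_of_le hst, mul_one]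
      rw [h2, norm_sub_rev _ (1 : A)]
      exact (norm_mul_le _ _).trans (mul_le_of_le_one_left (norm_nonneg _) (hnorm s))
    intro s t
    rcases le_total s t with h | h
    · exact key s t h
    · rw [norm_sub_rev, nndist_comm]; exact key t s h
  have hPc : Continuous P := by
    rw [continuous_iff_continuousAt]
    intro t
    rw [ContinuousAt, tendsto_iff_norm_sub_tendsto_zero]
    have hd : Tendsto (fun s : ℝ≥0 => nndist s t) (𝓝 t) (𝓝 0) := by
      have : Continuous fun s : ℝ≥0 => nndist s t := by fun_prop
      simpa using this.tendsto t
    have h2 := (tendsto_iff_norm_sub_tendsto_zero.1 (hcont0.comp hd))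
    exact squeeze_zero (fun _ => norm_nonneg _) (fun s => hbound s t) h2
  set f : ℝ → A := fun s => P s.toNNReal with hf
  have hfc : Continuous f := hPc.comp continuous_real_toNNReal
  have hf0 : f 0 = 1 := by simp [hf, h0]
  set F : ℝ → A := fun x => ∫ s in (0 : ℝ)..x, f s with hF
  have hFd : ∀ x, HasDerivAt F (f x) x := fun x =>
    intervalIntegral.integral_hasDerivAt_right (hfc.intervalIntegrable _ _)
      (hfc.stronglyMeasurableAtFilter _ _) hfc.continuousAt
  obtain ⟨ε, hε, hεu⟩ : ∃ ε : ℝ, 0 < ε ∧ IsUnit (F ε) := by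
    have h1 := (hFd 0).tendsto_slope_zero_right
    rw [hf0] at h1
    have h2 : ∀ᶠ t in 𝓝[>] (0 : ℝ), IsUnit (t⁻¹ • (F (0 + t) - F 0)) :=
      h1.eventually (Units.isOpen.mem_nhds isUnit_one)
    obtain ⟨ε, hε1, hε2⟩ := (h2.and self_mem_nhdsWithin).exists
    refine ⟨ε, hε2, ?_⟩
    have h3 : F ε = (algebraMap ℝ A ε) * (ε⁻¹ • (F (0 + ε) - F 0)) := by
      have : F 0 = 0 := by simp [hF]
      rw [zero_add, this, sub_zero, ← Algebra.smul_def, smul_smul, mul_inv_cancel₀ (ne_of_gt hε2),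
        one_smul]
    rw [h3]
    exact ((IsUnit.mk0 ε (ne_of_gt hε2)).map (algebraMap ℝ A)).mul hε1
  obtain ⟨u, hu⟩ := hεu
  have hid : ∀ t : ℝ≥0, (P t - 1) * F ε = (F (ε + t) - F ε) - (F t - F 0) := by
    intro t
    have h1 : P t * F ε = ∫ s in (0 : ℝ)..ε, f (s + t) := by
      have h11 : P t * F ε = ∫ s in (0 : ℝ)..ε, P t * f s := by
        exact (((ContinuousLinearMap.mul ℝ A (P t)).intervalIntegral_comp_comm
          (hfc.intervalIntegrable 0 ε)).symm)
      rw [h11]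
      refine intervalIntegral.integral_congr fun s hs => ?_
      rw [Set.uIcc_of_le hε.le] at hs
      change P t * P s.toNNReal = P (s + t).toNNReal
      rw [Real.toNNReal_add hs.1 t.coe_nonneg, Real.toNNReal_coe, add_comm, hadd]
    have h2 : (∫ s in (0 : ℝ)..ε, f (s + t)) = F (ε + t) - F t := by
      rw [intervalIntegral.integral_comp_add_right f (t : ℝ), zero_add, hF]
      exact (intervalIntegral.integral_interval_sub_left (hfc.intervalIntegrable _ _)
        (hfc.intervalIntegrable _ _)).symm
    have h3 : F 0 = 0 := by simp [hF]
    rw [sub_mul, one_mul, h1, h2, h3]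
    abel
  refine ⟨(f ε - f 0) * ↑u⁻¹, ?_⟩
  have hcoe : Tendsto (fun t : ℝ≥0 => (t : ℝ)) (𝓝[>] 0) (𝓝[>] 0) := by
    refine tendsto_nhdsWithin_of_tendsto_nhds_of_eventually_within _ ?_ ?_
    · have := (NNReal.continuous_coe.tendsto 0).mono_left (nhdsWithin_le_nhds (s := Set.Ioi 0))
      simpa using this
    · filter_upwards [self_mem_nhdsWithin] with t ht using by exact_mod_cast ht
  have hlim := (((hFd ε).tendsto_slope_zero_right.comp hcoe).sub
    ((hFd 0).tendsto_slope_zero_right.comp hcoe)).mul_const (↑u⁻¹ : A)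
  refine hlim.congr fun t => ?_
  simp only [Function.comp, zero_add]
  rw [← smul_sub, ← hid t, smul_mul_assoc, ← hu, mul_assoc, Units.mul_inv, mul_one]

/-- With `h = s / (j + 1)`, `P s` is the power `P h ^ (j + 1)`. Telescoping bounds its distance from
`R h ^ (j + 1)` by `(j + 1) ‖P h - R h‖ = s · h⁻¹ ‖P h - R h‖`. Thus `R` need not be a semigroup:
agreement with `P` to first order at `0` suffices. -/
theorem tendsto_pow_of_semigroup {P R : ℝ≥0 → A} (h0 : P 0 = 1)
    (hadd : ∀ s t, P (s + t) = P s * P t) (hP : ∀ t, ‖P t‖ ≤ 1) (hR : ∀ t, ‖R t‖ ≤ 1)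
    (hR0 : R 0 = 1)
    (hPR : Tendsto (fun t : ℝ≥0 => (t : ℝ)⁻¹ • (P t - R t)) (𝓝[>] 0) (𝓝 0)) (s : ℝ≥0) :
    Tendsto (fun j : ℕ => R (s / (j + 1 : ℕ)) ^ (j + 1)) atTop (𝓝 (P s)) := by
  rcases eq_or_ne s 0 with rfl | hs
  · simp [hR0, h0]
  have hpow : ∀ (t : ℝ≥0) (j : ℕ), P (j * t) = P t ^ j := by
    intro t j
    induction j with
    | zero => simp [h0]
    | succ j ih => rw [Nat.cast_succ, add_mul, one_mul, hadd, ih, pow_succ]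
  have hPs : ∀ j : ℕ, P s = P (s / (j + 1 : ℕ)) ^ (j + 1) := by
    intro j
    rw [← hpow, mul_div_cancel₀]
    exact_mod_cast Nat.succ_ne_zero j
  have ht : Tendsto (fun j : ℕ => s / ((j + 1 : ℕ) : ℝ≥0)) atTop (𝓝[>] 0) := by
    refine tendsto_nhdsWithin_of_tendsto_nhds_of_eventually_within _ ?_ ?_
    · exact ((tendsto_const_div_atTop_nhds_zero_nat s).comp (tendsto_add_atTop_nat 1))
    · exact Eventually.of_forall fun j => div_pos (pos_iff_ne_zero.2 hs) (by positivity)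
  rw [tendsto_iff_norm_sub_tendsto_zero]
  have h1 := ((hPR.comp ht).norm).const_mul (s : ℝ)
  simp only [norm_zero, mul_zero] at h1
  refine squeeze_zero (fun _ => norm_nonneg _) (fun j => ?_) h1
  rw [hPs j]
  refine (norm_pow_sub_pow_le_mul (hR _) (hP _) _).trans (le_of_eq ?_)
  simp only [Function.comp, norm_smul, NNReal.coe_div, NNReal.coe_natCast, norm_div,
    Real.norm_natCast, inv_div, Real.norm_of_nonneg s.coe_nonneg]
  have : (s : ℝ) ≠ 0 := by exact_mod_cast hs
  rw [norm_sub_rev]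
  field_simp

end Semigroup

/-! ### Stochastic kernels on a finite set -/

/-- A transition function on a finite set. -/
structure IsStochastic {ι : Type*} [Fintype ι] (p : ι → ι → ℝ) : Prop where
  nonneg : ∀ x y, 0 ≤ p x y
  sum_eq_one : ∀ x, ∑ y, p x y = 1

section FiniteKernel

variable {ι : Type*} [Fintype ι] [DecidableEq ι]

/-- The operator on functions with matrix `p`. -/
noncomputable def kernelOp (p : ι → ι → ℝ) : (ι → ℝ) →L[ℝ] (ι → ℝ) :=
  ∑ x, ∑ y, p x y • ((ContinuousLinearMap.single ℝ (fun _ : ι => ℝ) x).comp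
    (ContinuousLinearMap.proj (R := ℝ) (φ := fun _ : ι => ℝ) y))

theorem kernelOp_apply (p : ι → ι → ℝ) (f : ι → ℝ) (x : ι) :
    kernelOp p f x = ∑ y, p x y * f y := by
  simp [kernelOp, Finset.sum_apply, Pi.single_apply, mul_ite]

theorem kernelOp_single (p : ι → ι → ℝ) (x y : ι) :
    kernelOp p (Pi.single y 1) x = p x y := by
  simp [kernelOp_apply, Pi.single_apply]

theorem kernelOp_one : kernelOp (fun x y : ι => if x = y then (1 : ℝ) else 0) = 1 := by
  ext f x
  simp [kernelOp_apply]

theorem kernelOp_mul (p q : ι → ι → ℝ) :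
    kernelOp p * kernelOp q = kernelOp fun x z => ∑ y, p x y * q y z := by
  ext f x
  simp only [mul_apply_eq_comp, kernelOp_apply, Finset.mul_sum, Finset.sum_mul]
  rw [Finset.sum_comm]
  simp [mul_assoc]

theorem IsStochastic.norm_kernelOp_le {p : ι → ι → ℝ} (hp : IsStochastic p) :
    ‖kernelOp p‖ ≤ 1 := by
  refine ContinuousLinearMap.opNorm_le_bound _ zero_le_one fun f => ?_
  rw [one_mul, pi_norm_le_iff_of_nonneg (norm_nonneg _)]
  intro x
  rw [kernelOp_apply]
  refine (norm_sum_le _ _).trans ?_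
  calc ∑ y, ‖p x y * f y‖ ≤ ∑ y, p x y * ‖f‖ := by
        refine Finset.sum_le_sum fun y _ => ?_
        rw [norm_mul, Real.norm_of_nonneg (hp.nonneg x y)]
        exact mul_le_mul_of_nonneg_left (norm_le_pi_norm f y) (hp.nonneg x y)
    _ = ‖f‖ := by rw [← Finset.sum_mul, hp.sum_eq_one, one_mul]

theorem tendsto_kernelOp {α : Type*} {l : Filter α} {p : α → ι → ι → ℝ} {q : ι → ι → ℝ}
    (h : ∀ x y, Tendsto (fun a => p a x y) l (𝓝 (q x y))) :
    Tendsto (fun a => kernelOp (p a)) l (𝓝 (kernelOp q)) :=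
  tendsto_finsetSum _ fun x _ => tendsto_finsetSum _ fun y _ => (h x y).smul_const _

theorem tendsto_of_tendsto_clm {α : Type*} {l : Filter α}
    {T : α → (ι → ℝ) →L[ℝ] (ι → ℝ)} {S : (ι → ℝ) →L[ℝ] (ι → ℝ)} (h : Tendsto T l (𝓝 S)) (x y : ι) :
    Tendsto (fun a => T a (Pi.single y 1) x) l (𝓝 (S (Pi.single y 1) x)) := by
  have hc : Continuous fun L : (ι → ℝ) →L[ℝ] (ι → ℝ) => L (Pi.single y 1) x := by fun_prop
  exact (hc.tendsto S).comp h

/-- A semigroup of transition functions on a finite set, continuous at time `0`. -/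
structure IsTransitionSemigroup (p : ℝ≥0 → ι → ι → ℝ) : Prop where
  stochastic : ∀ t, IsStochastic (p t)
  zero : ∀ x y, p 0 x y = if x = y then 1 else 0
  add : ∀ s t x z, p (s + t) x z = ∑ y, p s x y * p t y z
  cont : ∀ x, Tendsto (fun t => p t x x) (𝓝[>] 0) (𝓝 1)

theorem IsStochastic.diag_eq {p : ι → ι → ℝ} (hp : IsStochastic p) (x : ι) :
    p x x = 1 - ∑ y ∈ Finset.univ.erase x, p x y := by
  rw [← hp.sum_eq_one x, ← Finset.add_sum_erase _ _ (Finset.mem_univ x)]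
  ring

theorem IsTransitionSemigroup.tendsto_zero {p : ℝ≥0 → ι → ι → ℝ} (hp : IsTransitionSemigroup p)
    (x y : ι) : Tendsto (fun t => p t x y) (𝓝[>] 0) (𝓝 (if x = y then 1 else 0)) := by
  split_ifs with h
  · subst h; exact hp.cont x
  · have h1 : Tendsto (fun t => 1 - p t x x) (𝓝[>] 0) (𝓝 0) := by
      simpa using (hp.cont x).const_sub 1
    refine squeeze_zero (fun t => (hp.stochastic t).nonneg x y) (fun t => ?_) h1
    rw [(hp.stochastic t).diag_eq x, sub_sub_cancel]
    exact Finset.single_le_sum (fun z _ => (hp.stochastic t).nonneg x z)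
      (Finset.mem_erase.2 ⟨Ne.symm h, Finset.mem_univ y⟩)

/-- The rates are the off-diagonal entries of the generator. The diagonal is never needed, because
rows sum to one. -/
theorem IsTransitionSemigroup.exists_rates {p : ℝ≥0 → ι → ι → ℝ} (hp : IsTransitionSemigroup p) :
    ∃ q : ι → ι → ℝ, ∀ x y, x ≠ y →
      Tendsto (fun t : ℝ≥0 => (t : ℝ)⁻¹ * p t x y) (𝓝[>] 0) (𝓝 (q x y)) := by
  obtain ⟨Q, hQ⟩ := semigroup_hasDeriv_zero (P := fun t => kernelOp (p t))
    (by rw [← kernelOp_one]; congr 1; ext x y; exact hp.zero x y)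
    (by intro s t; rw [kernelOp_mul]; congr 1; ext x y; exact hp.add s t x y)
    (by rw [← kernelOp_one]; exact tendsto_kernelOp hp.tendsto_zero)
    (fun t => (hp.stochastic t).norm_kernelOp_le)
  refine ⟨fun x y => Q (Pi.single y 1) x, fun x y hxy => ?_⟩
  refine (tendsto_of_tendsto_clm hQ x y).congr fun t => ?_
  simp [kernelOp_single, hxy]

/-- `n`-step transition function. -/
noncomputable def kernelPow (r : ι → ι → ℝ) : ℕ → ι → ι → ℝ
  | 0 => fun x y => if x = y then 1 else 0
  | n + 1 => fun x z => ∑ y, kernelPow r n x y * r y z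

theorem kernelOp_kernelPow (r : ι → ι → ℝ) (n : ℕ) :
    kernelOp (kernelPow r n) = kernelOp r ^ n := by
  induction n with
  | zero => rw [pow_zero]; exact kernelOp_one
  | succ n ih => rw [pow_succ, ← ih, kernelOp_mul]; rfl

/-- A semigroup is the limit of the powers of any transition functions that have the same
rates. -/
theorem IsTransitionSemigroup.tendsto_kernelPow {p r : ℝ≥0 → ι → ι → ℝ}
    (hp : IsTransitionSemigroup p) {q : ι → ι → ℝ}
    (hpq : ∀ x y, x ≠ y → Tendsto (fun t : ℝ≥0 => (t : ℝ)⁻¹ * p t x y) (𝓝[>] 0) (𝓝 (q x y)))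
    (hr : ∀ t, IsStochastic (r t)) (hr0 : ∀ x y, r 0 x y = if x = y then 1 else 0)
    (hrq : ∀ x y, x ≠ y → Tendsto (fun t : ℝ≥0 => (t : ℝ)⁻¹ * r t x y) (𝓝[>] 0) (𝓝 (q x y)))
    (s : ℝ≥0) (x y : ι) :
    Tendsto (fun j : ℕ => kernelPow (r (s / (j + 1 : ℕ))) (j + 1) x y) atTop (𝓝 (p s x y)) := by
  have hoff : ∀ x y, x ≠ y →
      Tendsto (fun t : ℝ≥0 => (t : ℝ)⁻¹ * (p t x y - r t x y)) (𝓝[>] 0) (𝓝 0) := by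
    intro x y hxy
    have := (hpq x y hxy).sub (hrq x y hxy)
    simpa [mul_sub] using this
  -- On the diagonal the difference is minus the sum of the off-diagonal differences, as both
  -- kernels are stochastic.
  have hall : ∀ x y, Tendsto (fun t : ℝ≥0 => (t : ℝ)⁻¹ * (p t x y - r t x y)) (𝓝[>] 0) (𝓝 0) := by
    intro x y
    by_cases hxy : x = y
    · subst hxy
      have h1 : Tendsto (fun t : ℝ≥0 => -∑ y ∈ Finset.univ.erase x,
          (t : ℝ)⁻¹ * (p t x y - r t x y)) (𝓝[>] 0) (𝓝 (-∑ y ∈ Finset.univ.erase x, 0)) :=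
        (tendsto_finsetSum _ fun y hy => hoff x y (Finset.ne_of_mem_erase hy).symm).neg
      simp only [Finset.sum_const_zero, neg_zero] at h1
      refine h1.congr fun t => ?_
      rw [(hp.stochastic t).diag_eq, (hr t).diag_eq, ← Finset.mul_sum, Finset.sum_sub_distrib]
      ring
    · exact hoff x y hxy
  have key := tendsto_pow_of_semigroup (P := fun t => kernelOp (p t)) (R := fun t => kernelOp (r t))
    (by rw [← kernelOp_one]; congr 1; ext x y; exact hp.zero x y)
    (by intro s t; rw [kernelOp_mul]; congr 1; ext x y; exact hp.add s t x y)
    (fun t => (hp.stochastic t).norm_kernelOp_le) (fun t => (hr t).norm_kernelOp_le)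
    (by rw [← kernelOp_one]; congr 1; ext x y; exact hr0 x y)
    (by
      have h := tendsto_kernelOp hall
      have h0 : kernelOp (fun _ _ : ι => (0 : ℝ)) = 0 := by simp [kernelOp]
      rw [h0] at h
      refine h.congr fun t => ?_
      ext f x
      simp [kernelOp_apply, Finset.mul_sum, ← Finset.sum_sub_distrib, mul_sub, sub_mul, mul_assoc])
    s
  have h2 := tendsto_of_tendsto_clm key x y
  simp only [kernelOp_single] at h2
  refine h2.congr fun j => ?_
  rw [← kernelOp_kernelPow, kernelOp_single]

end FiniteKernel

end CutPaste

namespace CutPaste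

/-! ### Transition functions of the restricted chains -/

@[fun_prop]
theorem measurable_restrict_coloring {k : ℕ} (n : ℕ) : Measurable (restrict (k := k) n) :=
  measurable_pi_lambda _ fun j => measurable_pi_apply (j : ℕ)

theorem restrict_surjective {k : ℕ} (hk : 1 ≤ k) (n : ℕ) :
    Function.Surjective (restrict (k := k) n) := by
  intro y
  refine ⟨fun i => if h : i < n then y ⟨i, h⟩ else ⟨0, hk⟩, ?_⟩
  ext j
  simp [restrict]

theorem measurable_relabel {k : ℕ} (σ : Equiv.Perm ℕ) : Measurable (relabel (k := k) σ) :=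
  measurable_pi_lambda _ fun j => measurable_pi_apply (σ j)

section Transition

variable {k : ℕ} {Ω : Type*} [MeasurableSpace Ω] {Pr : Kernel (Coloring k) Ω}
  {X : ℝ≥0 → Ω → Coloring k} {n : ℕ} {p : ℝ≥0 → FinColoring k n → FinColoring k n → ℝ}

theorem pastSigma_le {Ω E : Type*} [m : MeasurableSpace Ω] [MeasurableSpace E] {Y : ℝ≥0 → Ω → E}
    (hY : ∀ t, Measurable (Y t)) (t : ℝ≥0) : pastSigma Y t ≤ m :=
  iSup₂_le fun s _ => (hY s).comap_le

theorem measurable_pastSigma {Ω E : Type*} [MeasurableSpace E] {Y : ℝ≥0 → Ω → E}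
    {s t : ℝ≥0} (h : s ≤ t) : Measurable[pastSigma Y t] (Y s) :=
  Measurable.mono (comap_measurable (Y s))
    (le_iSup₂_of_le (f := fun s (_ : s ≤ t) => MeasurableSpace.comap (Y s) inferInstance)
      s h le_rfl) le_rfl

/-- The function `p` is a transition function of the restriction to `[n]`. -/
def IsTransitionOf (Pr : Kernel (Coloring k) Ω) (X : ℝ≥0 → Ω → Coloring k) (n : ℕ)
    (p : ℝ≥0 → FinColoring k n → FinColoring k n → ℝ) : Prop :=
  ∀ x s t, ∀ y : FinColoring k n,
    (Pr x)⟦{ω | restrict n (X (t + s) ω) = y} | pastSigma (fun u ω => restrict n (X u ω)) t⟧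
      =ᵐ[Pr x] fun ω => p s (restrict n (X t ω)) y

/-- The Markov property without conditional expectations: on the part of `S` where the present state
is `z`, the conditional probability is the constant `p s z y`, and integration yields the product.
-/
theorem IsTransitionOf.real_inter (hX : IsMarkovProcess Pr X) (hp : IsTransitionOf Pr X n p)
    (x : Coloring k) (s t : ℝ≥0) (z y : FinColoring k n) {S : Set Ω}
    (hS : MeasurableSet[pastSigma (fun u ω => restrict n (X u ω)) t] S) :
    (Pr x).real ((S ∩ {ω | restrict n (X t ω) = z}) ∩ {ω | restrict n (X (t + s) ω) = y}) =
      (Pr x).real (S ∩ {ω | restrict n (X t ω) = z}) * p s z y := by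
  have := hX.prob x
  have hY : ∀ u, Measurable fun ω => restrict n (X u ω) := fun u =>
    (measurable_restrict_coloring n).comp (hX.measurable u)
  have hm := pastSigma_le hY t
  have hA : MeasurableSet {ω | restrict n (X (t + s) ω) = y} :=
    hY (t + s) (measurableSet_singleton y)
  have hz : MeasurableSet[pastSigma (fun u ω => restrict n (X u ω)) t]
      {ω | restrict n (X t ω) = z} :=
    measurable_pastSigma (Y := fun u ω => restrict n (X u ω)) le_rfl (measurableSet_singleton z)
  have hSz := MeasurableSet.inter hS hz
  have h1 := setIntegral_condExp (μ := Pr x) hm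
    ((integrable_const (1 : ℝ)).indicator hA) hSz
  rw [setIntegral_congr_ae (g := fun _ => p s z y) (hm _ hSz) ?_] at h1
  · rw [setIntegral_indicator hA] at h1
    simp only [setIntegral_const, smul_eq_mul, mul_one] at h1
    exact h1.symm
  · filter_upwards [hp x s t y] with ω hω hmem
    rw [hω, hmem.2]

theorem IsMarkovProcess.restrict_init (hX : IsMarkovProcess Pr X) (n : ℕ) (x : Coloring k) :
    {ω | restrict n (X 0 ω) = restrict n x} =ᵐ[Pr x] Set.univ := by
  rw [eventuallyEq_univ]
  filter_upwards [hX.init x] with ω hω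
  simp [hω]

theorem IsTransitionOf.real_eq (hX : IsMarkovProcess Pr X) (hp : IsTransitionOf Pr X n p)
    (x : Coloring k) (s : ℝ≥0) (y : FinColoring k n) :
    (Pr x).real {ω | restrict n (X s ω) = y} = p s (restrict n x) y := by
  have := hX.prob x
  have h := hp.real_inter hX x s 0 (restrict n x) y MeasurableSet.univ
  have h0 := hX.restrict_init n x
  rw [Set.univ_inter, zero_add, Set.inter_comm,
    measureReal_congr (inter_ae_eq_left_of_ae_eq_univ h0), measureReal_congr h0] at h
  simpa using h

/-- A conditional probability is only determined almost surely. Here every value of `p` is pinned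
down, since each finite coloring is the restriction of some deterministic initial state. Continuity
at `0` comes from right-continuity of the paths by dominated convergence. -/
theorem IsTransitionOf.isTransitionSemigroup (hk : 1 ≤ k) (hX : IsMarkovProcess Pr X)
    (hp : IsTransitionOf Pr X n p)
    (hstep : ∀ x, ∀ᵐ ω ∂(Pr x), IsStepPath fun t => restrict n (X t ω)) :
    IsTransitionSemigroup p := by
  have hY : ∀ u, Measurable fun ω => restrict n (X u ω) := fun u =>
    (measurable_restrict_coloring n).comp (hX.measurable u)
  have hYs : ∀ u z, MeasurableSet {ω | restrict n (X u ω) = z} := fun u z =>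
    hY u (measurableSet_singleton z)
  constructor
  · intro t
    constructor
    · intro x y
      obtain ⟨x, rfl⟩ := restrict_surjective hk n x
      rw [← hp.real_eq hX]
      exact measureReal_nonneg
    · intro x
      obtain ⟨x, rfl⟩ := restrict_surjective hk n x
      have := hX.prob x
      simp_rw [← hp.real_eq hX x t]
      have := sum_measureReal_preimage_singleton (μ := Pr x) Finset.univ
        (f := fun ω => restrict n (X t ω)) (fun y _ => hYs t y)
      simpa [Set.preimage] using this
  · intro x y
    obtain ⟨x, rfl⟩ := restrict_surjective hk n x
    have := hX.prob x
    rw [← hp.real_eq hX]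
    split_ifs with h
    · subst h
      rw [measureReal_congr (hX.restrict_init n x)]
      simp
    · rw [measureReal_def, measure_eq_zero_iff_ae_notMem.2, ENNReal.toReal_zero]
      filter_upwards [hX.init x] with ω hω using by simpa [hω] using h
  · intro s t x y
    obtain ⟨x, rfl⟩ := restrict_surjective hk n x
    have := hX.prob x
    rw [← hp.real_eq hX]
    have h1 : ∀ z, (Pr x).real ({ω | restrict n (X s ω) = z} ∩ {ω | restrict n (X (s + t) ω) = y})
        = p s (restrict n x) z * p t z y := by
      intro z
      have := hp.real_inter hX x t s z y MeasurableSet.univ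
      rwa [Set.univ_inter, hp.real_eq hX] at this
    simp_rw [← h1]
    have := sum_measureReal_preimage_singleton
      (μ := (Pr x).restrict {ω | restrict n (X (s + t) ω) = y}) Finset.univ
      (f := fun ω => restrict n (X s ω)) (fun y _ => hYs s y)
    simp only [Finset.coe_univ, Set.preimage_univ, measureReal_restrict_apply_univ] at this
    rw [← this]
    refine Finset.sum_congr rfl fun z _ => ?_
    exact measureReal_restrict_apply (hYs s z)
  · intro x
    obtain ⟨x, rfl⟩ := restrict_surjective hk n x
    have := hX.prob x
    simp_rw [← hp.real_eq hX]
    have h1 : ∀ t, (Pr x).real {ω | restrict n (X t ω) = restrict n x} =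
        ∫ ω, ({ω | restrict n (X t ω) = restrict n x}).indicator (fun _ => (1 : ℝ)) ω ∂(Pr x) := by
      intro t
      rw [integral_indicator (hYs t _)]
      simp
    simp_rw [h1]
    have h2 : (1 : ℝ) = ∫ _, (1 : ℝ) ∂(Pr x) := by simp
    rw [h2]
    refine tendsto_integral_filter_of_dominated_convergence (fun _ => 1) ?_ ?_
      (integrable_const _) ?_
    · exact Eventually.of_forall fun t =>
        (measurable_const.indicator (hYs t _)).aestronglyMeasurable
    · exact Eventually.of_forall fun t => Eventually.of_forall fun ω => by
        by_cases h : restrict n (X t ω) = restrict n x <;> simp [Set.indicator, h]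
    · filter_upwards [hX.init x, hstep x] with ω h0 hω
      refine tendsto_const_nhds.congr' ?_
      filter_upwards [hω.1 0] with t ht
      rw [h0] at ht
      simp [Set.indicator, ht]

end Transition

/-! ### Exchangeability of the transition functions -/

theorem IsFinitePerm.mul {σ τ : Equiv.Perm ℕ} (hσ : IsFinitePerm σ) (hτ : IsFinitePerm τ) :
    IsFinitePerm (σ * τ) := by
  refine (hσ.union hτ).subset fun j hj => ?_
  by_contra h
  simp only [Set.mem_union, Set.mem_ofPred_eq, not_or, not_not] at h
  exact hj (by rw [Equiv.Perm.mul_apply, h.2, h.1])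

theorem isFinitePerm_swap (a b : ℕ) : IsFinitePerm (Equiv.swap a b) := by
  refine (Set.toFinite {a, b}).subset fun j hj => ?_
  by_contra h
  simp only [Set.mem_insert_iff, Set.mem_singleton_iff, not_or] at h
  exact hj (Equiv.swap_apply_of_ne_of_ne h.1 h.2)

theorem exists_finitePerm_extending {n : ℕ} (ι : Fin n → ℕ) (hι : Function.Injective ι) :
    ∃ σ : Equiv.Perm ℕ, IsFinitePerm σ ∧ ∀ i : Fin n, σ i = ι i := by
  induction n with
  | zero => exact ⟨1, by simp [IsFinitePerm], fun i => i.elim0⟩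
  | succ n ih =>
    obtain ⟨σ, hσ, h⟩ := ih (fun i => ι i.castSucc) (hι.comp (Fin.castSucc_injective n))
    -- The swap corrects the value at `n`; the earlier values `σ i = ι i` differ from both swapped
    -- points, by injectivity of `σ` and of `ι`.
    refine ⟨Equiv.swap (σ n) (ι (Fin.last n)) * σ, (isFinitePerm_swap _ _).mul hσ, fun i => ?_⟩
    refine Fin.lastCases ?_ (fun i => ?_) i
    · simp
    · rw [Equiv.Perm.mul_apply, Fin.val_castSucc, h i]
      refine Equiv.swap_apply_of_ne_of_ne ?_ ?_
      · rw [← h i]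
        exact fun he => absurd (σ.injective he) i.2.ne
      · exact fun he => absurd (hι he) (Fin.castSucc_lt_last i).ne

/-- The uniform law on `[k]`. -/
noncomputable def uniformColor (k : ℕ) : Measure (Fin k) := (k : ℝ≥0∞)⁻¹ • Measure.count

theorem isProbabilityMeasure_uniformColor {k : ℕ} (hk : 1 ≤ k) :
    IsProbabilityMeasure (uniformColor k) := by
  constructor
  have : (k : ℝ≥0∞) ≠ 0 := by exact_mod_cast (by omega : k ≠ 0)
  simp [uniformColor, Measure.count_apply_finite', ENNReal.inv_mul_cancel this]

/-- The law of independent uniform colors. -/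
noncomputable def uniformColoring (k : ℕ) : Measure (Coloring k) :=
  Measure.infinitePi fun _ => uniformColor k

theorem isExchangeableLaw_uniformColoring {k : ℕ} (hk : 1 ≤ k) :
    IsExchangeableLaw (uniformColoring k) := by
  intro σ _
  have := isProbabilityMeasure_uniformColor hk
  exact Measure.map_infinitePi_infinitePi_of_inj (P := fun _ : ℕ => uniformColor k) σ.injective

/-- Full support is the reason for choosing the uniform law: an identity under this exchangeable
initial law can be localized to any finite piece of an initial state. -/
theorem uniformColoring_cylinder_ne_zero {k : ℕ} (hk : 1 ≤ k) (n : ℕ) (y : FinColoring k n) :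
    uniformColoring k {x | restrict n x = y} ≠ 0 := by
  have := isProbabilityMeasure_uniformColor hk
  obtain ⟨x, rfl⟩ := restrict_surjective hk n y
  have h : {z : Coloring k | restrict n z = restrict n x} =
      Set.pi (Finset.range n : Set ℕ) fun i => {x i} := by
    ext z
    simp only [Set.mem_ofPred_eq, Set.mem_pi, Finset.coe_range, Set.mem_Iio,
      Set.mem_singleton_iff, funext_iff, restrict]
    exact ⟨fun h i hi => h ⟨i, hi⟩, fun h i => h i i.2⟩
  rw [h, uniformColoring, Measure.infinitePi_pi _ (fun _ _ => measurableSet_singleton _)]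
  rw [Finset.prod_ne_zero_iff]
  intro i _
  simp [uniformColor]

section Exchangeable

variable {k : ℕ} {Ω : Type*} [MeasurableSpace Ω] {Pr : Kernel (Coloring k) Ω}
  {X : ℝ≥0 → Ω → Coloring k}

theorem pathLaw_apply (hX : IsMarkovProcess Pr X) (μ : Measure (Coloring k))
    {S : Set (ℝ≥0 → Coloring k)} (hS : MeasurableSet S) :
    pathLaw Pr X μ S = ∫⁻ x, Pr x {ω | (fun t => X t ω) ∈ S} ∂μ := by
  have hm : Measurable fun ω t => X t ω := measurable_pi_lambda _ hX.measurable
  rw [pathLaw, Measure.map_apply hm hS, Measure.bind_apply (hm hS) Pr.measurable.aemeasurable]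
  rfl

/-- The law at a fixed time of the coordinates with indices `ι` depends on the initial state only
through these coordinates, and it does not depend on `ι` otherwise. -/
theorem IsExchangeable.real_injective (hk : 1 ≤ k) (hX : IsMarkovProcess Pr X)
    (hexch : IsExchangeable Pr X)
    {p : ∀ n, ℝ≥0 → FinColoring k n → FinColoring k n → ℝ}
    (hp : ∀ n, IsTransitionOf Pr X n (p n)) {n : ℕ} {ι : Fin n → ℕ} (hι : Function.Injective ι)
    (x : Coloring k) (t : ℝ≥0) (y : FinColoring k n) :
    (Pr x).real {ω | ∀ i, X t ω (ι i) = y i} = p n t (fun i => x (ι i)) y := by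
  obtain ⟨σ, hσ, hσι⟩ := exists_finitePerm_extending ι hι
  obtain ⟨m, hm⟩ : ∃ m, ∀ i, ι i < m := by
    obtain ⟨b, hb⟩ := (Set.finite_range ι).bddAbove
    exact ⟨b + 1, fun i => Nat.lt_succ_of_le (hb ⟨i, rfl⟩)⟩
  have hprob := hX.prob
  have := isProbabilityMeasure_uniformColor hk
  have hμ : IsProbabilityMeasure (uniformColoring k) := by
    unfold uniformColoring; infer_instance
  -- For the relabeled process, `σ⁻¹` undoes the relabeling at time `0`: `S` says that `X` starts
  -- like `x` on `[m]` and has colors `y` at the sites `ι` at time `t`. For `X` itself, `S` forces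
  -- the initial colors on `[n]` to be those of `x` at the sites `ι`, and asks for `y` on `[n]`.
  -- Exchangeability equates the two probabilities.
  set S : Set (ℝ≥0 → Coloring k) :=
    {w | restrict m (relabel σ⁻¹ (w 0)) = restrict m x ∧ restrict n (w t) = y} with hSdef
  have hS : MeasurableSet S := by
    have h1 : Measurable fun w : ℝ≥0 → Coloring k => restrict m (relabel σ⁻¹ (w 0)) :=
      (measurable_restrict_coloring m).comp ((measurable_relabel σ⁻¹).comp (measurable_pi_apply 0))
    have h2 : Measurable fun w : ℝ≥0 → Coloring k => restrict n (w t) :=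
      (measurable_restrict_coloring n).comp (measurable_pi_apply t)
    exact (measurableSet_eq_fun h1 measurable_const).inter
      (measurableSet_eq_fun h2 measurable_const)
  have hrel : ∀ z : Coloring k, relabel σ⁻¹ (relabel σ z) = z := by
    intro z; ext j; simp [relabel]
  have hrel' : ∀ z : Coloring k, relabel σ (relabel σ⁻¹ z) = z := by
    intro z; ext j; simp [relabel]
  -- events at time `t` that depend on the first `m` coordinates
  have hdep : ∀ z : Coloring k, restrict m z = restrict m x →
      Pr z {ω | ∀ i, X t ω (ι i) = y i} = Pr x {ω | ∀ i, X t ω (ι i) = y i} := by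
    intro z hz
    have key : ∀ w : Coloring k, (Pr w).real {ω | ∀ i, X t ω (ι i) = y i} =
        ∑ y' : FinColoring k m with ∀ i, y' ⟨ι i, hm i⟩ = y i, p m t (restrict m w) y' := by
      intro w
      have h1 := sum_measureReal_preimage_singleton (μ := Pr w)
        {y' : FinColoring k m | ∀ i, y' ⟨ι i, hm i⟩ = y i}.toFinset
        (f := fun ω => restrict m (X t ω)) (fun y _ =>
          ((measurable_restrict_coloring m).comp (hX.measurable t)) (measurableSet_singleton y))
      simp_rw [← (hp m).real_eq hX w t]
      have h2 : {ω | ∀ i, X t ω (ι i) = y i} = (fun ω => restrict m (X t ω)) ⁻¹'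
          {y' : FinColoring k m | ∀ i, y' ⟨ι i, hm i⟩ = y i} := by
        ext ω; simp [restrict]
      rw [h2, ← Set.coe_toFinset {y' : FinColoring k m | ∀ i, y' ⟨ι i, hm i⟩ = y i}, ← h1]
      refine Finset.sum_congr ?_ fun _ _ => rfl
      ext; simp
    rw [← measureReal_eq_measureReal_iff, key z, key x, hz]
  have hL : pathLaw Pr (fun t ω => relabel σ (X t ω)) (uniformColoring k) S =
      Pr x {ω | ∀ i, X t ω (ι i) = y i} *
        uniformColoring k {z | restrict m z = restrict m x} := by
    have h1 : pathLaw Pr (fun t ω => relabel σ (X t ω)) (uniformColoring k) S =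
        pathLaw Pr X (uniformColoring k) ((fun w t => relabel σ (w t)) ⁻¹' S) := by
      have hm1 : Measurable fun (w : ℝ≥0 → Coloring k) t => relabel σ (w t) :=
        measurable_pi_lambda _ fun t => (measurable_relabel σ).comp (measurable_pi_apply t)
      rw [pathLaw, pathLaw, Measure.map_apply (f := fun ω t => relabel σ (X t ω))
          (hm1.comp (measurable_pi_lambda _ hX.measurable)) hS,
        Measure.map_apply (measurable_pi_lambda _ hX.measurable) (hm1 hS)]
      rfl
    have hm1 : Measurable fun (w : ℝ≥0 → Coloring k) t => relabel σ (w t) :=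
      measurable_pi_lambda _ fun t => (measurable_relabel σ).comp (measurable_pi_apply t)
    rw [h1, pathLaw_apply hX _ (hm1 hS), ← setLIntegral_const, ← lintegral_indicator]
    · refine lintegral_congr fun z => ?_
      by_cases hz : restrict m z = restrict m x
      · rw [Set.indicator_of_mem (by exact hz), ← hdep z hz]
        refine measure_congr (eventuallyEq_set.2 ?_)
        filter_upwards [hX.init z] with ω hω
        change (restrict m (relabel σ⁻¹ (relabel σ (X 0 ω))) = restrict m x ∧
          restrict n (relabel σ (X t ω)) = y) ↔ _
        rw [hrel, hω]
        simp [hz, funext_iff, restrict, relabel, hσι]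
      · rw [Set.indicator_of_notMem (by exact hz), measure_eq_zero_iff_ae_notMem]
        filter_upwards [hX.init z] with ω hω hmem
        have h2 : restrict m (relabel σ⁻¹ (relabel σ (X 0 ω))) = restrict m x := hmem.1
        rw [hrel, hω] at h2
        exact hz h2
    · exact (measurable_restrict_coloring m) (measurableSet_singleton _)
  have hR : pathLaw Pr X (uniformColoring k) S =
      ENNReal.ofReal (p n t (fun i => x (ι i)) y) *
        uniformColoring k {z | restrict m (relabel σ⁻¹ z) = restrict m x} := by
    rw [pathLaw_apply hX _ hS, ← setLIntegral_const, ← lintegral_indicator]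
    · refine lintegral_congr fun z => ?_
      by_cases hz : restrict m (relabel σ⁻¹ z) = restrict m x
      · rw [Set.indicator_of_mem (by exact hz)]
        have h1 : restrict n z = fun i => x (ι i) := by
          rw [← hrel' z]
          ext i
          have := congrFun hz ⟨ι i, hm i⟩
          simp only [restrict, relabel] at this ⊢
          rw [hσι, ← this]
        rw [← h1, ← (hp n).real_eq hX z t y, ofReal_measureReal]
        refine measure_congr (eventuallyEq_set.2 ?_)
        filter_upwards [hX.init z] with ω hω
        change (restrict m (relabel σ⁻¹ (X 0 ω)) = restrict m x ∧ _) ↔ _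
        rw [hω]
        simp [hz]
      · rw [Set.indicator_of_notMem (by exact hz), measure_eq_zero_iff_ae_notMem]
        filter_upwards [hX.init z] with ω hω hmem
        have h2 : restrict m (relabel σ⁻¹ (X 0 ω)) = restrict m x := hmem.1
        rw [hω] at h2
        exact hz h2
    · exact ((measurable_restrict_coloring m).comp (measurable_relabel _))
        (measurableSet_singleton _)
  have hσ' : IsFinitePerm σ⁻¹ := by
    refine hσ.subset fun j hj hc => hj ?_
    rw [Equiv.Perm.inv_eq_iff_eq]; exact hc.symm
  have hinv : uniformColoring k {z | restrict m (relabel σ⁻¹ z) = restrict m x} =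
      uniformColoring k {z | restrict m z = restrict m x} := by
    conv_rhs => rw [← isExchangeableLaw_uniformColoring hk σ⁻¹ hσ']
    rw [Measure.map_apply (measurable_relabel _)
      (measurableSet_eq_fun (measurable_restrict_coloring m) measurable_const)]
    rfl
  have hE : pathLaw Pr (fun t ω => relabel σ (X t ω)) (uniformColoring k) S =
      pathLaw Pr X (uniformColoring k) S := congrArg (fun ν => ν S)
    (hexch (uniformColoring k) hμ (isExchangeableLaw_uniformColoring hk) σ hσ)
  -- The masses of the two initial cylinders coincide by exchangeability of the uniform law, and
  -- they are positive, so they cancel.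
  rw [hL, hR, hinv, ENNReal.mul_left_inj (uniformColoring_cylinder_ne_zero hk m _)
    (measure_ne_top _ _)] at hE
  rw [measureReal_def, hE, ENNReal.toReal_ofReal]
  have h1 := (hp n).real_eq hX (relabel σ x) t y
  have h2 : restrict n (relabel σ x) = fun i => x (ι i) := by
    ext i; simp [restrict, relabel, hσι]
  rw [h2] at h1
  rw [← h1]
  exact measureReal_nonneg

end Exchangeable

end CutPaste

namespace CutPaste

/-! ### Limits of finite measures on clopen sets -/

/-- On a compact space, a limit on a class of clopen sets extends to a measure. -/
theorem exists_measure_of_tendsto_isClopen {E α : Type*} [MeasurableSpace E] [TopologicalSpace E]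
    [T2Space E] [BorelSpace E] [CompactSpace E] {l : Filter α} [l.NeBot]
    (ν : α → Measure E) [hfin : ∀ a, IsFiniteMeasure (ν a)] {𝒞 : Set (Set E)} (hC : ∀ C ∈ 𝒞, IsClopen C)
    (huniv : Set.univ ∈ 𝒞) {c : Set E → ℝ}
    (h : ∀ C ∈ 𝒞, Tendsto (fun a => (ν a).real C) l (𝓝 (c C))) :
    ∃ χ : Measure E, IsFiniteMeasure χ ∧ ∀ C ∈ 𝒞, χ.real C = c C := by
  let ν' : α → FiniteMeasure E := fun a => (⟨ν a, hfin a⟩ : FiniteMeasure E)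
  -- The masses are eventually bounded, so by compactness the measures converge weakly along an
  -- ultrafilter finer than `l`. Indicators of clopen sets are continuous, hence values on these
  -- sets pass to the limit.
  set u := Ultrafilter.of l
  have hu : (u : Filter α) ≤ l := Ultrafilter.of_le l
  have hmass : ∀ᶠ a in (u : Filter α), (ν' a).mass ≤ (c Set.univ + 1).toNNReal := by
    have h1 := ((h _ huniv).mono_left hu).eventually (gt_mem_nhds (lt_add_one _))
    filter_upwards [h1] with a ha
    refine NNReal.le_toNNReal_of_coe_le ?_
    exact ha.le
  obtain ⟨χ, -, hχ⟩ := (isCompact_setOfPred_finiteMeasure_le_of_compactSpace E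
    ((c Set.univ + 1).toNNReal)).ultrafilter_le_nhds (u.map ν') (by
      rw [Ultrafilter.coe_map, le_principal_iff, mem_map]
      exact hmass)
  have hχ' : Tendsto ν' (u : Filter α) (𝓝 χ) := hχ
  refine ⟨χ, inferInstance, fun C hCC => ?_⟩
  have h1 := FiniteMeasure.tendsto_iff_forall_integral_tendsto.1 hχ'
    (BoundedContinuousFunction.indicator C (hC C hCC))
  have h2 : ∀ μ : Measure E, ∫ x, (BoundedContinuousFunction.indicator C (hC C hCC)) x ∂μ =
      μ.real C := by
    intro μ
    rw [show (∫ x, (BoundedContinuousFunction.indicator C (hC C hCC)) x ∂μ) =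
      ∫ x, C.indicator 1 x ∂μ from rfl, integral_indicator (hC C hCC).isOpen.measurableSet]
    simp
  simp_rw [h2] at h1
  exact tendsto_nhds_unique h1 ((h C hCC).mono_left hu)

/-! ### Cylinders of coset maps -/

/-- The set of the `M` with `M^[n] ∈ S`. -/
def cosetCylinder {k : ℕ} (n : ℕ) (S : Set (FinCosetMap k n)) : Set (CosetMap k) :=
  {M | M.restrict n ∈ S}

/-- The restriction from `[m]` to `[n]`. -/
def FinCosetMap.truncate {k n m : ℕ} (h : n ≤ m) (M : FinCosetMap k m) : FinCosetMap k n :=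
  fun i j => M i (Fin.castLE h j)

theorem truncate_restrict {k n m : ℕ} (h : n ≤ m) (M : CosetMap k) :
    (M.restrict m).truncate h = M.restrict n := rfl

theorem restrict_idMap (k n : ℕ) : (idMap k).restrict n = finIdMap k n := rfl

theorem restrict_eq_finIdMap_of_le {k n m : ℕ} (h : n ≤ m) {M : CosetMap k}
    (hM : M.restrict m = finIdMap k m) : M.restrict n = finIdMap k n := by
  rw [← truncate_restrict h, hM]; rfl

theorem restrict_zero_eq {k : ℕ} (M : CosetMap k) : M.restrict 0 = finIdMap k 0 := by
  ext i j; exact j.elim0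

theorem eq_idMap_of_restrict {k : ℕ} {M : CosetMap k} (h : ∀ n, M.restrict n = finIdMap k n) :
    M = idMap k := by
  ext i j
  have := congrFun (congrFun (h (j + 1)) i) ⟨j, Nat.lt_succ_self j⟩
  simpa [CosetMap.restrict, restrict, finIdMap, idMap] using congrArg Fin.val this

@[fun_prop]
theorem continuous_cosetMap_restrict {k : ℕ} (n : ℕ) :
    Continuous (CosetMap.restrict (k := k) n) :=
  continuous_pi fun i => continuous_pi fun j => (continuous_apply (j : ℕ)).comp (continuous_apply i)

@[fun_prop]
theorem measurable_cosetMap_restrict {k : ℕ} (n : ℕ) :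
    Measurable (CosetMap.restrict (k := k) n) :=
  (continuous_cosetMap_restrict n).measurable

theorem isClopen_cosetCylinder {k : ℕ} (n : ℕ) (S : Set (FinCosetMap k n)) :
    IsClopen (cosetCylinder n S) :=
  (isClopen_discrete S).preimage (continuous_cosetMap_restrict n)

theorem measurableSet_cosetCylinder {k : ℕ} (n : ℕ) (S : Set (FinCosetMap k n)) :
    MeasurableSet (cosetCylinder n S) :=
  (isClopen_cosetCylinder n S).isOpen.measurableSet

/-- The `M` that act trivially on `[j]` but not on `[j + 1]`. -/
def levelSet (k j : ℕ) : Set (CosetMap k) :=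
  {M | M.restrict j = finIdMap k j ∧ M.restrict (j + 1) ≠ finIdMap k (j + 1)}

theorem measurableSet_levelSet (k j : ℕ) : MeasurableSet (levelSet k j) :=
  (measurableSet_cosetCylinder j {finIdMap k j}).inter
    (measurableSet_cosetCylinder (j + 1) {finIdMap k (j + 1)}ᶜ)

/-- A level excludes the identity, so any cylinder cut down to a level, even the whole space, is a
cylinder for which rates are available. -/
theorem exists_inter_levelSet_eq {k n : ℕ} (S : Set (FinCosetMap k n)) (j : ℕ) :
    ∃ S' : Set (FinCosetMap k (max n (j + 1))), finIdMap k _ ∉ S' ∧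
      cosetCylinder n S ∩ levelSet k j = cosetCylinder _ S' := by
  refine ⟨{M | M.truncate (le_max_left _ _) ∈ S ∧
    M.truncate ((Nat.le_succ j).trans (le_max_right n (j + 1))) = finIdMap k j ∧
    M.truncate (le_max_right n (j + 1)) ≠ finIdMap k (j + 1)}, ?_, ?_⟩
  · exact fun h => h.2.2 rfl
  · ext M; rfl

/-- The level of `M` is one less than the first `m` for which `M` is nontrivial on `[m]`. A map that
is nontrivial on `[n]` has level below `n`, so finitely many levels are enough. -/
theorem iUnion_inter_levelSet {k n : ℕ} {S : Set (FinCosetMap k n)} (hS : finIdMap k n ∉ S) :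
    ⋃ j ∈ Finset.range n, cosetCylinder n S ∩ levelSet k j = cosetCylinder n S := by
  refine Set.Subset.antisymm (Set.iUnion₂_subset fun j _ => Set.inter_subset_left) fun M hM => ?_
  have hne : M.restrict n ≠ finIdMap k n := fun h => hS (h ▸ hM)
  classical
  have hex : ∃ m, M.restrict m ≠ finIdMap k m := ⟨n, hne⟩
  have hpos : Nat.find hex ≠ 0 := by
    intro h0
    have := Nat.find_spec hex
    rw [h0] at this
    exact this (restrict_zero_eq M)
  obtain ⟨j, hj⟩ := Nat.exists_eq_succ_of_ne_zero hpos
  have hle : Nat.find hex ≤ n := Nat.find_min' hex hne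
  simp only [Set.mem_iUnion]
  refine ⟨j, Finset.mem_range.2 (by omega), hM, ?_, ?_⟩
  · by_contra h
    have := Nat.find_min' hex h
    omega
  · have := Nat.find_spec hex
    rwa [hj] at this

theorem disjoint_levelSet (k : ℕ) : Pairwise (Function.onFun Disjoint (levelSet k)) := by
  have key : ∀ i j, i < j → Disjoint (levelSet k i) (levelSet k j) := by
    intro i j hij
    rw [Set.disjoint_left]
    intro M hi hj
    exact hi.2 (restrict_eq_finIdMap_of_le hij hj.1)
  intro i j hij
  rcases lt_or_gt_of_ne hij with h | h
  · exact key i j h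
  · exact (key j i h).symm

theorem cosetCylinder_inter_levelSet_eq_empty {k n j : ℕ} (h : n ≤ j) {S : Set (FinCosetMap k n)}
    (hS : finIdMap k n ∉ S) : cosetCylinder n S ∩ levelSet k j = ∅ := by
  rw [Set.eq_empty_iff_forall_notMem]
  rintro M ⟨hM, hMj⟩
  have h1 := restrict_eq_finIdMap_of_le h hMj.1
  exact hS (h1 ▸ hM)

/-! ### The measure of rates -/

/-- If the rates of all finite restrictions exist, then they are the values of a measure. -/
theorem exists_rate_measure {k : ℕ} (π : ℝ≥0 → Measure (CosetMap k)) [∀ t, IsFiniteMeasure (π t)]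
    (hπ : ∀ n, ∀ m : FinCosetMap k n, m ≠ finIdMap k n → ∃ r : ℝ,
      Tendsto (fun t : ℝ≥0 => (t : ℝ)⁻¹ * (π t).real (cosetCylinder n {m})) (𝓝[>] 0) (𝓝 r)) :
    ∃ χ : Measure (CosetMap k), SFinite χ ∧ χ {idMap k} = 0 ∧
      ∀ n, ∀ S : Set (FinCosetMap k n), finIdMap k n ∉ S → χ (cosetCylinder n S) ≠ ∞ ∧
        Tendsto (fun t : ℝ≥0 => (t : ℝ)⁻¹ * (π t).real (cosetCylinder n S)) (𝓝[>] 0)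
          (𝓝 (χ.real (cosetCylinder n S))) := by
  classical
  have hlim : ∀ n, ∀ S : Set (FinCosetMap k n), finIdMap k n ∉ S → ∃ r : ℝ,
      Tendsto (fun t : ℝ≥0 => (t : ℝ)⁻¹ * (π t).real (cosetCylinder n S)) (𝓝[>] 0) (𝓝 r) := by
    intro n S hS
    have h1 : ∀ m : FinCosetMap k n, ∃ r : ℝ, m ≠ finIdMap k n →
        Tendsto (fun t : ℝ≥0 => (t : ℝ)⁻¹ * (π t).real (cosetCylinder n {m})) (𝓝[>] 0) (𝓝 r) := by
      intro m
      by_cases hm : m = finIdMap k n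
      · exact ⟨0, fun h => absurd hm h⟩
      · obtain ⟨r, hr⟩ := hπ n m hm
        exact ⟨r, fun _ => hr⟩
    choose r hr using h1
    refine ⟨∑ m ∈ S.toFinset, r m, ?_⟩
    have h2 := tendsto_finsetSum S.toFinset fun m hm =>
      hr m (fun h => hS (h ▸ Set.mem_toFinset.1 hm))
    refine h2.congr fun t => ?_
    rw [← Finset.mul_sum]
    congr 1
    have h3 := sum_measureReal_preimage_singleton (μ := π t) S.toFinset
      (f := CosetMap.restrict (k := k) n)
      (fun y _ => (measurable_cosetMap_restrict n) (measurableSet_singleton y))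
    rw [Set.coe_toFinset] at h3
    exact h3
  -- The total rate may be infinite, which rules out compactness for the whole family. Restricted to
  -- one level, the total rate is finite.
  have hlevel : ∀ j, ∃ χ : Measure (CosetMap k), IsFiniteMeasure χ ∧
      ∀ n, ∀ S : Set (FinCosetMap k n),
        Tendsto (fun t : ℝ≥0 => (t : ℝ)⁻¹ * (π t).real (cosetCylinder n S ∩ levelSet k j)) (𝓝[>] 0)
          (𝓝 (χ.real (cosetCylinder n S))) := by
    intro j
    have hl : ∀ C ∈ {C : Set (CosetMap k) | ∃ n S, C = cosetCylinder n S}, ∃ r : ℝ,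
        Tendsto (fun t : ℝ≥0 => (t : ℝ)⁻¹ * (π t).real (C ∩ levelSet k j)) (𝓝[>] 0) (𝓝 r) := by
      rintro C ⟨n, S, rfl⟩
      obtain ⟨S', hS', he⟩ := exists_inter_levelSet_eq S j
      rw [he]
      exact hlim _ S' hS'
    choose! c hc using hl
    let ν : ℝ≥0 → Measure (CosetMap k) := fun t => t⁻¹ • (π t).restrict (levelSet k j)
    have hν : ∀ t, ∀ n, ∀ S : Set (FinCosetMap k n), (ν t).real
        (cosetCylinder n S) = (t : ℝ)⁻¹ * (π t).real (cosetCylinder n S ∩ levelSet k j) := by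
      intro t n S
      rw [measureReal_nnreal_smul_apply,
        measureReal_restrict_apply (measurableSet_cosetCylinder n S), NNReal.coe_inv]
    obtain ⟨χ, hχf, hχ⟩ := exists_measure_of_tendsto_isClopen (l := 𝓝[>] (0 : ℝ≥0)) ν
      (𝒞 := {C : Set (CosetMap k) | ∃ n S, C = cosetCylinder n S}) (c := c)
      (by rintro C ⟨n, S, rfl⟩; exact isClopen_cosetCylinder n S)
      ⟨0, Set.univ, rfl⟩
      (by
        intro C hC
        refine (hc C hC).congr fun t => ?_
        obtain ⟨n, S, rfl⟩ := hC
        rw [hν])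
    refine ⟨χ, hχf, fun n S => ?_⟩
    rw [hχ _ ⟨n, S, rfl⟩]
    exact hc _ ⟨n, S, rfl⟩
  choose χ hχf hχ using hlevel
  have hzero : ∀ n j, ∀ S : Set (FinCosetMap k n), cosetCylinder n S ∩ levelSet k j = ∅ →
      χ j (cosetCylinder n S) = 0 := by
    intro n j S he
    have h1 := hχ j n S
    simp only [he, measureReal_empty, mul_zero] at h1
    have h2 := tendsto_nhds_unique h1 tendsto_const_nhds
    exact (measureReal_eq_zero_iff).1 h2
  -- The identity has no mass: the cylinder of maps trivial on `[j + 1]` contains it and misses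
  -- level `j`, so its limiting rate there is zero.
  refine ⟨Measure.sum χ, inferInstance, ?_, ?_⟩
  · rw [Measure.sum_apply _ (measurableSet_singleton _), ENNReal.tsum_eq_zero]
    intro j
    refine measure_mono_null (t := cosetCylinder (j + 1) {finIdMap k (j + 1)}) ?_
      (hzero _ _ _ ?_)
    · rintro M rfl; exact restrict_idMap k _
    · rw [Set.eq_empty_iff_forall_notMem]
      rintro M ⟨hM, hMj⟩
      exact hMj.2 hM
  · intro n S hS
    have hsum : Measure.sum χ (cosetCylinder n S) =
        ∑ j ∈ Finset.range n, χ j (cosetCylinder n S) := by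
      rw [Measure.sum_apply _ (measurableSet_cosetCylinder n S)]
      refine tsum_eq_sum fun j hj => hzero _ _ _ ?_
      exact cosetCylinder_inter_levelSet_eq_empty (by simpa using hj) hS
    have hfin : ∀ j ∈ Finset.range n, χ j (cosetCylinder n S) ≠ ∞ := fun j _ => measure_ne_top _ _
    refine ⟨?_, ?_⟩
    · rw [hsum]
      exact ENNReal.sum_ne_top.2 hfin
    · have h1 := tendsto_finsetSum (Finset.range n) fun j _ => hχ j n S
      rw [measureReal_def, hsum, ENNReal.toReal_sum hfin]
      refine h1.congr fun t => ?_
      rw [← Finset.mul_sum]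
      congr 1
      conv_rhs => rw [← iUnion_inter_levelSet hS]
      rw [measureReal_biUnion_finset]
      · intro i _ j _ hij
        exact (disjoint_levelSet k hij).mono Set.inter_subset_right Set.inter_subset_right
      · exact fun j _ => (measurableSet_cosetCylinder n S).inter (measurableSet_levelSet k j)

/-- A measure without an atom at the identity is determined by the cylinders that do not contain
the identity. -/
theorem measure_ext_of_cosetCylinder {k : ℕ} {χ χ' : Measure (CosetMap k)}
    (h0 : χ {idMap k} = 0) (h0' : χ' {idMap k} = 0)
    (hfin : ∀ n, χ (cosetCylinder n {finIdMap k n}ᶜ) ≠ ∞)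
    (h : ∀ n, ∀ S : Set (FinCosetMap k n), finIdMap k n ∉ S →
      χ (cosetCylinder n S) = χ' (cosetCylinder n S)) : χ = χ' := by
  have hid : ∀ ν : Measure (CosetMap k), ν {idMap k} = 0 →
      ν.restrict {idMap k}ᶜ = ν := by
    intro ν hν
    rw [Measure.restrict_eq_self_of_ae_mem]
    rw [ae_iff]
    simpa using hν
  have hU : ({idMap k}ᶜ : Set (CosetMap k)) = ⋃ n, cosetCylinder n {finIdMap k n}ᶜ := by
    ext M
    simp only [Set.mem_compl_iff, Set.mem_singleton_iff, Set.mem_iUnion, cosetCylinder,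
      Set.mem_ofPred_eq]
    constructor
    · intro hM
      by_contra! hc
      exact hM (eq_idMap_of_restrict hc)
    · rintro ⟨n, hn⟩ rfl
      exact hn rfl
  rw [← hid χ h0, ← hid χ' h0', hU, Measure.restrict_iUnion_congr]
  intro n
  have : IsFiniteMeasure (χ.restrict (cosetCylinder n {finIdMap k n}ᶜ)) :=
    ⟨by simpa using (hfin n).lt_top⟩
  refine ext_of_generate_finite {C | ∃ m S, C = cosetCylinder (k := k) m S} ?_ ?_ ?_ ?_
  · refine le_antisymm ?_ (MeasurableSpace.generateFrom_le ?_)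
    · refine iSup_le fun i => ?_
      rw [MeasurableSpace.comap_le_iff_le_map]
      refine iSup_le fun j => ?_
      rintro _ ⟨T, -, rfl⟩
      refine MeasurableSpace.measurableSet_generateFrom
        ⟨j + 1, {M | M i ⟨j, Nat.lt_succ_self j⟩ ∈ T}, rfl⟩
    · rintro _ ⟨m, S, rfl⟩
      exact measurableSet_cosetCylinder m S
  · rintro _ ⟨m, S, rfl⟩ _ ⟨m', S', rfl⟩ -
    refine ⟨max m m', {M | M.truncate (le_max_left _ _) ∈ S ∧ M.truncate (le_max_right _ _) ∈ S'},
      rfl⟩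
  · rintro _ ⟨m, S, rfl⟩
    rw [Measure.restrict_apply (measurableSet_cosetCylinder m S),
      Measure.restrict_apply (measurableSet_cosetCylinder m S)]
    -- Cutting an arbitrary cylinder with the maps nontrivial on `[n]` gives a cylinder that omits
    -- the identity, where the two measures agree by assumption.
    exact h (max m n) {M | M.truncate (le_max_left _ _) ∈ S ∧
      M.truncate (le_max_right _ _) ∈ ({finIdMap k n}ᶜ : Set _)} (fun hc => hc.2 rfl)
  · simp only [Measure.restrict_apply_univ]
    exact h n _ (by simp)

end CutPaste

namespace CutPaste

/-! ### The measure of rates of an exchangeable consistent process. -/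

section RateMeasure

variable {k : ℕ} {Ω : Type*} [MeasurableSpace Ω] {Pr : Kernel (Coloring k) Ω}
  {X : ℝ≥0 → Ω → Coloring k}

/-- The coloring that has color `i` at all the sites `Nat.pair i j`. -/
def baseColoring (hk : 1 ≤ k) : Coloring k := fun a =>
  if h : a.unpair.1 < k then ⟨a.unpair.1, h⟩ else ⟨0, hk⟩

theorem baseColoring_pair (hk : 1 ≤ k) (i : Fin k) (j : ℕ) :
    baseColoring hk (Nat.pair i j) = i := by
  simp [baseColoring]

/-- The law at time `t` of the process started from `baseColoring`, as a law of coset maps. -/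
noncomputable def baseLaw (hk : 1 ≤ k) (Pr : Kernel (Coloring k) Ω) (X : ℝ≥0 → Ω → Coloring k)
    (t : ℝ≥0) : Measure (CosetMap k) :=
  (Pr (baseColoring hk)).map fun ω i j => X t ω (Nat.pair i j)

/-- Distinct entries of the coset map are distinct sites, and entry `(i, j)` starts with color `i`.
Hence this single initial state displays the motion out of every finite coloring. -/
theorem baseLaw_real (hk : 1 ≤ k) (hX : IsMarkovProcess Pr X)
    (hexch : IsExchangeable Pr X)
    {p : ∀ n, ℝ≥0 → FinColoring k n → FinColoring k n → ℝ}
    (hp : ∀ n, IsTransitionOf Pr X n (p n)) {n : ℕ} {g : Fin n → Fin k × ℕ}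
    (hg : Function.Injective g) (t : ℝ≥0) (y : FinColoring k n) :
    (baseLaw hk Pr X t).real {M | ∀ j, M (g j).1 (g j).2 = y j} =
      p n t (fun j => (g j).1) y := by
  have hm : Measurable fun ω (i : Fin k) (j : ℕ) => X t ω (Nat.pair i j) :=
    measurable_pi_lambda _ fun i => measurable_pi_lambda _ fun j =>
      (measurable_pi_apply _).comp (hX.measurable t)
  have hS : MeasurableSet {M : CosetMap k | ∀ j, M (g j).1 (g j).2 = y j} := by
    rw [Set.ofPred_forall]
    refine MeasurableSet.iInter fun j => measurableSet_eq_fun ?_ measurable_const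
    exact (measurable_pi_apply _).comp (measurable_pi_apply _)
  have hι : Function.Injective fun j => Nat.pair (g j).1 (g j).2 := by
    intro a b hab
    have h := Nat.pair_eq_pair.1 hab
    exact hg (Prod.ext (Fin.ext h.1) h.2)
  rw [baseLaw, measureReal_def, Measure.map_apply hm hS, ← measureReal_def]
  have h := hexch.real_injective hk hX hp hι (baseColoring hk) t y
  simp only [baseColoring_pair] at h
  exact h

/-- All `k * n` entries are read as one coloring, whose initial state is the coset number. The right
side does not involve `σ`; this is the source of coset exchangeability. -/
theorem baseLaw_cylinder_singleton (hk : 1 ≤ k) (hX : IsMarkovProcess Pr X)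
    (hexch : IsExchangeable Pr X)
    {p : ∀ n, ℝ≥0 → FinColoring k n → FinColoring k n → ℝ}
    (hp : ∀ n, IsTransitionOf Pr X n (p n)) (σ : Fin k → Equiv.Perm ℕ)
    {n : ℕ} (m : FinCosetMap k n) (t : ℝ≥0) :
    (baseLaw hk Pr X t).real {M | ∀ (i : Fin k) (j : Fin n), M i (σ i j) = m i j} =
      p (k * n) t (fun a => (finProdFinEquiv.symm a).1)
        (fun a => m (finProdFinEquiv.symm a).1 (finProdFinEquiv.symm a).2) := by
  have hg : Function.Injective fun a : Fin (k * n) =>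
      ((finProdFinEquiv.symm a).1, σ (finProdFinEquiv.symm a).1 (finProdFinEquiv.symm a).2) := by
    intro a b hab
    obtain ⟨h1, h2⟩ := Prod.ext_iff.1 hab
    simp only at h1 h2
    rw [h1] at h2
    exact finProdFinEquiv.symm.injective (Prod.ext h1 (Fin.ext ((σ _).injective h2)))
  rw [← baseLaw_real hk hX hexch hp hg]
  congr 1
  ext M
  simp only [Set.mem_ofPred_eq]
  constructor
  · exact fun h a => h _ _
  · intro h i j
    simpa using h (finProdFinEquiv (i, j))

/-- The measure of rates of the process. -/
theorem exists_rate_measure_of_process (hk : 1 ≤ k) (hX : IsMarkovProcess Pr X)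
    (hexch : IsExchangeable Pr X)
    {p : ∀ n, ℝ≥0 → FinColoring k n → FinColoring k n → ℝ}
    (hp : ∀ n, IsTransitionOf Pr X n (p n)) (hsemi : ∀ n, IsTransitionSemigroup (p n)) :
    ∃ χ : Measure (CosetMap k), SFinite χ ∧ IsCosetExchangeable χ ∧ IsRegular χ ∧
      ∀ n, ∀ x y : FinColoring k n, x ≠ y →
        Tendsto (fun t : ℝ≥0 => (t : ℝ)⁻¹ * p n t x y) (𝓝[>] 0)
          (𝓝 (χ.real {M | (M.restrict n).act x = y})) := by
  have hprob := hX.prob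
  have hfin : ∀ t, IsFiniteMeasure (baseLaw hk Pr X t) := fun t => by
    unfold baseLaw; infer_instance
  have hone : ∀ n (m : FinCosetMap k n), cosetCylinder n {m} =
      {M | ∀ (i : Fin k) (j : Fin n), M i ((1 : Equiv.Perm ℕ) j) = m i j} := by
    intro n m
    ext M
    simp [cosetCylinder, CosetMap.restrict, restrict, funext_iff]
  obtain ⟨χ, hχs, hχ0, hχ⟩ := exists_rate_measure (baseLaw hk Pr X) (by
    intro n m hm
    obtain ⟨q, hq⟩ := (hsemi (k * n)).exists_rates
    refine ⟨_, (hq (fun a => (finProdFinEquiv.symm a).1)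
      (fun a => m (finProdFinEquiv.symm a).1 (finProdFinEquiv.symm a).2) ?_).congr fun t => ?_⟩
    · intro h
      refine hm ?_
      ext i j
      have := congrFun h (finProdFinEquiv (i, j))
      simp only [Equiv.symm_apply_apply] at this
      rw [← this]; rfl
    · rw [hone, ← baseLaw_cylinder_singleton hk hX hexch hp (fun _ => 1)])
  refine ⟨χ, hχs, ?_, ⟨hχ0, fun n => ((hχ n {finIdMap k n}ᶜ (by simp)).1).lt_top⟩, ?_⟩
  · intro σ hσ
    have hm : Measurable fun (M : CosetMap k) i => relabel (σ i) (M i) :=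
      measurable_pi_lambda _ fun i => (measurable_relabel (σ i)).comp (measurable_pi_apply i)
    refine (measure_ext_of_cosetCylinder hχ0 ?_
      (fun n => (hχ n {finIdMap k n}ᶜ (by simp)).1) ?_).symm
    · rw [Measure.map_apply hm (measurableSet_singleton _)]
      refine measure_mono_null (fun M hM => ?_) hχ0
      have hM' : (fun i => relabel (σ i) (M i)) = idMap k := hM
      funext i j
      have := congrFun (congrFun hM' i) ((σ i).symm j)
      simp only [relabel, Equiv.apply_symm_apply] at this
      rw [this]; rfl
    · intro n S hS
      obtain ⟨N, hN⟩ : ∃ N, ∀ (i : Fin k) (j : Fin n), σ i j < N := by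
        obtain ⟨b, hb⟩ := (Set.finite_range fun a : Fin k × Fin n => σ a.1 a.2).bddAbove
        exact ⟨b + 1, fun i j => Nat.lt_succ_of_le (hb ⟨(i, j), rfl⟩)⟩
      set S' : Set (FinCosetMap k N) := {M | (fun i (j : Fin n) => M i ⟨σ i j, hN i j⟩) ∈ S}
      have hS' : finIdMap k N ∉ S' := hS
      have hpre : (fun (M : CosetMap k) i => relabel (σ i) (M i)) ⁻¹' (cosetCylinder n S) =
          cosetCylinder N S' := rfl
      rw [Measure.map_apply hm (measurableSet_cosetCylinder n S), hpre,
        ← ENNReal.toReal_eq_toReal_iff' (hχ n S hS).1 (hχ N S' hS').1]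
      -- Both sides are limits of rates under `baseLaw`, which already agree for each `t`.
      refine tendsto_nhds_unique (hχ n S hS).2 ((hχ N S' hS').2.congr fun t => ?_)
      congr 1
      have hsum : ∀ f : CosetMap k → FinCosetMap k n, Measurable f →
          (baseLaw hk Pr X t).real (f ⁻¹' S) =
            ∑ m ∈ S.toFinite.toFinset, (baseLaw hk Pr X t).real (f ⁻¹' {m}) := by
        intro f hf
        rw [sum_measureReal_preimage_singleton _ fun y _ => hf (measurableSet_singleton y),
          Set.Finite.coe_toFinset]
      have h1 := hsum (fun M => CosetMap.restrict n fun i => relabel (σ i) (M i))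
        ((measurable_cosetMap_restrict n).comp hm)
      have h2 := hsum (CosetMap.restrict n) (measurable_cosetMap_restrict n)
      refine h1.trans (Eq.trans (Finset.sum_congr rfl fun m _ => ?_) h2.symm)
      have h3 := baseLaw_cylinder_singleton hk hX hexch hp σ m t
      rw [← baseLaw_cylinder_singleton hk hX hexch hp (fun _ => 1) m t, ← hone] at h3
      refine Eq.trans ?_ h3
      congr 1
      ext M
      simp [CosetMap.restrict, restrict, relabel, funext_iff]
  · intro n x y hxy
    have hS : finIdMap k n ∉ {m : FinCosetMap k n | m.act x = y} := hxy
    refine (hχ n _ hS).2.congr fun t => ?_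
    -- The image of `x` under `M` involves only the entries `(x j, j)`, which are distinct because
    -- the `j` are. Their joint law is exactly `p n t x`.
    have hg : Function.Injective fun j : Fin n => (x j, (j : ℕ)) := fun a b hab =>
      Fin.ext (congrArg Prod.snd hab)
    rw [← baseLaw_real hk hX hexch hp hg]
    congr 2
    ext M
    simp [cosetCylinder, FinCosetMap.act, CosetMap.restrict, restrict, funext_iff]

end RateMeasure

end CutPaste

namespace CutPaste

/-! ### A Poisson number of independent points -/

section CompoundPoisson

variable {E : Type*} [MeasurableSpace E]

/-- The law of a Poisson number and an independent sequence of independent points. -/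
noncomputable def poissonSample (r : ℝ≥0) (ρ : Measure E) : Measure (ℕ × (ℕ → E)) :=
  (poissonMeasure r).prod (Measure.infinitePi fun _ => ρ)

open Classical in
/-- The number of points in `B`, among the first `ω.1` points of the sequence `ω.2`. -/
noncomputable def sampleCount (B : Set E) (ω : ℕ × (ℕ → E)) : ℕ :=
  ((Finset.range ω.1).filter fun i => ω.2 i ∈ B).card

theorem measurable_sampleCount {B : Set E} (hB : MeasurableSet B) :
    Measurable (sampleCount B) := by
  classical
  refine measurable_from_prod_countable_right fun n => ?_
  have h : (fun z : ℕ → E => sampleCount B (n, z)) =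
      fun z => ∑ i ∈ Finset.range n, if z i ∈ B then 1 else 0 := by
    funext z
    simp [sampleCount, Finset.sum_boole]
  rw [h]
  refine Finset.measurable_sum _ fun i _ => Measurable.ite ?_ measurable_const measurable_const
  exact (measurable_pi_apply i) hB

variable {r : ℝ≥0} {ρ : Measure E} [IsProbabilityMeasure ρ]

instance : IsProbabilityMeasure (poissonSample r ρ) := by
  unfold poissonSample; infer_instance

/-- Given that there are `n` points, independence turns the integral into the `n`th power of `∫ f`;
summing over `n` is the Poisson generating function. -/
theorem integral_prod_poissonSample {f : E → ℂ} (hf : Measurable f) (hf1 : ∀ z, ‖f z‖ ≤ 1) :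
    ∫ ω, ∏ i ∈ Finset.range ω.1, f (ω.2 i) ∂(poissonSample r ρ) =
      Complex.exp (r * (∫ z, f z ∂ρ - 1)) := by
  have hnorm : ∀ (n : ℕ) (z : ℕ → E), ‖∏ i ∈ Finset.range n, f (z i)‖ ≤ 1 := by
    intro n z
    rw [norm_prod]
    exact Finset.prod_le_one (fun _ _ => norm_nonneg _) fun _ _ => hf1 _
  have hmeas : Measurable fun ω : ℕ × (ℕ → E) => ∏ i ∈ Finset.range ω.1, f (ω.2 i) := by
    refine measurable_from_prod_countable_right fun n => ?_
    exact Finset.measurable_prod (Finset.range n) fun i _ => hf.comp (measurable_pi_apply i)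
  have hint : Integrable (fun ω : ℕ × (ℕ → E) => ∏ i ∈ Finset.range ω.1, f (ω.2 i))
      (poissonSample r ρ) :=
    (integrable_const (1 : ℝ)).mono' hmeas.aestronglyMeasurable
      (Eventually.of_forall fun ω => hnorm _ _)
  have hinner : ∀ n : ℕ, ∫ z, ∏ i ∈ Finset.range n, f (z i) ∂(Measure.infinitePi fun _ : ℕ => ρ) =
      (∫ z, f z ∂ρ) ^ n := by
    intro n
    have hind : iIndepFun (fun (i : Fin n) (z : ℕ → E) => f (z i))
        (Measure.infinitePi fun _ : ℕ => ρ) :=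
      (iIndepFun_infinitePi (P := fun _ : ℕ => ρ) (X := fun _ => f) (fun _ => hf)).precomp
        Fin.val_injective
    simp_rw [Finset.prod_range]
    rw [hind.integral_fun_prod_eq_prod_integral fun i =>
      (hf.comp (measurable_pi_apply _)).aestronglyMeasurable]
    have h1 : ∀ i : Fin n, ∫ z, f (z i) ∂(Measure.infinitePi fun _ : ℕ => ρ) = ∫ z, f z ∂ρ := by
      intro i
      conv_rhs => rw [← Measure.infinitePi_map_eval (fun _ : ℕ => ρ) (i : ℕ),
        integral_map (measurable_pi_apply _).aemeasurable hf.aestronglyMeasurable]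
    simp only [h1, Finset.prod_const, Finset.card_univ, Fintype.card_fin]
  rw [poissonSample] at hint ⊢
  rw [integral_prod _ hint]
  simp only [hinner]
  have hφ : ‖∫ z, f z ∂ρ‖ ≤ 1 := by
    refine (norm_integral_le_of_norm_le_const (Eventually.of_forall hf1)).trans ?_
    simp
  rw [integral_poissonMeasure' ((integrable_const (1 : ℝ)).mono'
    (measurable_of_countable _).aestronglyMeasurable (Eventually.of_forall fun n => by
      rw [norm_pow]; exact pow_le_one₀ (norm_nonneg _) hφ))]
  have hs := (NormedSpace.expSeries_div_hasSum_exp ((r : ℂ) * ∫ z, f z ∂ρ)).mul_left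
    (Complex.exp (-r))
  rw [← Complex.exp_eq_exp_ℂ, ← Complex.exp_add] at hs
  rw [mul_sub, mul_one, sub_eq_neg_add, ← hs.tsum_eq]
  congr 1
  ext n
  rw [mul_pow, Complex.real_smul]
  push_cast
  ring

/-- For disjoint sets, at most one indicator in the exponent of `f` is nonzero, so `f - 1` is a sum
over the sets and the exponential of its integral factors. This one formula gives both the Poisson
laws and the independence of the counts. -/
theorem integral_exp_sampleCount {ι : Type*} [Fintype ι] {B : ι → Set E}
    (hB : ∀ i, MeasurableSet (B i)) (hd : Pairwise fun i j => Disjoint (B i) (B j)) (t : ι → ℝ) :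
    ∫ ω, Complex.exp ((∑ i, t i * sampleCount (B i) ω : ℝ) * Complex.I) ∂(poissonSample r ρ) =
      ∏ i, Complex.exp (r * (ρ.real (B i)) * (Complex.exp (t i * Complex.I) - 1)) := by
  classical
  set f : E → ℂ := fun z => Complex.exp ((∑ i, t i * (if z ∈ B i then 1 else 0) : ℝ) * Complex.I)
  have hf : Measurable f := by
    refine Complex.measurable_exp.comp ((Complex.measurable_ofReal.comp ?_).mul_const _)
    exact Finset.measurable_sum _ fun i _ =>
      (Measurable.ite (hB i) measurable_const measurable_const).const_mul _
  have hf1 : ∀ z, ‖f z‖ ≤ 1 := fun z => (Complex.norm_exp_ofReal_mul_I _).le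
  have h1 : ∀ ω : ℕ × (ℕ → E),
      Complex.exp ((∑ i, t i * sampleCount (B i) ω : ℝ) * Complex.I) =
        ∏ l ∈ Finset.range ω.1, f (ω.2 l) := by
    intro ω
    rw [← Complex.exp_sum, ← Finset.sum_mul, ← Complex.ofReal_sum, Finset.sum_comm]
    congr 3
    refine Finset.sum_congr rfl fun i _ => ?_
    rw [← Finset.mul_sum, sampleCount, Finset.sum_boole]
  simp_rw [h1]
  rw [integral_prod_poissonSample hf hf1, ← Complex.exp_sum]
  congr 1
  have h2 : f = fun z => 1 + ∑ i, (B i).indicator (fun _ => Complex.exp (t i * Complex.I) - 1) z := by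
    funext z
    by_cases hz : ∃ i, z ∈ B i
    · obtain ⟨i, hi⟩ := hz
      have hj : ∀ j, j ≠ i → z ∉ B j := fun j hj h => Set.disjoint_left.1 (hd hj) h hi
      simp only [f]
      rw [Finset.sum_eq_single i (fun j _ h => by simp [hj j h]) (by simp),
        Finset.sum_eq_single i (fun j _ h => by simp [hj j h]) (by simp)]
      simp [hi]
    · push Not at hz
      simp [f, hz]
  have h3 : ∀ i, Integrable ((B i).indicator fun _ => Complex.exp (t i * Complex.I) - 1) ρ :=
    fun i => (integrable_const _).indicator (hB i)
  rw [h2, integral_add (integrable_const _) (integrable_finsetSum _ fun i _ => h3 i),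
    integral_finsetSum _ fun i _ => h3 i]
  simp only [integral_const, probReal_univ, one_smul, add_sub_cancel_left]
  rw [Finset.mul_sum]
  refine Finset.sum_congr rfl fun i _ => ?_
  rw [integral_indicator (hB i), setIntegral_const, Complex.real_smul]
  ring

theorem map_sampleCount {B : Set E} (hB : MeasurableSet B) :
    (poissonSample r ρ).map (sampleCount B) = poissonMeasure (r * (ρ B).toNNReal) := by
  apply (MeasurableEmbedding.natCast (α := ℝ)).map_injective
  have : IsProbabilityMeasure ((poissonSample r ρ).map (sampleCount B)) :=
    Measure.isProbabilityMeasure_map (measurable_sampleCount hB).aemeasurable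
  refine Measure.ext_of_charFun ?_
  ext t
  rw [charFun_map_cast_poissonMeasure, charFun_apply_real,
    Measure.map_map (by fun_prop) (measurable_sampleCount hB),
    integral_map (by have := measurable_sampleCount hB; fun_prop) (by fun_prop)]
  have h := integral_exp_sampleCount (r := r) (ρ := ρ) (ι := Unit) (fun _ => hB)
    (fun i j h => absurd rfl h) (fun _ => t)
  simp only [Finset.univ_unique, Finset.sum_singleton, Finset.prod_singleton] at h
  convert! h using 2
  · ext ω; simp
  · simp [Measure.real, ENNReal.coe_toNNReal_eq_toReal]

theorem iIndepFun_sampleCount {ι : Type*} [Fintype ι] {B : ι → Set E}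
    (hB : ∀ i, MeasurableSet (B i)) (hd : Pairwise fun i j => Disjoint (B i) (B j)) :
    iIndepFun (fun i => sampleCount (B i)) (poissonSample r ρ) := by
  have hm := fun i => measurable_sampleCount (hB i)
  have hm' : ∀ i, Measurable fun ω => (sampleCount (B i) ω : ℝ) := fun i =>
    measurable_from_nat.comp (hm i)
  have key : iIndepFun (fun i ω => (sampleCount (B i) ω : ℝ)) (poissonSample r ρ) := by
    rw [iIndepFun_iff_charFun_pi fun i => (hm' i).aemeasurable]
    intro t
    have h1 : ∀ i, charFun ((poissonSample r ρ).map fun ω => (sampleCount (B i) ω : ℝ)) (t i) =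
        Complex.exp (r * (ρ.real (B i)) * (Complex.exp (t i * Complex.I) - 1)) := by
      intro i
      rw [show (fun ω => (sampleCount (B i) ω : ℝ)) = Nat.cast ∘ sampleCount (B i) from rfl,
        ← Measure.map_map (by fun_prop) (hm i), map_sampleCount (hB i),
        charFun_map_cast_poissonMeasure]
      simp [Measure.real, ENNReal.coe_toNNReal_eq_toReal]
    simp_rw [h1]
    rw [← integral_exp_sampleCount hB hd, charFun_apply,
      integral_map (by fun_prop) (by fun_prop)]
    congr 1
  -- Characteristic functions need real-valued counts; the floor recovers the integer ones.
  have := key.comp (fun _ => Nat.floor) (fun _ => Nat.measurable_floor)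
  convert! this using 2
  ext ω
  simp

end CompoundPoisson

end CutPaste

namespace CutPaste

/-! ### Generalities on independence and counting -/

theorem iIndepFun_comp_measurePreserving {Ω Ω' ι : Type*} {𝓧 : ι → Type*} [MeasurableSpace Ω]
    [MeasurableSpace Ω'] [∀ i, MeasurableSpace (𝓧 i)] {P : Measure Ω} {P' : Measure Ω'}
    {X : (i : ι) → Ω' → 𝓧 i} (hX : iIndepFun X P') (hm : ∀ i, Measurable (X i)) {g : Ω → Ω'}
    (hg : MeasurePreserving g P P') : iIndepFun (fun i ω => X i (g ω)) P := by
  have := hX.isProbabilityMeasure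
  have hgm := hg.measurable
  have : IsProbabilityMeasure P := ⟨by
    rw [← Set.preimage_univ (f := g), hg.measure_preimage MeasurableSet.univ.nullMeasurableSet,
      measure_univ]⟩
  rw [iIndepFun_iff_map_fun_eq_infinitePi_map (X := fun i ω => X i (g ω))
    fun i => (hm i).comp hgm]
  have h1 : P.map (fun ω i => X i (g ω)) = P'.map fun ω i => X i ω := by
    rw [← hg.map_eq, Measure.map_map (by fun_prop) hgm]; rfl
  have h2 : ∀ i, P.map (fun ω => X i (g ω)) = P'.map (X i) := by
    intro i
    rw [← hg.map_eq, Measure.map_map (hm i) hgm]; rfl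
  simp_rw [h1, h2]
  exact (iIndepFun_iff_map_fun_eq_infinitePi_map hm).1 hX

theorem iIndepFun_curry {Ω ι κ : Type*} {𝓧 : Type*} [MeasurableSpace Ω] [MeasurableSpace 𝓧]
    {P : Measure Ω} [IsProbabilityMeasure P] {X : ι → κ → Ω → 𝓧} (hm : ∀ i j, Measurable (X i j))
    (h : iIndepFun (fun (a : ι × κ) => X a.1 a.2) P) : iIndepFun (fun i ω j => X i j ω) P := by
  have hp : ∀ i j, IsProbabilityMeasure (P.map (X i j)) := fun i j =>
    Measure.isProbabilityMeasure_map (hm i j).aemeasurable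
  have hp' : ∀ i, iIndepFun (fun j => X i j) P := fun i =>
    h.precomp (g := fun j => (i, j)) fun _ _ h => (Prod.ext_iff.1 h).2
  rw [iIndepFun_iff_map_fun_eq_infinitePi_map (by fun_prop)]
  have h1 := (iIndepFun_iff_map_fun_eq_infinitePi_map (X := fun (a : ι × κ) => X a.1 a.2)
    (fun a => hm a.1 a.2)).1 h
  have h2 := congrArg (Measure.map (MeasurableEquiv.curry ι κ 𝓧)) h1
  rw [Measure.map_map (by fun_prop) (measurable_pi_lambda _ fun a : ι × κ => hm a.1 a.2),
    Measure.infinitePi_map_curry (fun i j => P.map (X i j))] at h2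
  refine h2.trans ?_
  congr 1
  funext i
  exact ((iIndepFun_iff_map_fun_eq_infinitePi_map (hm i)).1 (hp' i)).symm

theorem measurable_enat_of_le {Ω : Type*} [MeasurableSpace Ω] {f : Ω → ℕ∞}
    (h : ∀ n : ℕ, MeasurableSet {ω | (n : ℕ∞) ≤ f ω}) : Measurable f := by
  refine measurable_to_countable' fun a => ?_
  induction a using ENat.recTopCoe with
  | top =>
    have : f ⁻¹' {⊤} = ⋂ n : ℕ, {ω | (n : ℕ∞) ≤ f ω} := by
      ext ω
      simp [ENat.eq_top_iff_forall_ge]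
    rw [this]
    exact MeasurableSet.iInter h
  | coe n =>
    have : f ⁻¹' {(n : ℕ∞)} = {ω | (n : ℕ∞) ≤ f ω} \ {ω | ((n + 1 : ℕ) : ℕ∞) ≤ f ω} := by
      ext ω
      simp only [Set.mem_preimage, Set.mem_singleton_iff, Set.mem_sdiff, Set.mem_ofPred_eq, not_le,
        Nat.cast_add, Nat.cast_one, ENat.lt_natCast_add_one_iff]
      exact ⟨fun h => h ▸ ⟨le_rfl, le_rfl⟩, fun h => le_antisymm h.2 h.1⟩
    rw [this]
    exact (h n).diff (h (n + 1))

theorem le_encard_iff_exists_finset {ι : Type*} {S : Set ι} {n : ℕ} :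
    (n : ℕ∞) ≤ S.encard ↔ ∃ F : Finset ι, (F : Set ι) ⊆ S ∧ F.card = n := by
  constructor
  · intro h
    obtain ⟨t, hts, ht⟩ := Set.exists_subset_encard_eq h
    have hfin := Set.finite_of_encard_eq_coe ht
    refine ⟨hfin.toFinset, by simpa using hts, ?_⟩
    have h2 := Set.encard_coe_eq_coe_finsetCard hfin.toFinset
    rw [hfin.coe_toFinset, ht] at h2
    exact_mod_cast h2.symm
  · rintro ⟨F, hF, rfl⟩
    rw [← Set.encard_coe_eq_coe_finsetCard]
    exact Set.encard_le_encard hF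

theorem measurable_encard {Ω ι : Type*} [MeasurableSpace Ω] [Countable ι] {S : Ω → Set ι}
    (h : ∀ i, MeasurableSet {ω | i ∈ S ω}) : Measurable fun ω => (S ω).encard := by
  refine measurable_enat_of_le fun n => ?_
  have : {ω | (n : ℕ∞) ≤ (S ω).encard} =
      ⋃ F ∈ {F : Finset ι | F.card = n}, ⋂ i ∈ F, {ω | i ∈ S ω} := by
    ext ω
    simp only [Set.mem_ofPred_eq, le_encard_iff_exists_finset, Set.mem_iUnion, Set.mem_iInter,
      Set.subset_def, Finset.mem_coe, exists_prop, and_comm]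
  rw [this]
  exact MeasurableSet.biUnion (Set.to_countable _) fun F _ =>
    MeasurableSet.biInter F.countable_toSet fun i _ => h i

theorem le_encard_sigma_iff (A : ℕ → Finset ℕ) (n : ℕ) :
    (n : ℕ∞) ≤ {a : (_ : ℕ) × ℕ | a.2 ∈ A a.1}.encard ↔
      ∃ C, n ≤ ∑ c ∈ Finset.range C, (A c).card := by
  rw [le_encard_iff_exists_finset]
  constructor
  · rintro ⟨F, hF, rfl⟩
    obtain ⟨C, hC⟩ : ∃ C, ∀ a ∈ F, a.1 < C := by
      obtain ⟨b, hb⟩ := (F.image Sigma.fst).bddAbove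
      exact ⟨b + 1, fun a ha => Nat.lt_succ_of_le (hb (Finset.mem_image_of_mem _ ha))⟩
    refine ⟨C, ?_⟩
    rw [← Finset.card_sigma]
    refine Finset.card_le_card fun a ha => ?_
    exact Finset.mem_sigma.2 ⟨Finset.mem_range.2 (hC a ha), hF ha⟩
  · rintro ⟨C, hC⟩
    rw [← Finset.card_sigma] at hC
    obtain ⟨F, hF, hn⟩ := Finset.exists_subset_card_eq hC
    refine ⟨F, fun a ha => ?_, hn⟩
    exact (Finset.mem_sigma.1 (hF ha)).2

/-- The sum of a sequence of natural numbers. -/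
noncomputable def totalCount (v : ℕ → ℕ) : ℕ∞ := {a : (_ : ℕ) × ℕ | a.2 < v a.1}.encard

/-- Events for the possibly infinite total become increasing unions over partial sums, whose laws
are Poisson. -/
theorem le_totalCount_iff (v : ℕ → ℕ) (n : ℕ) :
    (n : ℕ∞) ≤ totalCount v ↔ ∃ C, n ≤ ∑ c ∈ Finset.range C, v c := by
  have := le_encard_sigma_iff (fun c => Finset.range (v c)) n
  simpa [totalCount] using this

theorem encard_sigma_eq_totalCount (A : ℕ → Finset ℕ) :
    {a : (_ : ℕ) × ℕ | a.2 ∈ A a.1}.encard = totalCount fun c => (A c).card := by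
  refine ENat.eq_of_forall_natCast_le_iff fun n => ?_
  rw [le_encard_sigma_iff, le_totalCount_iff]

theorem measurable_totalCount : Measurable totalCount := by
  refine measurable_encard fun a => ?_
  exact measurableSet_lt measurable_const (measurable_pi_apply a.1)

theorem measure_enat_ext {μ ν : Measure ℕ∞} [IsProbabilityMeasure μ] [IsProbabilityMeasure ν]
    (h : ∀ n : ℕ, μ {(n : ℕ∞)} = ν {(n : ℕ∞)}) : μ = ν := by
  have hr : μ (Set.range ((↑) : ℕ → ℕ∞)) = ν (Set.range ((↑) : ℕ → ℕ∞)) := by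
    rw [← Set.iUnion_singleton_eq_range, measure_iUnion, measure_iUnion]
    · simp_rw [h]
    · exact fun i j hij => by simpa using hij
    · exact fun _ => measurableSet_singleton _
    · exact fun i j hij => by simpa using hij
    · exact fun _ => measurableSet_singleton _
  have htop : ({⊤} : Set ℕ∞) = (Set.range ((↑) : ℕ → ℕ∞))ᶜ := by
    ext a
    induction a using ENat.recTopCoe <;> simp
  refine Measure.ext_of_singleton fun a => ?_
  induction a using ENat.recTopCoe with
  | top =>
    rw [htop, prob_compl_eq_one_sub MeasurableSet.of_discrete,
      prob_compl_eq_one_sub MeasurableSet.of_discrete, hr]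
  | coe n => exact h n

/-! ### Sums of independent Poisson variables -/

section PoissonSum

variable {Ω : Type*} [MeasurableSpace Ω] {P : Measure Ω} [IsProbabilityMeasure P]
  {V : ℕ → Ω → ℕ} {r : ℕ → ℝ≥0}

theorem map_sum_range_poisson (hV : ∀ c, Measurable (V c)) (hind : iIndepFun V P)
    (hlaw : ∀ c, P.map (V c) = poissonMeasure (r c)) (C : ℕ) :
    P.map (fun ω => ∑ c ∈ Finset.range C, V c ω) =
      poissonMeasure (∑ c ∈ Finset.range C, r c) := by
  induction C with
  | zero =>
    simp only [Finset.range_zero, Finset.sum_empty, Measure.map_const, measure_univ, one_smul]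
    refine Measure.ext_of_singleton fun n => ?_
    rw [poissonMeasure_singleton, Measure.dirac_apply' _ (measurableSet_singleton _)]
    rcases n with _ | n <;> simp
  | succ C ih =>
    have h1 : IndepFun (fun ω => ∑ c ∈ Finset.range C, V c ω) (V C) P := by
      have := hind.indepFun_finsetSum_of_notMem hV (s := Finset.range C) (i := C) (by simp)
      convert! this using 1
      ext ω
      simp
    have hm : Measurable fun ω => ∑ c ∈ Finset.range C, V c ω :=
      Finset.measurable_sum _ fun c _ => hV c
    have := IndepFun.hasLaw_add_poissonMeasure h1 ⟨hm.aemeasurable, ih⟩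
      ⟨(hV C).aemeasurable, hlaw C⟩
    rw [Finset.sum_range_succ, ← this.map_eq]
    congr 1
    ext ω
    simp [Finset.sum_range_succ]

/-- The event that the total is `n` is the difference of two upper tails, and tails are limits of
tails of partial sums. No summability is assumed, so both the finite and the infinite intensity are
covered. -/
theorem tendsto_real_totalCount (hV : ∀ c, Measurable (V c)) (hind : iIndepFun V P)
    (hlaw : ∀ c, P.map (V c) = poissonMeasure (r c)) (n : ℕ) :
    Tendsto (fun C => Real.exp (-(∑ c ∈ Finset.range C, r c : ℝ≥0)) *
      (∑ c ∈ Finset.range C, r c : ℝ≥0) ^ n / n.factorial) atTop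
      (𝓝 (P.real {ω | totalCount (fun c => V c ω) = n})) := by
  have hm : ∀ C, Measurable fun ω => ∑ c ∈ Finset.range C, V c ω := fun C =>
    Finset.measurable_sum _ fun c _ => hV c
  have hge : ∀ a : ℕ, Tendsto (fun C => P.real {ω | a ≤ ∑ c ∈ Finset.range C, V c ω}) atTop
      (𝓝 (P.real {ω | (a : ℕ∞) ≤ totalCount fun c => V c ω})) := by
    intro a
    have hU : {ω | (a : ℕ∞) ≤ totalCount fun c => V c ω} =
        ⋃ C, {ω | a ≤ ∑ c ∈ Finset.range C, V c ω} := by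
      ext ω; simp [le_totalCount_iff]
    rw [hU]
    refine (ENNReal.continuousAt_toReal (measure_ne_top _ _)).tendsto.comp
      (tendsto_measure_iUnion_atTop fun C D hCD ω hω => ?_)
    exact le_trans (show a ≤ ∑ c ∈ Finset.range C, V c ω from hω)
      (Finset.sum_le_sum_of_subset (Finset.range_mono hCD))
  have h1 := (hge n).sub (hge (n + 1))
  have hmeas : ∀ a : ℕ, MeasurableSet {ω | (a : ℕ∞) ≤ totalCount fun c => V c ω} := fun a =>
    (measurable_totalCount.comp (measurable_pi_lambda _ hV))
      (MeasurableSet.of_discrete (s := Set.Ici (a : ℕ∞)))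
  have h2 : P.real {ω | totalCount (fun c => V c ω) = n} =
      P.real {ω | (n : ℕ∞) ≤ totalCount fun c => V c ω} -
        P.real {ω | ((n + 1 : ℕ) : ℕ∞) ≤ totalCount fun c => V c ω} := by
    rw [← measureReal_sdiff _ (hmeas (n + 1))]
    · congr 1
      ext ω
      simp only [Set.mem_ofPred_eq, Set.mem_sdiff, not_le, Nat.cast_add, Nat.cast_one,
        ENat.lt_natCast_add_one_iff]
      exact ⟨fun h => h ▸ ⟨le_rfl, le_rfl⟩, fun h => le_antisymm h.2 h.1⟩
    · intro ω hω
      refine le_trans ?_ (show ((n + 1 : ℕ) : ℕ∞) ≤ totalCount fun c => V c ω from hω)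
      exact_mod_cast Nat.le_succ n
  rw [h2]
  refine h1.congr fun C => ?_
  rw [← poissonMeasure_real_singleton, ← map_sum_range_poisson hV hind hlaw C,
    map_measureReal_apply (hm C) (measurableSet_singleton _), ← measureReal_sdiff]
  · congr 1
    ext ω
    simp only [Set.mem_ofPred_eq, Set.mem_sdiff, Set.mem_preimage, Set.mem_singleton_iff]
    omega
  · intro ω (hω : n + 1 ≤ _)
    exact (Nat.le_succ n).trans hω
  · exact (hm C) (MeasurableSet.of_discrete (s := Set.Ici (n + 1)))

theorem map_totalCount (hV : ∀ c, Measurable (V c)) (hind : iIndepFun V P)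
    (hlaw : ∀ c, P.map (V c) = poissonMeasure (r c)) (hr : ∑' c, (r c : ℝ≥0∞) ≠ ∞) :
    P.map (fun ω => totalCount fun c => V c ω) =
      (poissonMeasure (∑' c, (r c : ℝ≥0∞)).toNNReal).map (fun m : ℕ => (m : ℕ∞)) := by
  have hmT : Measurable fun ω => totalCount fun c => V c ω :=
    measurable_totalCount.comp (measurable_pi_lambda _ hV)
  have := Measure.isProbabilityMeasure_map (μ := P) hmT.aemeasurable
  have := Measure.isProbabilityMeasure_map
    (μ := poissonMeasure (∑' c, (r c : ℝ≥0∞)).toNNReal)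
    (measurable_from_nat (f := fun m : ℕ => (m : ℕ∞))).aemeasurable
  refine measure_enat_ext fun n => ?_
  rw [← measureReal_eq_measureReal_iff,
    map_measureReal_apply hmT (measurableSet_singleton _),
    map_measureReal_apply measurable_from_nat (measurableSet_singleton _)]
  have hpre : (fun m : ℕ => (m : ℕ∞)) ⁻¹' {(n : ℕ∞)} = {n} := by ext; simp
  rw [hpre, poissonMeasure_real_singleton]
  refine tendsto_nhds_unique (tendsto_real_totalCount hV hind hlaw n) ?_
  have hlim : Tendsto (fun C => ∑ c ∈ Finset.range C, r c) atTop
      (𝓝 (∑' c, (r c : ℝ≥0∞)).toNNReal) := by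
    have hs := ENNReal.tsum_coe_ne_top_iff_summable.1 hr
    rw [← ENNReal.coe_tsum hs, ENNReal.toNNReal_coe]
    exact hs.hasSum.tendsto_sum_nat
  have hc : Continuous fun x : ℝ≥0 => Real.exp (-(x : ℝ)) * (x : ℝ) ^ n / n.factorial := by
    fun_prop
  exact (hc.tendsto _).comp hlim

/-- The Poisson weight of each fixed `n` tends to zero when the mean tends to infinity, so no finite
value has positive probability. -/
theorem totalCount_eq_top (hV : ∀ c, Measurable (V c)) (hind : iIndepFun V P)
    (hlaw : ∀ c, P.map (V c) = poissonMeasure (r c)) (hr : ∑' c, (r c : ℝ≥0∞) = ∞) :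
    ∀ᵐ ω ∂P, totalCount (fun c => V c ω) = ⊤ := by
  have h0 : ∀ n : ℕ, ∀ᵐ ω ∂P, totalCount (fun c => V c ω) ≠ n := by
    intro n
    have hlim : Tendsto (fun C => ((∑ c ∈ Finset.range C, r c : ℝ≥0) : ℝ)) atTop atTop := by
      have h1 : ¬ Summable r := fun h => ENNReal.tsum_coe_ne_top_iff_summable.2 h hr
      have h2 := (NNReal.not_summable_iff_tendsto_nat_atTop).1 h1
      exact NNReal.tendsto_coe_atTop.2 h2
    have h3 := ((Real.tendsto_pow_mul_exp_neg_atTop_nhds_zero n).comp hlim).div_const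
      (n.factorial : ℝ)
    rw [zero_div] at h3
    have h4 := tendsto_nhds_unique (tendsto_real_totalCount hV hind hlaw n)
      (h3.congr fun C => by simp only [Function.comp]; rw [mul_comm])
    rw [measureReal_eq_zero_iff] at h4
    exact measure_eq_zero_iff_ae_notMem.1 h4
  filter_upwards [ae_all_iff.2 h0] with ω hω
  by_contra hne
  obtain ⟨n, hn⟩ := ENat.ne_top_iff_exists.1 hne
  exact hω n hn.symm

end PoissonSum

end CutPaste

namespace CutPaste

/-! ### Existence of Poisson point processes -/

theorem exists_smul_probabilityMeasure {E : Type*} [MeasurableSpace E] [Nonempty E]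
    (ν : Measure E) [IsFiniteMeasure ν] :
    ∃ (r : ℝ≥0) (ρ : Measure E), IsProbabilityMeasure ρ ∧ ν = r • ρ := by
  by_cases h : ν = 0
  · obtain ⟨z⟩ := ‹Nonempty E›
    -- The zero measure cannot be normalized; any probability measure with weight `0` will do.
    exact ⟨0, Measure.dirac z, inferInstance, by simp [h]⟩
  · have h0 : ν Set.univ ≠ 0 := by simpa using h
    refine ⟨(ν Set.univ).toNNReal, (ν Set.univ)⁻¹ • ν, ⟨?_⟩, ?_⟩
    · simp [ENNReal.inv_mul_cancel h0 (measure_ne_top _ _)]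
    · ext B -
      rw [Measure.smul_apply, Measure.smul_apply, ENNReal.smul_def,
        ENNReal.coe_toNNReal (measure_ne_top _ _), smul_eq_mul, smul_eq_mul, ← mul_assoc,
        ENNReal.mul_inv_cancel h0 (measure_ne_top _ _), one_mul]

section Superposition

variable {E : Type*} [MeasurableSpace E] {r : ℕ → ℝ≥0} {ρ : ℕ → Measure E}
  [∀ c, IsProbabilityMeasure (ρ c)]

/-- The law of a sequence of independent Poisson samples. -/
noncomputable def poissonSamples (r : ℕ → ℝ≥0) (ρ : ℕ → Measure E) :
    Measure (ℕ → ℕ × (ℕ → E)) :=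
  Measure.infinitePi fun c => poissonSample (r c) (ρ c)

instance : IsProbabilityMeasure (poissonSamples r ρ) := by
  unfold poissonSamples; infer_instance

/-- The indices of the points in `B`. -/
def sampleIndices (B : Set E) (ω : ℕ → ℕ × (ℕ → E)) : Set ((_ : ℕ) × ℕ) :=
  {a | a.2 < (ω a.1).1 ∧ (ω a.1).2 a.2 ∈ B}

/-- The point with a given index. -/
def samplePoint (ω : ℕ → ℕ × (ℕ → E)) (a : (_ : ℕ) × ℕ) : E := (ω a.1).2 a.2

theorem measurable_samplePoint (a : (_ : ℕ) × ℕ) :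
    Measurable fun ω : ℕ → ℕ × (ℕ → E) => samplePoint ω a :=
  (measurable_pi_apply a.2).comp (measurable_snd.comp (measurable_pi_apply a.1))

theorem measurableSet_sample_active (a : (_ : ℕ) × ℕ) :
    MeasurableSet {ω : ℕ → ℕ × (ℕ → E) | a.2 < (ω a.1).1} :=
  measurableSet_lt measurable_const (measurable_fst.comp (measurable_pi_apply a.1))

theorem measurable_encard_sampleIndices {B : Set E} (hB : MeasurableSet B) :
    Measurable fun ω : ℕ → ℕ × (ℕ → E) => (sampleIndices B ω).encard :=
  measurable_encard fun a =>
    (measurableSet_sample_active a).inter (measurable_samplePoint a hB)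

theorem encard_sampleIndices {E : Type*} (B : Set E) (ω : ℕ → ℕ × (ℕ → E)) :
    (sampleIndices B ω).encard = totalCount fun c => sampleCount B (ω c) := by
  classical
  refine Eq.trans ?_ (encard_sigma_eq_totalCount
    (fun c => (Finset.range (ω c).1).filter fun i => (ω c).2 i ∈ B))
  congr 1
  ext a
  simp [sampleIndices]

theorem map_sampleCount_eval {B : Set E} (hB : MeasurableSet B) (c : ℕ) :
    (poissonSamples r ρ).map (fun ω => sampleCount B (ω c)) =
      poissonMeasure (r c * (ρ c B).toNNReal) := by
  rw [← map_sampleCount hB, ← Measure.infinitePi_map_eval (fun c => poissonSample (r c) (ρ c)) c,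
    Measure.map_map (measurable_sampleCount hB) (measurable_pi_apply c)]
  rfl

theorem iIndepFun_sampleCount_eval {B : Set E} (hB : MeasurableSet B) :
    iIndepFun (fun c (ω : ℕ → ℕ × (ℕ → E)) => sampleCount B (ω c)) (poissonSamples r ρ) :=
  iIndepFun_infinitePi (P := fun c => poissonSample (r c) (ρ c)) (X := fun _ => sampleCount B)
    fun _ => measurable_sampleCount hB

theorem iIndepFun_encard_sampleIndices {ι : Type*} [Fintype ι] {B : ι → Set E}
    (hB : ∀ i, MeasurableSet (B i)) (hd : Pairwise fun i j => Disjoint (B i) (B j)) :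
    iIndepFun (fun i ω => (sampleIndices (B i) ω).encard) (poissonSamples r ρ) := by
  have hm : ∀ c i, Measurable fun ω : ℕ → ℕ × (ℕ → E) => sampleCount (B i) (ω c) := fun c i =>
    (measurable_sampleCount (hB i)).comp (measurable_pi_apply c)
  have h1 : iIndepFun (fun (a : ℕ × ι) (ω : ℕ → ℕ × (ℕ → E)) => sampleCount (B a.2) (ω a.1))
      (poissonSamples r ρ) := by
    refine iIndepFun_uncurry' (X := fun c i (ω : ℕ → ℕ × (ℕ → E)) => sampleCount (B i) (ω c)) hm ?_ fun c => ?_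
    · exact iIndepFun_infinitePi (P := fun c => poissonSample (r c) (ρ c))
        (X := fun _ ω i => sampleCount (B i) ω)
        fun _ => measurable_pi_lambda _ fun i => measurable_sampleCount (hB i)
    · exact iIndepFun_comp_measurePreserving (iIndepFun_sampleCount hB hd)
        (fun i => measurable_sampleCount (hB i))
        (measurePreserving_eval_infinitePi (fun c => poissonSample (r c) (ρ c)) c)
  have h2 : iIndepFun (fun (a : ι × ℕ) (ω : ℕ → ℕ × (ℕ → E)) => sampleCount (B a.1) (ω a.2))
      (poissonSamples r ρ) := h1.precomp (g := Prod.swap) Prod.swap_injective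
  have h3 := iIndepFun_curry (X := fun i c (ω : ℕ → ℕ × (ℕ → E)) => sampleCount (B i) (ω c)) (fun i c => hm c i) h2
  have h4 := h3.comp (fun _ => totalCount) (fun _ => measurable_totalCount)
  exact h4.congr fun i => Eventually.of_forall fun ω => (encard_sampleIndices (B i) ω).symm

/-- The two points are independent, and the diagonal is null because `ρ b.1` has no atoms. This
argument fails if `r b.1 = 0`, but then sample `b.1` is almost surely empty and `b` is not an active
index. -/
theorem samplePoint_ne [MeasurableEq E] [MeasurableSingletonClass E]
    (hatom : ∀ c z, r c • ρ c {z} = 0) {a b : (_ : ℕ) × ℕ}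
    (hab : a ≠ b) :
    ∀ᵐ ω ∂(poissonSamples r ρ), b.2 < (ω b.1).1 → samplePoint ω a ≠ samplePoint ω b := by
  rcases eq_or_ne (r b.1) 0 with hr | hr
  · have h0 : ∀ᵐ ω ∂(poissonSamples r ρ), (ω b.1).1 = 0 := by
      have hlaw : (poissonSamples r ρ).map (fun ω => (ω b.1).1) = poissonMeasure 0 := by
        have h1 := Measure.infinitePi_map_eval (fun c => poissonSample (r c) (ρ c)) b.1
        have h2 : (poissonSample (r b.1) (ρ b.1)).map Prod.fst = poissonMeasure (r b.1) := by
          rw [poissonSample, Measure.map_fst_prod, measure_univ, one_smul]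
        rw [← hr, ← h2, ← h1, Measure.map_map measurable_fst (measurable_pi_apply _)]
        rfl
      have hm : Measurable fun ω : ℕ → ℕ × (ℕ → E) => (ω b.1).1 :=
        measurable_fst.comp (measurable_pi_apply b.1)
      have h3 : poissonMeasure 0 {0} = 1 := by
        rw [poissonMeasure_singleton]; simp
      rw [← hlaw, Measure.map_apply hm (measurableSet_singleton _)] at h3
      exact (prob_compl_eq_zero_iff (hm (measurableSet_singleton _))).2 h3
    filter_upwards [h0] with ω hω h
    omega
  · have hlaw : ∀ a : (_ : ℕ) × ℕ,
        (poissonSamples r ρ).map (fun ω => samplePoint ω a) = ρ a.1 := by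
      intro a
      have h1 := Measure.infinitePi_map_eval (fun c => poissonSample (r c) (ρ c)) a.1
      have h2 : (poissonSample (r a.1) (ρ a.1)).map Prod.snd = Measure.infinitePi fun _ => ρ a.1 := by
        rw [poissonSample, Measure.map_snd_prod, measure_univ, one_smul]
      have h3 := Measure.infinitePi_map_eval (fun _ : ℕ => ρ a.1) a.2
      rw [← h2, ← h1, Measure.map_map measurable_snd (measurable_pi_apply _),
        Measure.map_map (measurable_pi_apply _)
          (measurable_snd.comp (measurable_pi_apply _))] at h3
      exact h3
    have hind : iIndepFun (fun (a : (_ : ℕ) × ℕ) (ω : ℕ → ℕ × (ℕ → E)) => (ω a.1).2 a.2)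
        (poissonSamples r ρ) := by
      refine iIndepFun_uncurry (X := fun c i (ω : ℕ → ℕ × (ℕ → E)) => (ω c).2 i)
        (fun c i => measurable_samplePoint ⟨c, i⟩) ?_ fun c => ?_
      · exact iIndepFun_infinitePi (P := fun c => poissonSample (r c) (ρ c))
          (X := fun _ ω i => ω.2 i) fun _ => measurable_snd
      · have h1 : MeasurePreserving (fun ω : ℕ → ℕ × (ℕ → E) => (ω c).2) (poissonSamples r ρ)
            (Measure.infinitePi fun _ => ρ c) := by
          refine ⟨measurable_snd.comp (measurable_pi_apply c), ?_⟩
          have h1 := Measure.infinitePi_map_eval (fun c => poissonSample (r c) (ρ c)) c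
          have h2 : (poissonSample (r c) (ρ c)).map Prod.snd = Measure.infinitePi fun _ => ρ c := by
            rw [poissonSample, Measure.map_snd_prod, measure_univ, one_smul]
          rw [← h2, ← h1, Measure.map_map measurable_snd (measurable_pi_apply _)]
          rfl
        exact iIndepFun_comp_measurePreserving
          (iIndepFun_infinitePi (P := fun _ : ℕ => ρ c) (X := fun _ z => z) fun _ => measurable_id)
          (fun i => measurable_pi_apply i) h1
    have hpair := (indepFun_iff_map_prod_eq_prod_map_map
      (measurable_samplePoint a).aemeasurable
      (measurable_samplePoint b).aemeasurable).1 (hind.indepFun hab)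
    rw [hlaw, hlaw] at hpair
    have hD : MeasurableSet {z : E × E | z.1 = z.2} :=
      measurableSet_eq_fun measurable_fst measurable_snd
    have h0 : ((ρ a.1).prod (ρ b.1)) {z : E × E | z.1 = z.2} = 0 := by
      rw [Measure.measure_prod_null hD]
      refine Eventually.of_forall fun z => ?_
      have h1 : Prod.mk z ⁻¹' {z : E × E | z.1 = z.2} = {z} := by
        ext w; simp [eq_comm]
      have h2 := hatom b.1 z
      change ρ b.1 (Prod.mk z ⁻¹' {z : E × E | z.1 = z.2}) = 0
      rw [h1]
      rw [ENNReal.smul_def, smul_eq_mul, mul_eq_zero] at h2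
      exact h2.resolve_left (by exact_mod_cast hr)
    rw [← hpair, Measure.map_apply ((measurable_samplePoint a).prodMk (measurable_samplePoint b))
      hD] at h0
    filter_upwards [measure_eq_zero_iff_ae_notMem.1 h0] with ω hω _
    exact hω

/-- The event that the points are distinct. -/
def distinctPoints (E : Type*) : Set (ℕ → ℕ × (ℕ → E)) :=
  {ω | ∀ a b : (_ : ℕ) × ℕ, a ≠ b → b.2 < (ω b.1).1 → samplePoint ω a ≠ samplePoint ω b}

theorem measurableSet_distinctPoints [MeasurableEq E] : MeasurableSet (distinctPoints E) := by
  simp only [distinctPoints, Set.ofPred_forall]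
  refine MeasurableSet.iInter fun a => MeasurableSet.iInter fun b =>
    MeasurableSet.iInter fun _ => ?_
  have h := (measurableSet_sample_active (E := E) b).compl.union
    (measurableSet_eq_fun (measurable_samplePoint a) (measurable_samplePoint (E := E) b)).compl
  convert! h using 1
  ext ω
  simp only [Set.mem_ofPred_eq, Set.mem_union, Set.mem_compl_iff]
  tauto

open Classical in
/-- The set of the points of the samples, if they are distinct. -/
noncomputable def samplePoints (ω : ℕ → ℕ × (ℕ → E)) : Set E :=
  if ω ∈ distinctPoints E then samplePoint ω '' {a | a.2 < (ω a.1).1} else ∅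

theorem encard_samplePoints_inter {E : Type*} {ω : ℕ → ℕ × (ℕ → E)} (hω : ω ∈ distinctPoints E) (B : Set E) :
    (samplePoints ω ∩ B).encard = (sampleIndices B ω).encard := by
  have h : samplePoints ω ∩ B = samplePoint ω '' sampleIndices B ω := by
    rw [samplePoints, if_pos hω]
    ext z
    constructor
    · rintro ⟨⟨a, ha, rfl⟩, hz⟩; exact ⟨a, ⟨ha, hz⟩, rfl⟩
    · rintro ⟨a, ⟨ha, hz⟩, rfl⟩; exact ⟨⟨a, ha, rfl⟩, hz⟩
  rw [h, Set.InjOn.encard_image]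
  intro a _ b hb hab
  by_contra hne
  exact hω a b hne hb.1 hab

/-- The superposition of independent Poisson samples is a Poisson point process. -/
theorem isPoissonPointProcess_samplePoints [MeasurableEq E] [MeasurableSingletonClass E]
    (hatom : ∀ c z, r c • ρ c {z} = 0) :
    IsPoissonPointProcess (poissonSamples r ρ) samplePoints (Measure.sum fun c => r c • ρ c) := by
  classical
  have hgood : ∀ᵐ ω ∂(poissonSamples r ρ), ω ∈ distinctPoints E := by
    have : ∀ a b : (_ : ℕ) × ℕ, ∀ᵐ ω ∂(poissonSamples r ρ),
        a ≠ b → b.2 < (ω b.1).1 → samplePoint ω a ≠ samplePoint ω b := by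
      intro a b
      by_cases hab : a = b
      · simp [hab]
      · filter_upwards [samplePoint_ne hatom hab] with ω hω _ using hω
    exact ae_all_iff.2 fun a => ae_all_iff.2 fun b => this a b
  have hcongr : ∀ B : Set E, (fun ω => (samplePoints ω ∩ B).encard) =ᵐ[poissonSamples r ρ]
      fun ω => (sampleIndices B ω).encard := by
    intro B
    filter_upwards [hgood] with ω hω using encard_samplePoints_inter hω B
  have hmeas : ∀ B : Set E, MeasurableSet B → ∀ c, Measurable fun ω : ℕ → ℕ × (ℕ → E) =>
      sampleCount B (ω c) := fun B hB c =>
    (measurable_sampleCount hB).comp (measurable_pi_apply c)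
  have hν : ∀ B : Set E, MeasurableSet B → (Measure.sum fun c => r c • ρ c) B =
      ∑' c, ((r c * (ρ c B).toNNReal : ℝ≥0) : ℝ≥0∞) := by
    intro B hB
    rw [Measure.sum_apply _ hB]
    refine tsum_congr fun c => ?_
    rw [Measure.smul_apply, ENNReal.smul_def, ENNReal.coe_mul,
      ENNReal.coe_toNNReal (measure_ne_top _ _), smul_eq_mul]
  refine ⟨fun ω => ?_, fun B hB => ?_, fun B hB hfin => ?_, fun B hB hinf => ?_,
    fun m B hB hd => ?_⟩
  · unfold samplePoints
    split_ifs
    · exact (Set.to_countable _).image _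
    · exact Set.countable_empty
  · have h : (fun ω : ℕ → ℕ × (ℕ → E) => (samplePoints ω ∩ B).encard) =
        fun ω => if ω ∈ distinctPoints E then (sampleIndices B ω).encard else 0 := by
      funext ω
      split_ifs with hω
      · exact encard_samplePoints_inter hω B
      · simp [samplePoints, hω]
    rw [h]
    exact Measurable.ite measurableSet_distinctPoints (measurable_encard_sampleIndices hB)
      measurable_const
  · rw [Measure.map_congr (hcongr B)]
    simp_rw [encard_sampleIndices]
    rw [hν B hB] at hfin ⊢
    exact map_totalCount (hmeas B hB) (iIndepFun_sampleCount_eval hB)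
      (fun c => map_sampleCount_eval hB c) hfin
  · rw [hν B hB] at hinf
    filter_upwards [hcongr B, totalCount_eq_top (hmeas B hB) (iIndepFun_sampleCount_eval hB)
      (fun c => map_sampleCount_eval hB c) hinf] with ω h1 h2
    rw [h1, encard_sampleIndices, h2]
  · exact (iIndepFun_encard_sampleIndices hB hd).congr fun i => (hcongr (B i)).symm

end Superposition

/-- A Poisson point process exists for every s-finite intensity without atoms. -/
theorem exists_isPoissonPointProcess {E : Type} [MeasurableSpace E] [Nonempty E] [MeasurableEq E]
    [MeasurableSingletonClass E] (ν : Measure E) [SFinite ν] (hatom : ∀ z, ν {z} = 0) :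
    ∃ (Ω : Type) (_ : MeasurableSpace Ω) (P : Measure Ω) (N : Ω → Set E),
      IsProbabilityMeasure P ∧ IsPoissonPointProcess P N ν := by
  choose r ρ hρ hν using fun c => exists_smul_probabilityMeasure (sfiniteSeq ν c)
  have hsum : ν = Measure.sum fun c => r c • ρ c := by
    simp_rw [← hν]
    exact (sum_sfiniteSeq ν).symm
  refine ⟨_, _, poissonSamples r ρ, samplePoints, inferInstance, ?_⟩
  have h := isPoissonPointProcess_samplePoints (r := r) (ρ := ρ) (by
    intro c z
    have h1 : (r c • ρ c) {z} = 0 := by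
      rw [← hν c]
      exact le_antisymm ((sfiniteSeq_le ν c {z}).trans (hatom z).le) zero_le
    exact h1)
  rwa [← hsum] at h

end CutPaste

namespace CutPaste

/-! ### Driven paths -/

section Paths

variable {k n : ℕ} {A : Set (ℝ≥0 × CosetMap k)}

/-- The atoms with time in `(a, b]` that act nontrivially on `[n]`. -/
def window (k n : ℕ) (a b : ℝ≥0) : Set (ℝ≥0 × CosetMap k) :=
  Set.Ioc a b ×ˢ cosetCylinder n {finIdMap k n}ᶜ

/-- The atoms with time in `(a, b]` and restriction `m`. -/
def markWindow (a b : ℝ≥0) (m : FinCosetMap k n) : Set (ℝ≥0 × CosetMap k) :=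
  Set.Ioc a b ×ˢ cosetCylinder n {m}

open Classical in
/-- The map of the only atom, if there is just one: `c m` is the number of atoms with
restriction `m`. -/
noncomputable def stepMap (c : FinCosetMap k n → ℕ∞) : FinColoring k n → FinColoring k n :=
  if h : ∃ m, m ≠ finIdMap k n ∧ c m = 1 ∧ ∀ m', m' ≠ finIdMap k n → m' ≠ m → c m' = 0
  then h.choose.act else id

theorem stepMap_eq_act {c : FinCosetMap k n → ℕ∞} {m : FinCosetMap k n} (hm : m ≠ finIdMap k n)
    (hc : c m = 1) (h0 : ∀ m', m' ≠ finIdMap k n → m' ≠ m → c m' = 0) : stepMap c = m.act := by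
  have h : ∃ m, m ≠ finIdMap k n ∧ c m = 1 ∧ ∀ m', m' ≠ finIdMap k n → m' ≠ m → c m' = 0 :=
    ⟨m, hm, hc, h0⟩
  rw [stepMap, dif_pos h]
  congr 1
  by_contra hne
  have := h0 _ h.choose_spec.1 hne
  rw [h.choose_spec.2.1] at this
  exact one_ne_zero this

theorem stepMap_eq_id {c : FinCosetMap k n → ℕ∞}
    (h : ∀ m, m ≠ finIdMap k n → c m ≠ 1) : stepMap c = id := by
  rw [stepMap, dif_neg]
  rintro ⟨m, hm, hc, -⟩
  exact h m hm hc

/-- The map of the only atom in the window, if there is just one. -/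
noncomputable def windowMap (n : ℕ) (A : Set (ℝ≥0 × CosetMap k)) (a b : ℝ≥0) :
    FinColoring k n → FinColoring k n :=
  stepMap fun m => (A ∩ markWindow a b m).encard

theorem windowMap_eq_id (h : A ∩ window k n a b = ∅) : windowMap n A a b = id := by
  refine stepMap_eq_id fun m hm h1 => ?_
  obtain ⟨e, he⟩ := Set.encard_eq_one.1 h1
  have he' : e ∈ A ∩ markWindow a b m := by rw [he]; rfl
  have : e ∈ A ∩ window k n a b := ⟨he'.1, he'.2.1, fun hc => hm (he'.2.2.symm.trans hc)⟩
  rw [h] at this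
  exact this

theorem windowMap_eq_act {e : ℝ≥0 × CosetMap k} (h : A ∩ window k n a b = {e}) :
    windowMap n A a b = (e.2.restrict n).act := by
  have he : e ∈ A ∩ window k n a b := by rw [h]; rfl
  have hsub : ∀ m, m ≠ finIdMap k n → A ∩ markWindow a b m ⊆ {e} := by
    intro m hm e' he'
    rw [← h]
    exact ⟨he'.1, he'.2.1, fun hc => hm (he'.2.2.symm.trans hc)⟩
  refine stepMap_eq_act (fun hc => he.2.2 hc) ?_ fun m' hm' hne => ?_
  · rw [Set.encard_eq_one]
    exact ⟨e, (hsub _ fun hc => he.2.2 hc).antisymm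
      (Set.singleton_subset_iff.2 ⟨he.1, he.2.1, rfl⟩)⟩
  · rw [Set.encard_eq_zero, Set.eq_empty_iff_forall_notMem]
    intro e' he'
    have := hsub m' hm' he'
    rw [Set.mem_singleton_iff] at this
    subst this
    exact hne he'.2.2.symm

/-- Without atoms the path is continuous into a discrete space, hence constant on the connected
interval. At the left endpoint right-continuity is enough, and so an atom at time `a` itself is
harmless. -/
theorem IsDriven.eq_of_inter_window_eq_empty {y : ℝ≥0 → FinColoring k n} (hy : IsDriven n A y)
    {a b : ℝ≥0} (hab : a ≤ b) (h : A ∩ window k n a b = ∅) : y b = y a := by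
  have hc : ContinuousOn y (Set.Icc a b) := by
    intro t ht
    have hright : Tendsto y (𝓝[>] t) (𝓝 (y t)) :=
      tendsto_const_nhds.congr' ((hy.1 t).mono fun s hs => hs.symm)
    have hR : Tendsto y (𝓝[≥] t) (𝓝 (y t)) := continuousWithinAt_Ioi_iff_Ici.1 hright
    rcases eq_or_lt_of_le ht.1 with hat | hat
    · subst hat
      exact hR.mono_left (nhdsWithin_mono _ fun s hs => hs.1)
    · obtain ⟨z, hz, -, hz2⟩ := hy.2 t (lt_of_le_of_lt zero_le hat)
      have hyz : y t = z := hz2 fun M hM => by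
        by_contra hne
        have : (t, M) ∈ A ∩ window k n a b := ⟨hM, ⟨hat, ht.2⟩, hne⟩
        rw [h] at this
        exact this
      rw [← hyz] at hz
      have hleft : Tendsto y (𝓝[<] t) (𝓝 (y t)) :=
        tendsto_const_nhds.congr' (hz.mono fun s hs => hs.symm)
      have hall : Tendsto y (𝓝 t) (𝓝 (y t)) := by
        rw [← nhdsLT_sup_nhdsGE]
        exact hleft.sup hR
      exact hall.mono_left nhdsWithin_le_nhds
  exact isPreconnected_Icc.constant hc (Set.right_mem_Icc.2 hab) (Set.left_mem_Icc.2 hab)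

/-- The path is constant before and after the time of the only atom, so its left limit there is `y
a` and its value there is `y b`. -/
theorem IsDriven.eq_windowMap {y : ℝ≥0 → FinColoring k n} (hy : IsDriven n A y)
    {a b : ℝ≥0} (hab : a ≤ b) (h : (A ∩ window k n a b).encard ≤ 1) :
    y b = windowMap n A a b (y a) := by
  rcases Set.encard_le_one_iff_eq.1 h with h0 | ⟨⟨s, M⟩, h1⟩
  · rw [windowMap_eq_id h0, hy.eq_of_inter_window_eq_empty hab h0, id]
  · rw [windowMap_eq_act h1]
    have he : (s, M) ∈ A ∩ window k n a b := by rw [h1]; rfl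
    have has : a < s := he.2.1.1
    have hsb : s ≤ b := he.2.1.2
    have hne : M.restrict n ≠ finIdMap k n := he.2.2
    have hbs : y b = y s := by
      refine hy.eq_of_inter_window_eq_empty hsb (Set.eq_empty_iff_forall_notMem.2 ?_)
      rintro ⟨s', M'⟩ ⟨hA, ht, hM⟩
      have : (s', M') ∈ A ∩ window k n a b := ⟨hA, ⟨has.trans ht.1, ht.2⟩, hM⟩
      rw [h1, Set.mem_singleton_iff, Prod.mk.injEq] at this
      exact ht.1.ne' this.1
    obtain ⟨z, hz, hz1, -⟩ := hy.2 s (lt_of_le_of_lt zero_le has)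
    have hza : z = y a := by
      have hev : ∀ᶠ u in 𝓝[<] s, y u = y a := by
        filter_upwards [Ioo_mem_nhdsLT has] with u hu
        refine hy.eq_of_inter_window_eq_empty hu.1.le (Set.eq_empty_iff_forall_notMem.2 ?_)
        rintro ⟨s', M'⟩ ⟨hA, ht, hM⟩
        have : (s', M') ∈ A ∩ window k n a b :=
          ⟨hA, ⟨ht.1, (ht.2.trans hu.2.le).trans hsb⟩, hM⟩
        rw [h1, Set.mem_singleton_iff, Prod.mk.injEq] at this
        exact (ht.2.trans_lt hu.2).ne this.1
      have : (𝓝[<] s).NeBot := nhdsLT_neBot_of_exists_lt ⟨a, has⟩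
      obtain ⟨u, hu1, hu2⟩ := (hz.and hev).exists
      rw [← hu1, hu2]
    rw [hbs, hz1 M he.1 hne, hza]

/-- The composition of the maps of the windows `(τ 0, τ 1], …, (τ (L - 1), τ L]`. -/
noncomputable def gridMap (n : ℕ) (A : Set (ℝ≥0 × CosetMap k)) (τ : ℕ → ℝ≥0) :
    ℕ → FinColoring k n → FinColoring k n
  | 0 => id
  | L + 1 => windowMap n A (τ L) (τ (L + 1)) ∘ gridMap n A τ L

theorem IsDriven.eq_gridMap {y : ℝ≥0 → FinColoring k n} (hy : IsDriven n A y) {τ : ℕ → ℝ≥0}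
    (hτ : Monotone τ) {L : ℕ} (h : ∀ l < L, (A ∩ window k n (τ l) (τ (l + 1))).encard ≤ 1) :
    y (τ L) = gridMap n A τ L (y (τ 0)) := by
  induction L with
  | zero => rfl
  | succ L ih =>
    rw [hy.eq_windowMap (hτ (Nat.le_succ L)) (h L (Nat.lt_succ_self L)),
      ih fun l hl => h l (hl.trans (Nat.lt_succ_self L))]
    rfl

/-- The `l`-th of the points that divide `[t, t + s]` into `j + 1` intervals. -/
noncomputable def gridPoint (t s : ℝ≥0) (j l : ℕ) : ℝ≥0 := t + l * (s / (j + 1 : ℕ))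

theorem gridPoint_zero (t s : ℝ≥0) (j : ℕ) : gridPoint t s j 0 = t := by simp [gridPoint]

theorem gridPoint_last (t s : ℝ≥0) (j : ℕ) : gridPoint t s j (j + 1) = t + s := by
  rw [gridPoint, mul_div_cancel₀]
  exact_mod_cast Nat.succ_ne_zero j

theorem gridPoint_mono (t s : ℝ≥0) (j : ℕ) : Monotone (gridPoint t s j) := by
  intro l l' h
  unfold gridPoint
  gcongr

theorem gridPoint_succ (t s : ℝ≥0) (j l : ℕ) :
    gridPoint t s j (l + 1) = gridPoint t s j l + s / (j + 1 : ℕ) := by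
  unfold gridPoint
  push_cast
  ring

/-- The atoms that act nontrivially on `[n]` are locally finite, and their times are distinct. -/
def IsSimple (A : Set (ℝ≥0 × CosetMap k)) : Prop :=
  ∀ n T, (A ∩ window k n 0 T).Finite ∧
    ∀ e ∈ A ∩ window k n 0 T, ∀ e' ∈ A ∩ window k n 0 T, e.1 = e'.1 → e = e'

/-- Only finitely many atoms matter and their times are distinct, so the mesh eventually falls below
the smallest gap. -/
theorem IsSimple.eventually_encard_le_one (hA : IsSimple A) (n : ℕ) (t s : ℝ≥0) :
    ∀ᶠ j in atTop, ∀ l < j + 1,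
      (A ∩ window k n (gridPoint t s j l) (gridPoint t s j (l + 1))).encard ≤ 1 := by
  obtain ⟨hfin, hdist⟩ := hA n (t + s)
  have hlim : Tendsto (fun j : ℕ => s / ((j + 1 : ℕ) : ℝ≥0)) atTop (𝓝 0) :=
    (tendsto_const_div_atTop_nhds_zero_nat s).comp (tendsto_add_atTop_nat 1)
  have h1 : ∀ᶠ j : ℕ in atTop, ∀ e ∈ A ∩ window k n 0 (t + s), ∀ e' ∈ A ∩ window k n 0 (t + s),
      e.1 < e'.1 → s / ((j + 1 : ℕ) : ℝ≥0) < e'.1 - e.1 := by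
    refine (eventually_all_finite hfin).2 fun e _ => (eventually_all_finite hfin).2 fun e' _ => ?_
    by_cases hlt : e.1 < e'.1
    · filter_upwards [hlim.eventually (gt_mem_nhds (tsub_pos_of_lt hlt))] with j hj _ using hj
    · exact Eventually.of_forall fun j h => absurd h hlt
  filter_upwards [h1] with j hj l hl
  have hsub : A ∩ window k n (gridPoint t s j l) (gridPoint t s j (l + 1)) ⊆
      A ∩ window k n 0 (t + s) := by
    rintro e ⟨he, ht, hm⟩
    refine ⟨he, ⟨lt_of_le_of_lt zero_le ht.1, ht.2.trans ?_⟩, hm⟩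
    rw [← gridPoint_last t s j]
    exact gridPoint_mono t s j hl
  have key : ∀ e ∈ A ∩ window k n (gridPoint t s j l) (gridPoint t s j (l + 1)),
      ∀ e' ∈ A ∩ window k n (gridPoint t s j l) (gridPoint t s j (l + 1)), ¬ e.1 < e'.1 := by
    intro e he e' he' hlt
    have h2 := hj e (hsub he) e' (hsub he') hlt
    have h3 := he'.2.1.2
    rw [gridPoint_succ] at h3
    have h4 : e'.1 ≤ e.1 + s / ((j + 1 : ℕ) : ℝ≥0) := h3.trans (by gcongr; exact he.2.1.1.le)
    exact absurd h2 (not_lt.2 (tsub_le_iff_left.2 h4))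
  rw [Set.encard_le_one_iff]
  intro e e' he he'
  exact hdist e (hsub he) e' (hsub he')
    (le_antisymm (not_lt.1 (key e' he' e he)) (not_lt.1 (key e he e' he')))

/-- Apply the maps `g t`, `t ∈ S`, in increasing order of `t`. -/
noncomputable def evolve {F : Type*} (g : ℝ≥0 → F → F) (S : Finset ℝ≥0) (x : F) : F :=
  (S.sort (· ≥ ·)).foldr g x

theorem evolve_insert {F : Type*} (g : ℝ≥0 → F → F) {S : Finset ℝ≥0} {t : ℝ≥0}
    (h : ∀ s ∈ S, s < t) (x : F) : evolve g (insert t S) x = g t (evolve g S x) := by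
  rw [evolve, Finset.sort_insert _ (fun b hb => (h b hb).le) (fun ht => lt_irrefl _ (h t ht))]
  rfl

/-- The path at time `t` composes the maps of the finitely many nontrivial atoms up to `t`. Local
finiteness makes this composition constant just after `t`, and just before `t` equal to the one over
times less than `t`; distinct times make the map at each time unique. -/
theorem IsSimple.exists_isDriven (hA : IsSimple A) (n : ℕ) (x : FinColoring k n) :
    ∃ y : ℝ≥0 → FinColoring k n, y 0 = x ∧ IsDriven n A y := by
  classical
  set D : Set ℝ≥0 := {t | 0 < t ∧ ∃ M, (t, M) ∈ A ∧ M.restrict n ≠ finIdMap k n} with hD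
  have hDfin : ∀ T, (D ∩ Set.Iic T).Finite := by
    intro T
    refine ((hA n T).1.image Prod.fst).subset ?_
    rintro t ⟨⟨h0, M, hM, hne⟩, hT⟩
    exact ⟨(t, M), ⟨hM, ⟨h0, hT⟩, hne⟩, rfl⟩
  let g : ℝ≥0 → FinColoring k n → FinColoring k n := fun t =>
    if h : ∃ M, (t, M) ∈ A ∧ M.restrict n ≠ finIdMap k n then (h.choose.restrict n).act else id
  have hg : ∀ t M, 0 < t → (t, M) ∈ A → M.restrict n ≠ finIdMap k n →
      g t = (M.restrict n).act := by
    intro t M h0 hM hne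
    have h : ∃ M, (t, M) ∈ A ∧ M.restrict n ≠ finIdMap k n := ⟨M, hM, hne⟩
    have h1 := (hA n t).2 (t, h.choose) ⟨h.choose_spec.1, ⟨h0, le_rfl⟩, h.choose_spec.2⟩
      (t, M) ⟨hM, ⟨h0, le_rfl⟩, hne⟩ rfl
    simp only [g, dif_pos h]
    rw [(Prod.mk.inj h1).2]
  have hDlt : ∀ t, (D ∩ Set.Iio t).Finite := fun t =>
    (hDfin t).subset (Set.inter_subset_inter_right _ Set.Iio_subset_Iic_self)
  refine ⟨fun t => evolve g (hDfin t).toFinset x, ?_, ?_, ?_⟩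
  · have : (hDfin 0).toFinset = ∅ := by
      rw [Set.Finite.toFinset_eq_empty, Set.eq_empty_iff_forall_notMem]
      rintro t ⟨⟨h0, -⟩, hT⟩
      exact absurd h0 (not_lt.2 hT)
    simp [this, evolve]
  · intro t
    have h1 : ∀ᶠ s in 𝓝[>] t, ∀ d ∈ D ∩ Set.Iic (t + 1), t < d → s < d := by
      refine (eventually_all_finite (hDfin (t + 1))).2 fun d _ => ?_
      by_cases htd : t < d
      · filter_upwards [Ioo_mem_nhdsGT htd] with s hs _ using hs.2
      · exact Eventually.of_forall fun s h => absurd h htd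
    filter_upwards [h1, Ioo_mem_nhdsGT (lt_add_one t)] with s hs hst
    have : (hDfin s).toFinset = (hDfin t).toFinset := by
      rw [Set.Finite.toFinset_inj]
      refine Set.Subset.antisymm ?_
        (Set.inter_subset_inter_right _ (Set.Iic_subset_Iic.2 hst.1.le))
      rintro d ⟨hd, hds⟩
      refine ⟨hd, Set.mem_Iic.2 (not_lt.1 fun htd => ?_)⟩
      exact absurd (hs d ⟨hd, le_trans hds hst.2.le⟩ htd) (not_lt.2 hds)
    simp only [this]
  · intro t ht
    refine ⟨evolve g (hDlt t).toFinset x, ?_, ?_, ?_⟩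
    · have h1 : ∀ᶠ s in 𝓝[<] t, ∀ d ∈ D ∩ Set.Iio t, d ≤ s := by
        refine (eventually_all_finite (hDlt t)).2 fun d hd => ?_
        filter_upwards [Ioo_mem_nhdsLT (show d < t from hd.2)] with s hs using hs.1.le
      filter_upwards [h1, self_mem_nhdsWithin] with s hs hst
      have : (hDfin s).toFinset = (hDlt t).toFinset := by
        rw [Set.Finite.toFinset_inj]
        exact Set.Subset.antisymm (fun d hd => ⟨hd.1, Set.mem_Iio.2 (lt_of_le_of_lt hd.2 hst)⟩)
          fun d hd => ⟨hd.1, hs d hd⟩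
      simp only [this]
    · intro M hM hne
      have hins : (hDfin t).toFinset = insert t (hDlt t).toFinset := by
        ext d
        simp only [Set.Finite.mem_toFinset, Finset.mem_insert]
        constructor
        · rintro ⟨hd, hdt⟩
          rcases eq_or_lt_of_le (show d ≤ t from hdt) with h | h
          · exact Or.inl h
          · exact Or.inr ⟨hd, h⟩
        · rintro (rfl | hd)
          · exact ⟨⟨ht, M, hM, hne⟩, Set.mem_Iic.2 le_rfl⟩
          · exact ⟨hd.1, Set.mem_Iic.2 (le_of_lt hd.2)⟩
      change evolve g (hDfin t).toFinset x = _
      rw [hins, evolve_insert, hg t M ht hM hne]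
      intro s hs
      exact ((Set.Finite.mem_toFinset _).1 hs).2
    · intro h
      have : (hDfin t).toFinset = (hDlt t).toFinset := by
        rw [Set.Finite.toFinset_inj]
        refine Set.Subset.antisymm (fun d hd => ⟨hd.1, Set.mem_Iio.2 (lt_of_le_of_ne hd.2 ?_)⟩)
          (Set.inter_subset_inter_right _ Set.Iio_subset_Iic_self)
        rintro rfl
        obtain ⟨⟨-, M, hM, hne⟩, -⟩ := hd
        exact hne (h M hM)
      simp only [this]

theorem IsDriven.truncate {m : ℕ} (h : n ≤ m) {y : ℝ≥0 → FinColoring k m} (hy : IsDriven m A y) :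
    IsDriven n A fun t i => y t (Fin.castLE h i) := by
  refine ⟨fun t => ?_, fun t ht => ?_⟩
  · filter_upwards [hy.1 t] with s hs
    rw [hs]
  · obtain ⟨z, hz, hz1, hz2⟩ := hy.2 t ht
    refine ⟨fun i => z (Fin.castLE h i), ?_, ?_, ?_⟩
    · filter_upwards [hz] with s hs
      rw [hs]
    · intro M hM hne
      change (fun i => y t (Fin.castLE h i)) = _
      rw [hz1 M hM fun hc => hne (restrict_eq_finIdMap_of_le h hc)]
      rfl
    · intro hid
      change (fun i => y t (Fin.castLE h i)) = _
      -- An atom may be trivial on `[n]` but not on `[m]`: then the larger path can jump, while its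
      -- first `n` coordinates do not move.
      by_cases hex : ∃ M, (t, M) ∈ A ∧ M.restrict m ≠ finIdMap k m
      · obtain ⟨M, hM, hne⟩ := hex
        rw [hz1 M hM hne]
        have h1 := hid M hM
        funext i
        exact congrFun (congrFun h1 (z (Fin.castLE h i))) i
      · push Not at hex
        rw [hz2 hex]

end Paths

end CutPaste

namespace CutPaste

/-! ### Window maps of a Poisson point process -/

theorem measurableEmbedding_nnreal_coe : MeasurableEmbedding ((↑) : ℝ≥0 → ℝ) :=
  NNReal.isClosedEmbedding_coe.measurableEmbedding

theorem lebesgue_Ioc (a b : ℝ≥0) : lebesgue (Set.Ioc a b) = ENNReal.ofReal (b - a) := by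
  rw [lebesgue, measurableEmbedding_nnreal_coe.comap_apply]
  have : ((↑) : ℝ≥0 → ℝ) '' Set.Ioc a b = Set.Ioc (a : ℝ) b := by
    ext x
    constructor
    · rintro ⟨y, hy, rfl⟩
      exact ⟨NNReal.coe_lt_coe.2 hy.1, NNReal.coe_le_coe.2 hy.2⟩
    · intro hx
      lift x to ℝ≥0 using a.coe_nonneg.trans hx.1.le
      exact ⟨x, ⟨NNReal.coe_lt_coe.1 hx.1, NNReal.coe_le_coe.1 hx.2⟩, rfl⟩
  rw [this, Real.volume_Ioc]

theorem lebesgue_singleton (a : ℝ≥0) : lebesgue {a} = 0 := by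
  rw [lebesgue, measurableEmbedding_nnreal_coe.comap_apply]
  simp

instance sigmaFinite_lebesgue : SigmaFinite lebesgue :=
  ⟨⟨{ set := fun j => Set.Iic j
      set_mem := fun _ => trivial
      finite := fun j => by
        have h : Set.Iic (j : ℝ≥0) ⊆ {0} ∪ Set.Ioc 0 (j : ℝ≥0) := fun x hx =>
          (eq_or_ne x 0).imp id fun h0 => ⟨pos_iff_ne_zero.2 h0, hx⟩
        refine (measure_mono h).trans_lt ((measure_union_le _ _).trans_lt ?_)
        rw [lebesgue_singleton, lebesgue_Ioc, zero_add]
        exact ENNReal.ofReal_lt_top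
      spanning := Set.iUnion_eq_univ_iff.2 fun x => exists_nat_ge x }⟩⟩

section Window

variable {k n : ℕ}

theorem measurableSet_markWindow (a b : ℝ≥0) (m : FinCosetMap k n) :
    MeasurableSet (markWindow a b m) :=
  measurableSet_Ioc.prod (measurableSet_cosetCylinder _ _)

theorem measurableSet_window (a b : ℝ≥0) : MeasurableSet (window k n a b) :=
  measurableSet_Ioc.prod (measurableSet_cosetCylinder _ _)

variable {χ : Measure (CosetMap k)} [SFinite χ]

theorem prod_markWindow (a h : ℝ≥0) (m : FinCosetMap k n) :
    lebesgue.prod χ (markWindow a (a + h) m) = h * χ (cosetCylinder n {m}) := by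
  rw [markWindow, Measure.prod_prod, lebesgue_Ioc]
  simp

theorem prod_window (a h : ℝ≥0) :
    lebesgue.prod χ (window k n a (a + h)) = h * χ (cosetCylinder n {finIdMap k n}ᶜ) := by
  rw [window, Measure.prod_prod, lebesgue_Ioc]
  simp

variable {Ω : Type*} [MeasurableSpace Ω] {P : Measure Ω}
  {N : Ω → Set (ℝ≥0 × CosetMap k)}

theorem IsPoissonPointProcess.measureReal_encard_eq {E : Type*} [MeasurableSpace E]
    {N : Ω → Set E} {ν : Measure E} (hN : IsPoissonPointProcess P N ν) {B : Set E}
    (hB : MeasurableSet B) (hν : ν B ≠ ∞) (c : ℕ) :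
    P.real {ω | (N ω ∩ B).encard = c} =
      Real.exp (-(ν B).toReal) * (ν B).toReal ^ c / c.factorial := by
  have h1 : {ω | (N ω ∩ B).encard = c} = (fun ω => (N ω ∩ B).encard) ⁻¹' {(c : ℕ∞)} := rfl
  rw [h1, ← map_measureReal_apply (hN.measurable B hB) (measurableSet_singleton _),
    hN.poisson B hB hν, map_measureReal_apply (measurable_of_countable _)
      (measurableSet_singleton _)]
  have h2 : (fun m : ℕ => (m : ℕ∞)) ⁻¹' {(c : ℕ∞)} = {c} := by
    ext m; simp
  rw [h2, poissonMeasure_real_singleton]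
  rfl

theorem IsPoissonPointProcess.ae_encard_ne_top {E : Type*} [MeasurableSpace E]
    {N : Ω → Set E} {ν : Measure E} (hN : IsPoissonPointProcess P N ν) {B : Set E}
    (hB : MeasurableSet B) (hν : ν B ≠ ∞) : ∀ᵐ ω ∂P, (N ω ∩ B).encard ≠ ⊤ := by
  have h1 : {ω | ¬ (N ω ∩ B).encard ≠ ⊤} = (fun ω => (N ω ∩ B).encard) ⁻¹' {⊤} := by
    ext; simp
  rw [ae_iff, h1, ← Measure.map_apply (hN.measurable B hB) (measurableSet_singleton _),
    hN.poisson B hB hν, Measure.map_apply (measurable_of_countable _)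
      (measurableSet_singleton _)]
  have h2 : (fun m : ℕ => (m : ℕ∞)) ⁻¹' {⊤} = ∅ := by
    ext m; simp
  rw [h2, measure_empty]

/-- From `exp (-a) ≥ 1 - a`, multiplied by `1 + a`. The left side is the probability that a Poisson
variable of mean `a` is at least two. -/
theorem one_sub_exp_mul_le_sq {a : ℝ} (ha : 0 ≤ a) :
    1 - (Real.exp (-a) + Real.exp (-a) * a) ≤ a ^ 2 := by
  nlinarith [Real.add_one_le_exp (-a)]

theorem IsPoissonPointProcess.measureReal_one_lt_encard_le [IsProbabilityMeasure P] {E : Type*} [MeasurableSpace E]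
    {N : Ω → Set E} {ν : Measure E} (hN : IsPoissonPointProcess P N ν) {B : Set E}
    (hB : MeasurableSet B) (hν : ν B ≠ ∞) :
    P.real {ω | 1 < (N ω ∩ B).encard} ≤ (ν B).toReal ^ 2 := by
  have hm := hN.measurable B hB
  have hm' : ∀ c : ℕ, MeasurableSet {ω | (N ω ∩ B).encard = c} := fun c =>
    measurableSet_eq_fun hm measurable_const
  have h1 : {ω | 1 < (N ω ∩ B).encard} =
      ({ω | (N ω ∩ B).encard = (0 : ℕ)} ∪ {ω | (N ω ∩ B).encard = (1 : ℕ)})ᶜ := by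
    ext ω
    simp only [Set.mem_ofPred_eq, Set.mem_compl_iff, Set.mem_union, Nat.cast_zero, Nat.cast_one]
    rw [← not_le, Order.le_one_iff]
  rw [h1, measureReal_compl ((hm' 0).union (hm' 1)), measureReal_union _ (hm' 1),
    hN.measureReal_encard_eq hB hν, hN.measureReal_encard_eq hB hν, probReal_univ]
  · simpa using one_sub_exp_mul_le_sq (ENNReal.toReal_nonneg (a := ν B))
  · rw [Set.disjoint_left]
    intro ω h0 h1
    simp only [Set.mem_ofPred_eq] at h0 h1
    rw [h0] at h1
    simp at h1

end Window

end CutPaste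

namespace CutPaste

/-! ### The law of the map of a window. -/

section Window

variable {k n : ℕ} {χ : Measure (CosetMap k)}

theorem IsRegular.cosetCylinder_ne_top (hχ : IsRegular χ) {S : Set (FinCosetMap k n)}
    (hS : finIdMap k n ∉ S) : χ (cosetCylinder n S) ≠ ∞ := by
  refine ((measure_mono fun M hM => ?_).trans_lt (hχ.2 n)).ne
  intro hc
  rw [← hc] at hS
  exact hS hM

theorem IsRegular.measureReal_cosetCylinder (hχ : IsRegular χ) {S : Finset (FinCosetMap k n)}
    (hS : finIdMap k n ∉ S) : χ.real (cosetCylinder n (S : Set (FinCosetMap k n))) =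
      ∑ m ∈ S, χ.real (cosetCylinder n {m}) := by
  have h : cosetCylinder n (S : Set (FinCosetMap k n)) = ⋃ m ∈ S, cosetCylinder n {m} := by
    ext M
    simp [cosetCylinder]
  rw [h]
  refine measureReal_biUnion_finset ?_ (fun m _ => measurableSet_cosetCylinder _ _) ?_
  · intro m _ m' _ hne
    exact Set.disjoint_left.2 fun M hM hM' => hne (hM.symm.trans hM')
  · intro m hm
    refine hχ.cosetCylinder_ne_top fun hc => hS ?_
    rwa [Set.mem_singleton_iff.1 hc]

variable [SFinite χ] {Ω : Type*} [MeasurableSpace Ω] {P : Measure Ω}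
  {N : Ω → Set (ℝ≥0 × CosetMap k)}

theorem IsPoissonPointProcess.iIndepFun_fintype {E : Type*} [MeasurableSpace E]
    {N : Ω → Set E} {ν : Measure E} (hN : IsPoissonPointProcess P N ν) {ι : Type*} [Fintype ι]
    {B : ι → Set E} (hB : ∀ i, MeasurableSet (B i))
    (hd : Pairwise fun i j => Disjoint (B i) (B j)) :
    iIndepFun (fun i ω => (N ω ∩ B i).encard) P := by
  have e := Fintype.equivFin ι
  have h := (hN.indep _ (fun i => B (e.symm i)) (fun i => hB _)
    fun i j hij => hd fun hc => hij (e.symm.injective hc)).precomp e.injective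
  simpa using h

/-- Window maps are functions of finitely many point counts, so they inherit measurability and
independence from the counts. -/
theorem measurable_stepMap : Measurable (stepMap (k := k) (n := n)) :=
  measurable_of_countable _

variable {ν : Measure (ℝ≥0 × CosetMap k)}

theorem IsPoissonPointProcess.measurable_windowMap (hN : IsPoissonPointProcess P N ν)
    (n : ℕ) (a b : ℝ≥0) : Measurable fun ω => windowMap n (N ω) a b :=
  measurable_stepMap.comp
    (measurable_pi_lambda _ fun m => hN.measurable _ (measurableSet_markWindow a b m))

theorem IsPoissonPointProcess.measurable_windowMap_apply (hN : IsPoissonPointProcess P N ν)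
    (n : ℕ) (a b : ℝ≥0) (y : FinColoring k n) : Measurable fun ω => windowMap n (N ω) a b y :=
  (measurable_pi_apply y).comp (hN.measurable_windowMap n a b)

theorem IsPoissonPointProcess.iIndepFun_markWindow (hN : IsPoissonPointProcess P N ν)
    (n : ℕ) {ι : Type*} [Fintype ι] {a b : ι → ℝ≥0}
    (hd : Pairwise fun i j => Disjoint (Set.Ioc (a i) (b i)) (Set.Ioc (a j) (b j))) :
    iIndepFun (fun (p : ι × FinCosetMap k n) ω => (N ω ∩ markWindow (a p.1) (b p.1) p.2).encard)
      P := by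
  refine hN.iIndepFun_fintype (fun p => measurableSet_markWindow _ _ _) fun p p' hne => ?_
  by_cases h1 : p.1 = p'.1
  · have h2 : p.2 ≠ p'.2 := fun h2 => hne (Prod.ext h1 h2)
    exact Set.disjoint_left.2 fun e he he' => h2 (he.2.symm.trans he'.2)
  · exact Set.disjoint_left.2 fun e he he' => Set.disjoint_left.1 (hd h1) he.1 he'.1

theorem IsPoissonPointProcess.iIndepFun_windowMap [IsProbabilityMeasure P] (hN : IsPoissonPointProcess P N ν)
    (n : ℕ) {ι : Type*} [Fintype ι] {a b : ι → ℝ≥0}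
    (hd : Pairwise fun i j => Disjoint (Set.Ioc (a i) (b i)) (Set.Ioc (a j) (b j))) :
    iIndepFun (fun i ω => windowMap n (N ω) (a i) (b i)) P :=
  (iIndepFun_curry (X := fun i m ω => (N ω ∩ markWindow (a i) (b i) m).encard) (fun _ _ => hN.measurable _ (measurableSet_markWindow _ _ _))
    (hN.iIndepFun_markWindow n hd)).comp (fun _ => stepMap) fun _ => measurable_stepMap

-- Since `y ≠ y'`, the default value `id` is excluded: exactly one nontrivial atom is present and
-- its map carries `y` to `y'`. This expresses the event by prescribed values of independent counts.
open Classical in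
theorem stepMap_apply_eq_iff {c : FinCosetMap k n → ℕ∞} {y y' : FinColoring k n} (hne : y ≠ y') :
    stepMap c y = y' ↔ ∃ m ∈ Finset.univ.filter fun m : FinCosetMap k n => m.act y = y',
      ∀ m' ∈ Finset.univ.erase (finIdMap k n), c m' = ((if m' = m then 1 else 0 : ℕ) : ℕ∞) := by
  constructor
  · intro h
    by_cases hex : ∃ m, m ≠ finIdMap k n ∧ c m = 1 ∧ ∀ m', m' ≠ finIdMap k n → m' ≠ m → c m' = 0
    · obtain ⟨m, hm, hc, h0⟩ := hex
      rw [stepMap_eq_act hm hc h0] at h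
      refine ⟨m, by simpa using h, fun m' hm' => ?_⟩
      by_cases hmm : m' = m
      · subst hmm; simp [hc]
      · simp [hmm, h0 m' (Finset.ne_of_mem_erase hm') hmm]
    · rw [stepMap, dif_neg hex] at h
      exact absurd h hne
  · rintro ⟨m, hm, h⟩
    have hact : m.act y = y' := (Finset.mem_filter.1 hm).2
    have hid : m ≠ finIdMap k n := by
      rintro rfl
      exact hne hact
    rw [stepMap_eq_act hid (by simpa using h m (Finset.mem_erase.2 ⟨hid, Finset.mem_univ _⟩)), hact]
    intro m' hm' hmm
    simpa [hmm] using h m' (Finset.mem_erase.2 ⟨hm', Finset.mem_univ _⟩)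

variable [IsProbabilityMeasure P]

/-- For each admissible mark `m`, one atom with mark `m` and none with another nontrivial mark is a
product of independent Poisson probabilities. The exponentials combine to the total rate, and the
factors `h * χ` are summed over the disjoint choices of `m`. -/
theorem IsPoissonPointProcess.measureReal_windowMap_of_ne
    (hN : IsPoissonPointProcess P N (lebesgue.prod χ)) (hχ : IsRegular χ) (a h : ℝ≥0)
    {y y' : FinColoring k n} (hne : y ≠ y') :
    P.real {ω | windowMap n (N ω) a (a + h) y = y'} =
      Real.exp (-(h * χ.real (cosetCylinder n {finIdMap k n}ᶜ))) *
        (h * χ.real {M | (M.restrict n).act y = y'}) := by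
  classical
  have hmeas : ∀ m : FinCosetMap k n,
      Measurable fun ω => (N ω ∩ markWindow a (a + h) m).encard := fun m =>
    hN.measurable _ (measurableSet_markWindow _ _ _)
  have hset : {ω | windowMap n (N ω) a (a + h) y = y'} =
      ⋃ m ∈ Finset.univ.filter fun m : FinCosetMap k n => m.act y = y',
        ⋂ m' ∈ Finset.univ.erase (finIdMap k n),
          (fun ω => (N ω ∩ markWindow a (a + h) m').encard) ⁻¹'
            {((if m' = m then 1 else 0 : ℕ) : ℕ∞)} := by
    ext ω
    simp only [Set.mem_ofPred_eq, windowMap, stepMap_apply_eq_iff hne, Set.mem_iUnion,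
      Set.mem_iInter, Set.mem_preimage, Set.mem_singleton_iff, exists_prop]
  have hindep : iIndepFun (fun (m : FinCosetMap k n) ω => (N ω ∩ markWindow a (a + h) m).encard)
      P := by
    have := (hN.iIndepFun_markWindow n (ι := Unit) (a := fun _ => a) (b := fun _ => a + h)
      fun i j hij => absurd (Subsingleton.elim i j) hij).precomp
      (g := fun m : FinCosetMap k n => ((), m)) fun m m' hmm => (Prod.mk.inj hmm).2
    exact this
  have hfin : ∀ m : FinCosetMap k n, m ≠ finIdMap k n →
      lebesgue.prod χ (markWindow a (a + h) m) ≠ ∞ := by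
    intro m hm
    rw [prod_markWindow]
    exact ENNReal.mul_ne_top ENNReal.coe_ne_top (hχ.cosetCylinder_ne_top fun hc => hm hc.symm)
  have hreal : ∀ m : FinCosetMap k n, (lebesgue.prod χ (markWindow a (a + h) m)).toReal =
      h * χ.real (cosetCylinder n {m}) := by
    intro m
    rw [prod_markWindow, ENNReal.toReal_mul]
    rfl
  have hmid : ∀ m ∈ Finset.univ.filter fun m : FinCosetMap k n => m.act y = y',
      m ≠ finIdMap k n := by
    rintro m hm rfl
    exact hne (Finset.mem_filter.1 hm).2
  rw [hset, measureReal_biUnion_finset]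
  · have hone : ∀ m ∈ Finset.univ.filter fun m : FinCosetMap k n => m.act y = y',
        P.real (⋂ m' ∈ Finset.univ.erase (finIdMap k n),
          (fun ω => (N ω ∩ markWindow a (a + h) m').encard) ⁻¹'
            {((if m' = m then 1 else 0 : ℕ) : ℕ∞)}) =
        Real.exp (-(h * χ.real (cosetCylinder n {finIdMap k n}ᶜ))) *
          (h * χ.real (cosetCylinder n {m})) := by
      intro m hm
      rw [measureReal_def, hindep.measure_inter_preimage_eq_mul _
        (fun m' _ => measurableSet_singleton _), ENNReal.toReal_prod]
      have h1 : ∀ m' ∈ Finset.univ.erase (finIdMap k n),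
          (P ((fun ω => (N ω ∩ markWindow a (a + h) m').encard) ⁻¹'
            {((if m' = m then 1 else 0 : ℕ) : ℕ∞)})).toReal =
          Real.exp (-(h * χ.real (cosetCylinder n {m'}))) *
            (if m' = m then h * χ.real (cosetCylinder n {m'}) else 1) := by
        intro m' hm'
        have h2 := hN.measureReal_encard_eq (measurableSet_markWindow a (a + h) m')
          (hfin m' (Finset.ne_of_mem_erase hm')) (if m' = m then 1 else 0)
        rw [hreal] at h2
        refine h2.trans ?_
        split_ifs <;> simp
      rw [Finset.prod_congr rfl h1, Finset.prod_mul_distrib, ← Real.exp_sum,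
        Finset.prod_ite_eq', if_pos (Finset.mem_erase.2 ⟨hmid m hm, Finset.mem_univ _⟩),
        Finset.sum_neg_distrib, ← Finset.mul_sum,
        ← hχ.measureReal_cosetCylinder (Finset.notMem_erase _ _), Finset.coe_erase,
        Finset.coe_univ, ← Set.compl_eq_univ_sdiff]
    rw [Finset.sum_congr rfl hone, ← Finset.mul_sum, ← Finset.mul_sum]
    rw [← hχ.measureReal_cosetCylinder fun hc => hmid _ hc rfl, Finset.coe_filter_univ]
    rfl
  · intro m hm m' hm' hmm
    refine Set.disjoint_left.2 fun ω hω hω' => ?_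
    have h1 := Set.mem_iInter₂.1 hω m (Finset.mem_erase.2 ⟨hmid m hm, Finset.mem_univ _⟩)
    have h2 := Set.mem_iInter₂.1 hω' m (Finset.mem_erase.2 ⟨hmid m hm, Finset.mem_univ _⟩)
    simp only [Set.mem_preimage, Set.mem_singleton_iff, if_true, if_neg hmm] at h1 h2
    rw [h1] at h2
    simp at h2
  · exact fun m _ => Finset.measurableSet_biInter _ fun m' _ => hmeas m' (measurableSet_singleton _)

/-- The law of the map of a window of length `h`. -/
noncomputable def windowKernel (P : Measure Ω) (N : Ω → Set (ℝ≥0 × CosetMap k)) (n : ℕ) (h : ℝ≥0)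
    (y y' : FinColoring k n) : ℝ :=
  P.real {ω | windowMap n (N ω) 0 h y = y'}

theorem sum_measureReal_eq_of_fintype {F : Type*} [Fintype F] [MeasurableSpace F]
    [MeasurableSingletonClass F] {f : Ω → F} (hf : Measurable f) :
    ∑ y, P.real {ω | f ω = y} = 1 := by
  have h := measureReal_biUnion_finset (μ := P) (s := Finset.univ) (f := fun y => {ω | f ω = y})
    (fun y _ y' _ hne => Set.disjoint_left.2 fun ω h h' => hne (h.symm.trans h'))
    fun y _ => hf (measurableSet_singleton y)
  rw [← h, ← probReal_univ (μ := P)]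
  congr 1
  ext ω
  simp

theorem IsPoissonPointProcess.isStochastic_windowKernel (hN : IsPoissonPointProcess P N ν)
    (n : ℕ) (h : ℝ≥0) : IsStochastic (windowKernel P N n h) where
  nonneg _ _ := measureReal_nonneg
  sum_eq_one y := sum_measureReal_eq_of_fintype (hN.measurable_windowMap_apply n 0 h y)

theorem windowKernel_zero (y y' : FinColoring k n) :
    windowKernel P N n 0 y y' = if y = y' then 1 else 0 := by
  have h : ∀ ω, windowMap n (N ω) 0 0 y = y := fun ω => by
    rw [windowMap_eq_id (by simp [window])]; rfl
  simp only [windowKernel, h]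
  split_ifs with hy <;> simp [hy]

/-- Stationarity in time. Off the diagonal the explicit formula does not involve `a`; on the
diagonal the probability is what remains of the total mass. -/
theorem IsPoissonPointProcess.measureReal_windowMap
    (hN : IsPoissonPointProcess P N (lebesgue.prod χ)) (hχ : IsRegular χ) (a h : ℝ≥0)
    (y y' : FinColoring k n) :
    P.real {ω | windowMap n (N ω) a (a + h) y = y'} = windowKernel P N n h y y' := by
  have hoff : ∀ y', y ≠ y' →
      P.real {ω | windowMap n (N ω) a (a + h) y = y'} = windowKernel P N n h y y' := by
    intro y' hne
    rw [hN.measureReal_windowMap_of_ne hχ a h hne]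
    have := hN.measureReal_windowMap_of_ne hχ 0 h hne
    rw [zero_add] at this
    exact this.symm
  by_cases hne : y = y'
  · subst hne
    have h1 := sum_measureReal_eq_of_fintype (P := P)
      (hN.measurable_windowMap_apply n a (a + h) y)
    have h2 := (hN.isStochastic_windowKernel n h).sum_eq_one y
    rw [← Finset.sum_erase_add _ _ (Finset.mem_univ y)] at h1 h2
    rw [Finset.sum_congr rfl fun z hz => hoff z (Finset.ne_of_mem_erase hz).symm] at h1
    linarith
  · exact hoff y' hne

/-- Windows with several atoms are treated as empty, so this kernel need not form a semigroup in
`h`. Its first-order behavior is all that `tendsto_kernelPow` requires. -/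
theorem IsPoissonPointProcess.tendsto_windowKernel
    (hN : IsPoissonPointProcess P N (lebesgue.prod χ)) (hχ : IsRegular χ)
    {y y' : FinColoring k n} (hne : y ≠ y') :
    Tendsto (fun h : ℝ≥0 => (h : ℝ)⁻¹ * windowKernel P N n h y y') (𝓝[>] 0)
      (𝓝 (χ.real {M | (M.restrict n).act y = y'})) := by
  set l := χ.real (cosetCylinder n {finIdMap k n}ᶜ)
  set q := χ.real {M | (M.restrict n).act y = y'}
  have h1 : Tendsto (fun h : ℝ≥0 => Real.exp (-(h * l)) * q) (𝓝[>] 0) (𝓝 q) := by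
    have hc : Continuous fun h : ℝ≥0 => Real.exp (-(h * l)) * q := by fun_prop
    have := (hc.tendsto 0).mono_left (nhdsWithin_le_nhds (s := Set.Ioi 0))
    simpa using this
  refine h1.congr' ?_
  filter_upwards [self_mem_nhdsWithin] with h hh
  have hh0 : (h : ℝ) ≠ 0 := by exact_mod_cast (ne_of_gt hh)
  have := hN.measureReal_windowMap_of_ne hχ 0 h hne
  rw [zero_add] at this
  rw [windowKernel, this, mul_left_comm, inv_mul_cancel_left₀ hh0]

end Window

end CutPaste

namespace CutPaste

/-! ### Finite-dimensional laws of a driven process -/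

/-- The composition `U (L - 1) ∘ ⋯ ∘ U 0`. -/
def composeMaps {F : Type*} (U : ℕ → F → F) : ℕ → F → F
  | 0 => id
  | L + 1 => U L ∘ composeMaps U L

theorem composeMaps_congr {F : Type*} {U V : ℕ → F → F} {L : ℕ} (h : ∀ l < L, U l = V l) :
    composeMaps U L = composeMaps V L := by
  induction L with
  | zero => rfl
  | succ L ih =>
    rw [composeMaps, composeMaps, h L (Nat.lt_succ_self L), ih fun l hl => h l (hl.trans
      (Nat.lt_succ_self L))]

theorem gridMap_eq_composeMaps {k : ℕ} (n : ℕ) (A : Set (ℝ≥0 × CosetMap k)) (τ : ℕ → ℝ≥0) (L : ℕ) :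
    gridMap n A τ L = composeMaps (fun l => windowMap n A (τ l) (τ (l + 1))) L := by
  induction L with
  | zero => rfl
  | succ L ih => rw [gridMap, composeMaps, ih]

/-- Independent random maps generate a Markov chain: the state after `L` steps involves only earlier
maps, so it is independent of the next one. -/
theorem measureReal_composeMaps {F Ω : Type*} [Fintype F] [DecidableEq F] [MeasurableSpace F]
    [MeasurableSingletonClass F] [MeasurableSpace Ω] {P : Measure Ω} [IsProbabilityMeasure P]
    {U : ℕ → Ω → F → F} (hU : ∀ l, Measurable (U l)) (hind : iIndepFun U P) {r : F → F → ℝ}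
    (hr : ∀ l y y', P.real {ω | U l ω y = y'} = r y y') (L : ℕ) (y y' : F) :
    P.real {ω | composeMaps (fun l => U l ω) L y = y'} = kernelPow r L y y' := by
  have hm : ∀ L z, Measurable fun ω => composeMaps (fun l => U l ω) L z := by
    intro L z
    induction L with
    | zero => exact measurable_const
    | succ L ih =>
      have h1 : Measurable fun q : (F → F) × F => q.1 q.2 := measurable_of_countable _
      exact h1.comp ((hU L).prodMk ih)
  induction L generalizing y' with
  | zero =>
    change P.real {ω | y = y'} = if y = y' then 1 else 0
    split_ifs with h <;> simp [h]
  | succ L ih =>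
    -- The composition is written as a function of the first `L` maps alone, so that independence of
    -- disjoint index sets applies.
    let φ : (Finset.range L → F → F) → F → F := fun u =>
      composeMaps (fun l => if h : l ∈ Finset.range L then u ⟨l, h⟩ else id) L
    have hφ : ∀ ω, φ (fun l => U l ω) = composeMaps (fun l => U l ω) L := fun ω =>
      composeMaps_congr fun l hl => by rw [dif_pos (Finset.mem_range.2 hl)]
    have h1 : IndepFun (fun ω => composeMaps (fun l => U l ω) L) (U L) P := by
      have := (hind.indepFun_finset (Finset.range L) {L} (by simp) hU).comp
        (φ := φ) (ψ := fun u : (({L} : Finset ℕ) → F → F) => u ⟨L, Finset.mem_singleton_self L⟩)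
        (measurable_of_countable _) (measurable_of_countable _)
      convert! this using 1
      funext ω
      exact (hφ ω).symm
    have h2 : {ω | composeMaps (fun l => U l ω) (L + 1) y = y'} =
        ⋃ z ∈ (Finset.univ : Finset F),
          {ω | composeMaps (fun l => U l ω) L y = z} ∩ {ω | U L ω z = y'} := by
      ext ω
      simp [composeMaps]
    have hmU : ∀ z, Measurable fun ω => U L ω z := fun z => (measurable_pi_apply z).comp (hU L)
    rw [h2, measureReal_biUnion_finset]
    · refine Finset.sum_congr rfl fun z _ => ?_
      rw [← ih, ← hr L, measureReal_def, measureReal_def, measureReal_def, ← ENNReal.toReal_mul]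
      congr 1
      exact h1.measure_inter_preimage_eq_mul {f | f y = z} {f | f z = y'}
        (Set.toFinite _).measurableSet (Set.toFinite _).measurableSet
    · exact fun z _ z' _ hne => Set.disjoint_left.2 fun ω h h' => hne (h.1.symm.trans h'.1)
    · exact fun z _ => (hm L y (measurableSet_singleton z)).inter
        (hmU z (measurableSet_singleton y'))

section Grid

variable {k : ℕ} {χ : Measure (CosetMap k)} {ν : Measure (ℝ≥0 × CosetMap k)}
  {Ω : Type*} [MeasurableSpace Ω] {P : Measure Ω} [IsProbabilityMeasure P]
  {N : Ω → Set (ℝ≥0 × CosetMap k)}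

theorem measurable_windowMap_pointSigma {k : ℕ} {Ω : Type*} (N : Ω → Set (ℝ≥0 × CosetMap k)) (n : ℕ)
    (a b : ℝ≥0) : Measurable[pointSigma N] fun ω => windowMap n (N ω) a b := by
  refine measurable_stepMap.comp (@measurable_pi_lambda _ _ _ (pointSigma N) _ _ fun m => ?_)
  have h : MeasurableSpace.comap (fun ω => (N ω ∩ markWindow a b m).encard) inferInstance ≤
      pointSigma N := le_iSup₂_of_le _ (measurableSet_markWindow a b m) le_rfl
  exact measurable_iff_comap_le.2 h

theorem measurable_gridMap_pointSigma {k : ℕ} {Ω : Type*} (N : Ω → Set (ℝ≥0 × CosetMap k)) (n : ℕ)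
    (τ : ℕ → ℝ≥0) (L : ℕ) : Measurable[pointSigma N] fun ω => gridMap n (N ω) τ L := by
  induction L with
  | zero => exact @measurable_const _ _ _ (pointSigma N) _
  | succ L ih =>
    have h1 : Measurable fun q : (FinColoring k n → FinColoring k n) ×
      (FinColoring k n → FinColoring k n) => q.1 ∘ q.2 := measurable_of_countable _
    exact h1.comp ((measurable_windowMap_pointSigma N n _ _).prodMk ih)

theorem IsPoissonPointProcess.pointSigma_le {Ω : Type*} [m : MeasurableSpace Ω] {P : Measure Ω}
    {N : Ω → Set (ℝ≥0 × CosetMap k)} (hN : IsPoissonPointProcess P N ν) : pointSigma N ≤ m :=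
  iSup₂_le fun B hB => (hN.measurable B hB).comap_le

theorem IsPoissonPointProcess.iIndepFun_windowMap_succ (hN : IsPoissonPointProcess P N ν)
    (n : ℕ) {τ : ℕ → ℝ≥0} (hτ : Monotone τ) :
    iIndepFun (fun l ω => windowMap n (N ω) (τ l) (τ (l + 1))) P := by
  rw [iIndepFun_iff_finset]
  intro S
  exact hN.iIndepFun_windowMap n fun l l' hne =>
    hτ.pairwise_disjoint_on_Ioc_succ fun hc => hne (Subtype.ext hc)

theorem IsPoissonPointProcess.measureReal_gridMap [SFinite χ]
    (hN : IsPoissonPointProcess P N (lebesgue.prod χ)) (hχ : IsRegular χ) {n : ℕ} (t s : ℝ≥0)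
    (j L : ℕ) (y y' : FinColoring k n) :
    P.real {ω | gridMap n (N ω) (gridPoint t s j) L y = y'} =
      kernelPow (windowKernel P N n (s / (j + 1 : ℕ))) L y y' := by
  simp_rw [gridMap_eq_composeMaps]
  refine measureReal_composeMaps
    (U := fun l ω => windowMap n (N ω) (gridPoint t s j l) (gridPoint t s j (l + 1)))
    (fun l => hN.measurable_windowMap _ _ _) (hN.iIndepFun_windowMap_succ n (gridPoint_mono t s j))
    (fun l z z' => ?_) L y y'
  simp_rw [gridPoint_succ]
  exact hN.measureReal_windowMap hχ _ _ z z'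

/-- All cells of all intervals are pairwise disjoint, so their window maps are independent; they are
then grouped by interval. -/
theorem IsPoissonPointProcess.iIndepFun_gridMap (hN : IsPoissonPointProcess P N ν)
    (n : ℕ) {t : ℕ → ℝ≥0} (ht : Monotone t) (m j : ℕ) :
    iIndepFun (fun (i : Fin m) ω =>
      gridMap n (N ω) (gridPoint (t i) (t (i + 1) - t i) j) (j + 1)) P := by
  let τ : ℕ → ℕ → ℝ≥0 := fun i => gridPoint (t i) (t (i + 1) - t i) j
  have hsub : ∀ i : ℕ, ∀ l < j + 1, Set.Ioc (τ i l) (τ i (l + 1)) ⊆ Set.Ioc (t i) (t (i + 1)) := by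
    intro i l hl
    refine Set.Ioc_subset_Ioc ?_ ?_
    · exact le_self_add
    · calc τ i (l + 1) ≤ τ i (j + 1) := gridPoint_mono _ _ _ hl
        _ = t (i + 1) := by
          rw [show τ i (j + 1) = t i + (t (i + 1) - t i) from gridPoint_last _ _ _, add_tsub_cancel_of_le (ht (Nat.le_succ i))]
  have h1 : iIndepFun (fun (a : Fin m × Fin (j + 1)) ω =>
      windowMap n (N ω) (τ a.1 a.2) (τ a.1 (a.2 + 1))) P := by
    refine hN.iIndepFun_windowMap n fun a a' hne => ?_
    by_cases hi : a.1 = a'.1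
    · have hl : (a.2 : ℕ) ≠ a'.2 := fun hl => hne (Prod.ext hi (Fin.ext hl))
      beta_reduce
      rw [hi]
      exact (gridPoint_mono _ _ j).pairwise_disjoint_on_Ioc_succ hl
    · have hi' : (a.1 : ℕ) ≠ a'.1 := fun hc => hi (Fin.ext hc)
      exact (ht.pairwise_disjoint_on_Ioc_succ hi').mono (hsub _ _ a.2.2) (hsub _ _ a'.2.2)
  have h2 := (iIndepFun_curry (X := fun (i : Fin m) (l : Fin (j + 1)) ω =>
    windowMap n (N ω) (τ i l) (τ i (l + 1))) (fun _ _ => hN.measurable_windowMap _ _ _) h1).comp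
    (fun _ u => composeMaps (fun l => if h : l < j + 1 then u ⟨l, h⟩ else id) (j + 1))
    fun _ => measurable_of_countable _
  convert! h2 using 1
  funext i ω
  rw [gridMap_eq_composeMaps]
  exact composeMaps_congr fun l hl => by rw [dif_pos hl]

/-- A cell carries two or more atoms with probability at most the square of its mean; summing over
`j + 1` cells of length `s / (j + 1)` leaves one factor `1 / (j + 1)`. -/
theorem IsPoissonPointProcess.measureReal_exists_one_lt_encard_le [SFinite χ]
    (hN : IsPoissonPointProcess P N (lebesgue.prod χ)) (hχ : IsRegular χ) (n : ℕ) (t s : ℝ≥0)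
    (j : ℕ) :
    P.real {ω | ∃ l < j + 1,
      1 < (N ω ∩ window k n (gridPoint t s j l) (gridPoint t s j (l + 1))).encard} ≤
    (s * χ.real (cosetCylinder n {finIdMap k n}ᶜ)) ^ 2 / (j + 1) := by
  have h : {ω | ∃ l < j + 1,
      1 < (N ω ∩ window k n (gridPoint t s j l) (gridPoint t s j (l + 1))).encard} =
      ⋃ l ∈ Finset.range (j + 1),
        {ω | 1 < (N ω ∩ window k n (gridPoint t s j l) (gridPoint t s j (l + 1))).encard} := by
    ext ω
    simp
  rw [h]
  refine (measureReal_biUnion_finset_le _ _).trans ?_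
  have h1 : ∀ l ∈ Finset.range (j + 1),
      P.real {ω | 1 < (N ω ∩ window k n (gridPoint t s j l) (gridPoint t s j (l + 1))).encard} ≤
        ((s / (j + 1)) * χ.real (cosetCylinder n {finIdMap k n}ᶜ)) ^ 2 := by
    intro l _
    have hν := prod_window (χ := χ) (n := n) (gridPoint t s j l) (s / (j + 1 : ℕ))
    rw [← gridPoint_succ] at hν
    refine (hN.measureReal_one_lt_encard_le (measurableSet_window _ _) ?_).trans (le_of_eq ?_)
    · rw [hν]
      exact ENNReal.mul_ne_top ENNReal.coe_ne_top (hχ.cosetCylinder_ne_top (by simp))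
    · rw [hν, ENNReal.toReal_mul, ENNReal.coe_toReal, measureReal_def]
      push_cast
      rfl
  refine (Finset.sum_le_sum h1).trans (le_of_eq ?_)
  rw [Finset.sum_const, Finset.card_range, nsmul_eq_mul]
  push_cast
  field_simp

theorem exists_lt_le_succ {τ : ℕ → ℝ≥0} {t : ℝ≥0} {L : ℕ} (h0 : τ 0 < t) (hL : t ≤ τ L) :
    ∃ l < L, τ l < t ∧ t ≤ τ (l + 1) := by
  induction L with
  | zero => exact absurd h0 (not_lt.2 hL)
  | succ L ih =>
    by_cases h : t ≤ τ L
    · obtain ⟨l, hl, hl'⟩ := ih h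
      exact ⟨l, hl.trans (Nat.lt_succ_self L), hl'⟩
    · exact ⟨L, Nat.lt_succ_self L, not_le.1 h, hL⟩

/-- Two atoms with equal times share a cell of every grid. Almost surely some grid has at most one
atom per cell, because the probability that grid `j` fails tends to zero. Integer horizons suffice
by monotonicity. -/
theorem IsPoissonPointProcess.ae_isSimple [SFinite χ]
    (hN : IsPoissonPointProcess P N (lebesgue.prod χ)) (hχ : IsRegular χ) :
    ∀ᵐ ω ∂P, IsSimple (N ω) := by
  have hfin : ∀ᵐ ω ∂P, ∀ n T : ℕ, (N ω ∩ window k n 0 T).encard ≠ ⊤ := by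
    refine ae_all_iff.2 fun n => ae_all_iff.2 fun T =>
      hN.ae_encard_ne_top (measurableSet_window _ _) ?_
    have := prod_window (χ := χ) (n := n) 0 T
    rw [zero_add] at this
    rw [this]
    exact ENNReal.mul_ne_top ENNReal.coe_ne_top (hχ.cosetCylinder_ne_top (by simp))
  have hgrid : ∀ᵐ ω ∂P, ∀ n T : ℕ, ∃ j : ℕ, ∀ l < j + 1,
      (N ω ∩ window k n (gridPoint 0 T j l) (gridPoint 0 T j (l + 1))).encard ≤ 1 := by
    refine ae_all_iff.2 fun n => ae_all_iff.2 fun T => ?_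
    rw [ae_iff, ← measureReal_eq_zero_iff]
    refine le_antisymm ?_ measureReal_nonneg
    refine ge_of_tendsto' (tendsto_const_div_atTop_nhds_zero_nat
      ((((T : ℝ≥0) : ℝ) * χ.real (cosetCylinder n {finIdMap k n}ᶜ)) ^ 2)
        |>.comp (tendsto_add_atTop_nat 1)) fun j => ?_
    have := hN.measureReal_exists_one_lt_encard_le hχ n 0 T j
    refine (measureReal_mono ?_).trans (this.trans (le_of_eq ?_))
    · intro ω hω
      simp only [Set.mem_ofPred_eq] at hω ⊢
      push Not at hω
      exact hω j
    · simp
  filter_upwards [hfin, hgrid] with ω h1 h2 n T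
  obtain ⟨T', hT'⟩ := exists_nat_ge T
  have hsub : N ω ∩ window k n 0 T ⊆ N ω ∩ window k n 0 T' :=
    Set.inter_subset_inter_right _ (Set.prod_mono (Set.Ioc_subset_Ioc_right hT') subset_rfl)
  refine ⟨(Set.encard_ne_top_iff.1 (h1 n T')).subset hsub, fun e he e' he' hee => ?_⟩
  obtain ⟨j, hj⟩ := h2 n T'
  have hlast : gridPoint 0 T' j (j + 1) = T' := by rw [gridPoint_last, zero_add]
  obtain ⟨l, hl, hl1, hl2⟩ := exists_lt_le_succ (τ := gridPoint 0 T' j) (t := e.1) (L := j + 1)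
    (by rw [gridPoint_zero]; exact he.2.1.1) (by rw [hlast]; exact he.2.1.2.trans hT')
  exact Set.encard_le_one_iff.1 (hj l hl) e e' ⟨he.1, ⟨hl1, hl2⟩, he.2.2⟩
    ⟨he'.1, ⟨hee ▸ hl1, hee ▸ hl2⟩, he'.2.2⟩

end Grid

end CutPaste

namespace CutPaste

/-! ### Limit of the grid approximations of the driven process. -/

section FinDim

variable {k n : ℕ} {χ : Measure (CosetMap k)} [SFinite χ] {μ : Measure (Coloring k)}
  {Ω : Type*} [MeasurableSpace Ω] {P : Measure Ω} [IsProbabilityMeasure P]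
  {N : Ω → Set (ℝ≥0 × CosetMap k)} {Y : ℝ≥0 → Ω → Coloring k}
  {p : ℝ≥0 → FinColoring k n → FinColoring k n → ℝ}

theorem IsPoissonConstruction.measureReal_init_inter_gridMap
    (hY : IsPoissonConstruction P χ μ N Y) (hχ : IsRegular χ) {t : ℕ → ℝ≥0} (ht : Monotone t)
    (m j : ℕ) (y : ℕ → FinColoring k n) :
    P.real ({ω | restrict n (Y 0 ω) = y 0} ∩ ⋂ i ∈ (Finset.univ : Finset (Fin m)),
      {ω | gridMap n (N ω) (gridPoint (t i) (t (i + 1) - t i) j) (j + 1) (y i) = y (i + 1)}) =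
    μ.real {x | restrict n x = y 0} * ∏ i ∈ Finset.range m,
      kernelPow (windowKernel P N n ((t (i + 1) - t i) / (j + 1 : ℕ))) (j + 1) (y i)
        (y (i + 1)) := by
  have hcyl : MeasurableSet {x : Coloring k | restrict n x = y 0} :=
    measurable_restrict_coloring n (measurableSet_singleton _)
  have hset : ∀ i : ℕ, MeasurableSet {f : FinColoring k n → FinColoring k n | f (y i) = y (i + 1)} :=
    fun i => (Set.toFinite _).measurableSet
  have hinit : MeasurableSet[MeasurableSpace.comap (Y 0) inferInstance]
      {ω | restrict n (Y 0 ω) = y 0} := ⟨_, hcyl, rfl⟩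
  have hpast : MeasurableSet[pointSigma N] (⋂ i ∈ (Finset.univ : Finset (Fin m)),
      {ω | gridMap n (N ω) (gridPoint (t i) (t (i + 1) - t i) j) (j + 1) (y i) = y (i + 1)}) :=
    @Finset.measurableSet_biInter _ _ (pointSigma N) _ _ fun i _ =>
      measurable_gridMap_pointSigma N n _ _ (hset i)
  have h1 := (Indep_iff _ _ _).1 hY.indep _ _ hpast hinit
  have h2 := (hY.poisson.iIndepFun_gridMap n ht m j).measure_inter_preimage_eq_mul Finset.univ
    (sets := fun i => {f | f (y i) = y (i + 1)}) fun i _ => hset i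
  rw [Set.inter_comm, measureReal_def, h1, ENNReal.toReal_mul, mul_comm]
  congr 1
  · rw [← hY.init, map_measureReal_apply (hY.measurable 0) hcyl]
    rfl
  · refine (congrArg ENNReal.toReal h2).trans ?_
    rw [ENNReal.toReal_prod, ← Fin.prod_univ_eq_prod_range (fun i : ℕ =>
      kernelPow (windowKernel P N n ((t (i + 1) - t i) / (j + 1 : ℕ))) (j + 1) (y i)
        (y (i + 1)))]
    refine Finset.prod_congr rfl fun i _ => ?_
    exact hY.poisson.measureReal_gridMap hχ (t i) (t (i + 1) - t i) j (j + 1) (y i) (y (i + 1))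

/-- The event `E` for the path is compared with the event `G j` for the grid maps, whose probability
is a product of powers of `windowKernel` and converges to the right side. The two differ only if
some cell holds two atoms, with probability tending to zero. -/
theorem IsPoissonConstruction.measureReal_finDim
    (hY : IsPoissonConstruction P χ μ N Y) (hχ : IsRegular χ) (hp : IsTransitionSemigroup p)
    (hrate : ∀ x y, x ≠ y → Tendsto (fun t : ℝ≥0 => (t : ℝ)⁻¹ * p t x y) (𝓝[>] 0)
      (𝓝 (χ.real {M | (M.restrict n).act x = y})))
    {t : ℕ → ℝ≥0} (ht : Monotone t) (ht0 : t 0 = 0) (m : ℕ) (y : ℕ → FinColoring k n) :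
    P.real {ω | ∀ i < m + 1, restrict n (Y (t i) ω) = y i} =
      μ.real {x | restrict n x = y 0} *
        ∏ i ∈ Finset.range m, p (t (i + 1) - t i) (y i) (y (i + 1)) := by
  set E : Set Ω := {ω | ∀ i < m + 1, restrict n (Y (t i) ω) = y i} with hE
  set G : ℕ → Set Ω := fun j => {ω | restrict n (Y 0 ω) = y 0} ∩
    ⋂ i ∈ (Finset.univ : Finset (Fin m)),
      {ω | gridMap n (N ω) (gridPoint (t i) (t (i + 1) - t i) j) (j + 1) (y i) = y (i + 1)} with hG
  set B : ℕ → ℕ → Set Ω := fun j i => {ω | ∃ l < j + 1,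
    1 < (N ω ∩ window k n (gridPoint (t i) (t (i + 1) - t i) j l)
      (gridPoint (t i) (t (i + 1) - t i) j (l + 1))).encard} with hB
  have hYm : ∀ s, Measurable fun ω => restrict n (Y s ω) := fun s =>
    (measurable_restrict_coloring n).comp (hY.measurable s)
  have hEm : MeasurableSet E := by
    have : E = ⋂ i ∈ Finset.range (m + 1), {ω | restrict n (Y (t i) ω) = y i} := by
      ext ω; simp [hE]
    rw [this]
    exact Finset.measurableSet_biInter _ fun i _ => hYm _ (measurableSet_singleton _)
  have hGm : ∀ j, MeasurableSet (G j) := by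
    intro j
    refine (hYm 0 (measurableSet_singleton (y 0))).inter
      (Finset.measurableSet_biInter _ fun i _ => ?_)
    exact (measurable_gridMap_pointSigma N n _ _).mono hY.poisson.pointSigma_le le_rfl
      (Set.toFinite {f : FinColoring k n → FinColoring k n | f (y i) = y (i + 1)}).measurableSet
  have hlimG : Tendsto (fun j => P.real (G j)) atTop (𝓝 (μ.real {x | restrict n x = y 0} *
      ∏ i ∈ Finset.range m, p (t (i + 1) - t i) (y i) (y (i + 1)))) := by
    simp_rw [hG, hY.measureReal_init_inter_gridMap hχ ht]
    refine tendsto_const_nhds.mul (tendsto_finsetProd _ fun i _ => ?_)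
    exact hp.tendsto_kernelPow hrate (fun h => hY.poisson.isStochastic_windowKernel n h)
      windowKernel_zero (fun _ _ hne => hY.poisson.tendsto_windowKernel hχ hne) _ _ _
  have hlimB : Tendsto (fun j => ∑ i ∈ Finset.range m, P.real (B j i)) atTop (𝓝 0) := by
    rw [← Finset.sum_const_zero (s := Finset.range m)]
    refine tendsto_finsetSum _ fun i _ => ?_
    refine squeeze_zero (fun _ => measureReal_nonneg)
      (fun j => hY.poisson.measureReal_exists_one_lt_encard_le hχ n _ _ j) ?_
    have := (tendsto_const_div_atTop_nhds_zero_nat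
      (((t (i + 1) - t i : ℝ≥0) * χ.real (cosetCylinder n {finIdMap k n}ᶜ)) ^ 2)).comp
      (tendsto_add_atTop_nat 1)
    refine this.congr fun j => ?_
    simp
  -- Outside the exceptional events, `eq_gridMap` says that the grid maps carry the path from each
  -- time to the next.
  have hae : ∀ j, ∀ᵐ ω ∂P, ω ∈ symmDiff E (G j) → ω ∈ ⋃ i ∈ Finset.range m, B j i := by
    intro j
    filter_upwards [hY.driven] with ω hω hsd
    by_contra hnot
    have hle : ∀ i < m, ∀ l < j + 1, (N ω ∩ window k n (gridPoint (t i) (t (i + 1) - t i) j l)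
        (gridPoint (t i) (t (i + 1) - t i) j (l + 1))).encard ≤ 1 := by
      intro i hi l hl
      by_contra hc
      exact hnot (Set.mem_iUnion₂.2 ⟨i, Finset.mem_range.2 hi, l, hl, not_le.1 hc⟩)
    have hgrid : ∀ i < m, restrict n (Y (t (i + 1)) ω) =
        gridMap n (N ω) (gridPoint (t i) (t (i + 1) - t i) j) (j + 1)
          (restrict n (Y (t i) ω)) := by
      intro i hi
      have h := (hω n).eq_gridMap (gridPoint_mono (t i) (t (i + 1) - t i) j) (hle i hi)
      rw [gridPoint_zero, gridPoint_last, add_tsub_cancel_of_le (ht (Nat.le_succ i))] at h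
      exact h
    have hiff : ω ∈ E ↔ ω ∈ G j := by
      constructor
      · intro h
        refine ⟨?_, Set.mem_iInter₂.2 fun i _ => ?_⟩
        · have := h 0 (Nat.succ_pos m)
          rwa [ht0] at this
        · have h1 := hgrid i i.2
          rw [h i (i.2.trans (Nat.lt_succ_self m)), h (i + 1) (Nat.succ_lt_succ i.2)] at h1
          exact h1.symm
      · rintro ⟨h0, h⟩ i hi
        induction i with
        | zero => rw [ht0]; exact h0
        | succ i ih =>
          have him : i < m := Nat.lt_of_succ_lt_succ hi
          rw [hgrid i him, ih (him.trans (Nat.lt_succ_self m))]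
          exact Set.mem_iInter₂.1 h ⟨i, him⟩ (Finset.mem_univ _)
    rcases hsd with ⟨h1, h2⟩ | ⟨h1, h2⟩
    · exact h2 (hiff.1 h1)
    · exact h2 (hiff.2 h1)
  have hbound : ∀ j, |P.real E - P.real (G j)| ≤ ∑ i ∈ Finset.range m, P.real (B j i) := by
    intro j
    refine (abs_measureReal_sub_le_measureReal_symmDiff hEm.nullMeasurableSet
      (hGm j).nullMeasurableSet).trans (le_trans ?_ (measureReal_biUnion_finset_le _ _))
    exact ENNReal.toReal_mono (measure_ne_top _ _) (measure_mono_ae (hae j))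
  have hlim0 : Tendsto (fun j => P.real E - P.real (G j)) atTop (𝓝 0) :=
    squeeze_zero_norm hbound hlimB
  have := hlim0.add hlimG
  simp only [sub_add_cancel, zero_add] at this
  exact tendsto_nhds_unique tendsto_const_nhds this

end FinDim

/-! ### Finite-dimensional laws of `X`, and uniqueness of laws on path space. -/

section FinDimPath

variable {k n : ℕ} {Ω : Type*} [MeasurableSpace Ω] {Pr : Kernel (Coloring k) Ω}
  {X : ℝ≥0 → Ω → Coloring k} {p : ℝ≥0 → FinColoring k n → FinColoring k n → ℝ}

theorem IsTransitionOf.measureReal_finDim (hX : IsMarkovProcess Pr X)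
    (hp : IsTransitionOf Pr X n p) (x : Coloring k) {t : ℕ → ℝ≥0} (ht : Monotone t)
    (ht0 : t 0 = 0) (m : ℕ) (y : ℕ → FinColoring k n) :
    (Pr x).real {ω | ∀ i < m + 1, restrict n (X (t i) ω) = y i} =
      {x | restrict n x = y 0}.indicator
        (fun _ => ∏ i ∈ Finset.range m, p (t (i + 1) - t i) (y i) (y (i + 1))) x := by
  have := hX.prob x
  induction m with
  | zero =>
    have h1 : {ω | ∀ i < 0 + 1, restrict n (X (t i) ω) = y i} =ᵐ[Pr x]
        {_ω | restrict n x = y 0} := by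
      refine eventuallyEq_set.2 ?_
      filter_upwards [hX.init x] with ω hω
      simp [ht0, hω]
    rw [measureReal_congr h1]
    by_cases h : restrict n x = y 0 <;> simp [h]
  | succ m ih =>
    have h1 : {ω | ∀ i < m + 1 + 1, restrict n (X (t i) ω) = y i} =
        ({ω | ∀ i < m + 1, restrict n (X (t i) ω) = y i} ∩ {ω | restrict n (X (t m) ω) = y m}) ∩
          {ω | restrict n (X (t m + (t (m + 1) - t m)) ω) = y (m + 1)} := by
      rw [add_tsub_cancel_of_le (ht (Nat.le_succ m))]
      ext ω
      constructor
      · intro h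
        exact ⟨⟨fun i hi => h i (by omega), h m (by omega)⟩, h (m + 1) (by omega)⟩
      · rintro ⟨⟨h, -⟩, h'⟩ i hi
        rcases Nat.lt_succ_iff_lt_or_eq.1 hi with hi | rfl
        · exact h i hi
        · exact h'
    have h2 : {ω | ∀ i < m + 1, restrict n (X (t i) ω) = y i} ∩
        {ω | restrict n (X (t m) ω) = y m} =
        {ω | ∀ i < m + 1, restrict n (X (t i) ω) = y i} :=
      Set.inter_eq_left.2 fun ω h => h m (Nat.lt_succ_self m)
    have hS : MeasurableSet[pastSigma (fun u ω => restrict n (X u ω)) (t m)]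
        {ω | ∀ i < m + 1, restrict n (X (t i) ω) = y i} := by
      have : {ω | ∀ i < m + 1, restrict n (X (t i) ω) = y i} =
          ⋂ i ∈ Finset.range (m + 1), {ω | restrict n (X (t i) ω) = y i} := by
        ext ω; simp
      rw [this]
      refine @Finset.measurableSet_biInter _ _ (pastSigma (fun u ω => restrict n (X u ω)) (t m))
        _ _ fun i hi => ?_
      exact measurable_pastSigma (Y := fun u ω => restrict n (X u ω))
        (ht (Nat.lt_succ_iff.1 (Finset.mem_range.1 hi))) (measurableSet_singleton (y i))
    rw [h1, hp.real_inter hX x _ _ _ _ hS, h2, ih]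
    by_cases h : restrict n x = y 0 <;> simp [h, Finset.prod_range_succ]

theorem isProbabilityMeasure_pathLaw (hX : IsMarkovProcess Pr X) (μ : Measure (Coloring k))
    [IsProbabilityMeasure μ] : IsProbabilityMeasure (pathLaw Pr X μ) := by
  have := hX.prob
  refine ⟨?_⟩
  rw [pathLaw_apply hX μ MeasurableSet.univ]
  simp

theorem measurableSet_finDim {t : ℕ → ℝ≥0} (m : ℕ) (y : ℕ → FinColoring k n) :
    MeasurableSet {w : ℝ≥0 → Coloring k | ∀ i < m, restrict n (w (t i)) = y i} := by
  have : {w : ℝ≥0 → Coloring k | ∀ i < m, restrict n (w (t i)) = y i} =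
      ⋂ i ∈ Finset.range m, {w | restrict n (w (t i)) = y i} := by
    ext w; simp
  rw [this]
  exact Finset.measurableSet_biInter _ fun i _ =>
    ((measurable_restrict_coloring n).comp (measurable_pi_apply (t i))) (measurableSet_singleton _)

theorem IsTransitionOf.pathLaw_finDim (hX : IsMarkovProcess Pr X)
    (hp : IsTransitionOf Pr X n p) (μ : Measure (Coloring k)) [IsProbabilityMeasure μ]
    {t : ℕ → ℝ≥0} (ht : Monotone t)
    (ht0 : t 0 = 0) (m : ℕ) (y : ℕ → FinColoring k n) :
    (pathLaw Pr X μ).real {w | ∀ i < m + 1, restrict n (w (t i)) = y i} =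
      μ.real {x | restrict n x = y 0} *
        ∏ i ∈ Finset.range m, p (t (i + 1) - t i) (y i) (y (i + 1)) := by
  have := hX.prob
  have hcyl : MeasurableSet {x : Coloring k | restrict n x = y 0} :=
    measurable_restrict_coloring n (measurableSet_singleton _)
  have hm : Measurable fun ω t => X t ω := measurable_pi_lambda _ hX.measurable
  have hSm : MeasurableSet {ω | ∀ i < m + 1, restrict n (X (t i) ω) = y i} :=
    hm (measurableSet_finDim (m + 1) y)
  rw [measureReal_def, pathLaw_apply hX μ (measurableSet_finDim (m + 1) y)]
  have h1 : ∀ x, Pr x {ω | (fun t => X t ω) ∈ {w | ∀ i < m + 1, restrict n (w (t i)) = y i}} =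
      ENNReal.ofReal ((Pr x).real {ω | ∀ i < m + 1, restrict n (X (t i) ω) = y i}) :=
    fun x => (ofReal_measureReal).symm
  simp_rw [h1]
  rw [← integral_eq_lintegral_of_nonneg_ae (ae_of_all _ fun _ => measureReal_nonneg)]
  · simp_rw [hp.measureReal_finDim hX _ ht ht0]
    rw [integral_indicator hcyl, setIntegral_const, smul_eq_mul]
  · exact (Kernel.measurable_coe Pr hSm).ennreal_toReal.aestronglyMeasurable

/-- A law on path space is determined by the finite-dimensional laws of its restrictions, along
times that start at `0`. -/
theorem pathMeasure_ext {μ ν : Measure (ℝ≥0 → Coloring k)} [IsFiniteMeasure μ] [IsFiniteMeasure ν]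
    (h : ∀ n m (t : ℕ → ℝ≥0), Monotone t → t 0 = 0 → ∀ y : ℕ → FinColoring k n,
      μ.real {w | ∀ i < m + 1, restrict n (w (t i)) = y i} =
        ν.real {w | ∀ i < m + 1, restrict n (w (t i)) = y i}) : μ = ν := by
  classical
  -- Path space is viewed as one product indexed by pairs of a time and a site, where finite
  -- marginals determine a measure.
  let e := (MeasurableEquiv.curry ℝ≥0 ℕ (Fin k)).symm
  refine e.map_measurableEquiv_injective ?_
  refine IsProjectiveLimit.unique (P := fun I => ((ν.map e).map I.restrict)) (fun I => ?_)
    fun I => rfl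
  -- The pairs in `I` are enlarged to a rectangle: all their times, with `0` added, and all sites
  -- below `n`.
  set J : Finset ℝ≥0 := insert 0 (I.image Prod.fst) with hJ
  set n := I.sup Prod.snd + 1 with hn
  let φ : (J → FinColoring k n) → (I → Fin k) := fun u a =>
    u ⟨a.1.1, Finset.mem_insert_of_mem (Finset.mem_image_of_mem _ a.2)⟩
      ⟨a.1.2, Nat.lt_succ_of_le (Finset.le_sup (f := Prod.snd) a.2)⟩
  let ψ : (ℝ≥0 → Coloring k) → (J → FinColoring k n) := fun w s => restrict n (w s)
  have hψ : Measurable ψ := measurable_pi_lambda _ fun s =>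
    (measurable_restrict_coloring n).comp (measurable_pi_apply _)
  have hφ : Measurable φ := measurable_of_countable _
  have hcomp : I.restrict ∘ e = φ ∘ ψ := rfl
  have hr : Measurable (I.restrict (π := fun _ : ℝ≥0 × ℕ => Fin k)) :=
    measurable_pi_lambda _ fun _ => measurable_pi_apply _
  change _ = (ν.map e).map I.restrict
  rw [Measure.map_map hr e.measurable, Measure.map_map hr e.measurable, hcomp,
    ← Measure.map_map hφ hψ, ← Measure.map_map hφ hψ]
  congr 1
  refine Measure.ext_of_singleton fun z => ?_
  rw [Measure.map_apply hψ (measurableSet_singleton z),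
    Measure.map_apply hψ (measurableSet_singleton z), ← measureReal_eq_measureReal_iff]
  have hcard : 0 < J.card := Finset.card_pos.2 ⟨0, Finset.mem_insert_self _ _⟩
  -- The increasing enumeration of `J` is continued as a constant beyond its last element, to obtain
  -- a monotone sequence on `ℕ`.
  let g : ℕ → Fin J.card := fun i => ⟨min i (J.card - 1), by omega⟩
  have hg : Monotone g := fun i i' hii => Fin.mk_le_mk.2 (min_le_min_right _ hii)
  let τ : ℕ → J := fun i => J.orderIsoOfFin rfl (g i)
  have hτ : Monotone fun i => (τ i : ℝ≥0) := fun i i' hii =>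
    (J.orderIsoOfFin rfl).monotone (hg hii)
  have hsurj : ∀ s : J, ∃ i < J.card - 1 + 1, τ i = s := by
    intro s
    refine ⟨(J.orderIsoOfFin rfl).symm s, by have := ((J.orderIsoOfFin rfl).symm s).2; omega, ?_⟩
    have hgi : g ((J.orderIsoOfFin rfl).symm s) = (J.orderIsoOfFin rfl).symm s := by
      apply Fin.ext
      have := ((J.orderIsoOfFin rfl).symm s).2
      simp only [g]
      omega
    simp only [τ, hgi, OrderIso.apply_symm_apply]
  have hτ0 : (τ 0 : ℝ≥0) = 0 := by
    obtain ⟨i, -, hi⟩ := hsurj ⟨0, Finset.mem_insert_self _ _⟩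
    have := hτ (Nat.zero_le i)
    simp only [hi] at this
    exact le_antisymm this zero_le
  have hset : ψ ⁻¹' {z} =
      {w | ∀ i < J.card - 1 + 1, restrict n (w (τ i)) = z (τ i)} := by
    ext w
    constructor
    · intro hw i _
      exact congrFun hw (τ i)
    · intro hw
      refine funext fun s => ?_
      obtain ⟨i, hi, rfl⟩ := hsurj s
      exact hw i hi
  rw [hset]
  exact h n (J.card - 1) (fun i => τ i) hτ hτ0 fun i => z (τ i)

end FinDimPath

end CutPaste

namespace CutPaste

/-! ### Existence of the driven process -/

theorem IsPoissonPointProcess.comp_measurePreserving {Ω Ω' E : Type*} [MeasurableSpace Ω]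
    [MeasurableSpace Ω'] [MeasurableSpace E] {P : Measure Ω} {Q : Measure Ω'} {N : Ω → Set E}
    {ν : Measure E} (hN : IsPoissonPointProcess P N ν) {g : Ω' → Ω} (hg : MeasurePreserving g Q P) :
    IsPoissonPointProcess Q (fun ω => N (g ω)) ν where
  countable ω := hN.countable (g ω)
  measurable B hB := (hN.measurable B hB).comp hg.measurable
  poisson B hB hν := by
    rw [← hN.poisson B hB hν, ← hg.map_eq, Measure.map_map (hN.measurable B hB) hg.measurable]
    rfl
  infinite B hB hν := hg.quasiMeasurePreserving.ae (hN.infinite B hB hν)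
  indep m B hB hd :=
    iIndepFun_comp_measurePreserving (hN.indep m B hB hd) (fun i => hN.measurable _ (hB i)) hg

section Limit

variable {k n : ℕ} {A : Set (ℝ≥0 × CosetMap k)}

/-- The state at time `t` of the path driven by `A` that starts at `x`. -/
noncomputable def drivenState (A : Set (ℝ≥0 × CosetMap k)) (x : Coloring k) (t : ℝ≥0) :
    Coloring k := fun i =>
  haveI : Nonempty (Fin k) := ⟨x 0⟩
  limUnder atTop fun j : ℕ =>
    gridMap (i + 1) A (gridPoint 0 t j) (j + 1) (restrict (i + 1) x) (Fin.last i)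

theorem gridMap_of_forall_eq {τ : ℕ → ℝ≥0} (h : ∀ l, τ l = 0) (L : ℕ) : gridMap n A τ L = id := by
  induction L with
  | zero => rfl
  | succ L ih =>
    rw [gridMap, ih, h, h, windowMap_eq_id (by simp [window])]
    rfl

theorem drivenState_zero (x : Coloring k) : drivenState A x 0 = x := by
  funext i
  refine Tendsto.limUnder_eq (tendsto_const_nhds.congr fun j => ?_)
  rw [gridMap_of_forall_eq fun l => by simp [gridPoint]]
  rfl

/-- For simple `A` the grid compositions are eventually constant in `j` and equal to the path driven
on `[n]`. Coordinate `i` uses only `[i + 1]`, so all `n` are served by one process; the limit form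
makes it measurable. -/
theorem IsSimple.isDriven_drivenState (hA : IsSimple A) (x : Coloring k) (n : ℕ) :
    IsDriven n A fun t => restrict n (drivenState A x t) := by
  obtain ⟨y, hy0, hy⟩ := hA.exists_isDriven n (restrict n x)
  convert! hy using 1
  funext t i
  have hi : (i : ℕ) + 1 ≤ n := i.2
  have hy' := hy.truncate hi
  refine Tendsto.limUnder_eq (tendsto_const_nhds.congr' ?_)
  filter_upwards [hA.eventually_encard_le_one (i + 1) 0 t] with j hj
  have h := hy'.eq_gridMap (gridPoint_mono 0 t j) hj
  rw [gridPoint_zero, gridPoint_last, zero_add] at h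
  have h0 : (fun l => y 0 (Fin.castLE hi l)) = restrict (i + 1) x := by
    rw [hy0]; rfl
  have := congrFun h (Fin.last i)
  rw [h0] at this
  exact this

end Limit

theorem measurable_drivenState {k : ℕ} {Ω : Type*} [MeasurableSpace Ω] {P : Measure Ω}
    {N : Ω → Set (ℝ≥0 × CosetMap k)} {ν : Measure (ℝ≥0 × CosetMap k)}
    (hN : IsPoissonPointProcess P N ν) {f : Ω → Coloring k} (hf : Measurable f) (t : ℝ≥0) :
    Measurable fun ω => drivenState (N ω) (f ω) t := by
  refine measurable_pi_lambda _ fun i => ?_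
  rcases isEmpty_or_nonempty (Fin k) with hk | hk
  · exact measurable_of_subsingleton_codomain _
  refine (StronglyMeasurable.limUnder (hE := hk) fun j => ?_).measurable
  refine Measurable.stronglyMeasurable ?_
  have h1 : Measurable fun q : (FinColoring k (i + 1) → FinColoring k (i + 1)) ×
    FinColoring k (i + 1) => q.1 q.2 (Fin.last i) := measurable_of_countable _
  exact h1.comp (((measurable_gridMap_pointSigma N (i + 1) (gridPoint 0 t j) (j + 1)).mono hN.pointSigma_le le_rfl).prodMk
    ((measurable_restrict_coloring _).comp hf))

theorem exists_isPoissonConstruction {k : ℕ} (χ : Measure (CosetMap k)) [SFinite χ]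
    (hχ : IsRegular χ) (μ : Measure (Coloring k)) [IsProbabilityMeasure μ] :
    ∃ (Ω' : Type) (_ : MeasurableSpace Ω') (P : Measure Ω')
      (N : Ω' → Set (ℝ≥0 × CosetMap k)) (Y : ℝ≥0 → Ω' → Coloring k),
      IsProbabilityMeasure P ∧ IsPoissonConstruction P χ μ N Y := by
  have : Nonempty (CosetMap k) := ⟨idMap k⟩
  -- The intensity has no atoms because Lebesgue measure has none, whatever the atoms of `χ`.
  obtain ⟨Ω, mΩ, P, N, hP, hN⟩ := exists_isPoissonPointProcess (lebesgue.prod χ) (by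
    rintro ⟨t, M⟩
    rw [← Set.singleton_prod_singleton, Measure.prod_prod, lebesgue_singleton, zero_mul])
  have hN' := hN.comp_measurePreserving (measurePreserving_snd (μ := μ) (ν := P))
  refine ⟨Coloring k × Ω, inferInstance, μ.prod P, fun z => N z.2,
    fun t z => drivenState (N z.2) z.1 t, inferInstance, hN',
    fun t => measurable_drivenState hN' measurable_fst t, ?_, ?_, ?_⟩
  · simp_rw [drivenState_zero]
    exact measurePreserving_fst.map_eq
  · simp_rw [drivenState_zero]
    have h1 : IndepFun (fun z : Coloring k × Ω => z.2) (fun z => z.1) (μ.prod P) :=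
      (indepFun_prod (X := id) (Y := id) measurable_id measurable_id).symm
    refine indep_of_indep_of_le_left ((IndepFun_iff_Indep _ _ _).1 h1) ?_
    refine iSup₂_le fun B hB => ?_
    have := (hN.measurable B hB).comap_le
    calc MeasurableSpace.comap (fun z : Coloring k × Ω => (N z.2 ∩ B).encard) inferInstance
        = MeasurableSpace.comap Prod.snd
            (MeasurableSpace.comap (fun ω => (N ω ∩ B).encard) inferInstance) := by
          rw [MeasurableSpace.comap_comp]; rfl
      _ ≤ _ := MeasurableSpace.comap_mono this
  · filter_upwards [hN'.ae_isSimple hχ] with z hz n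
    exact hz.isDriven_drivenState z.1 n

end CutPaste

/-! ### Conclusion: existence of the rate measure and identification of the laws. -/

theorem theorem4p2 {k : ℕ} (hk : 1 ≤ k) {Ω : Type*} [MeasurableSpace Ω]
    (Pr : ProbabilityTheory.Kernel (CutPaste.Coloring k) Ω)
    (X : ℝ≥0 → Ω → CutPaste.Coloring k)
    (hX : CutPaste.IsMarkovProcess Pr X)
    (hexch : CutPaste.IsExchangeable Pr X)
    (hcons : CutPaste.IsConsistent Pr X) :
    ∃ χ : Measure (CutPaste.CosetMap k),
      CutPaste.IsCosetExchangeable χ ∧ CutPaste.IsRegular χ ∧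
      ∀ μ : Measure (CutPaste.Coloring k), IsProbabilityMeasure μ →
        -- the process `X*_χ` with initial law `μ` exists
        (∃ (Ω' : Type) (_ : MeasurableSpace Ω') (P : Measure Ω')
          (N : Ω' → Set (ℝ≥0 × CutPaste.CosetMap k)) (Y : ℝ≥0 → Ω' → CutPaste.Coloring k),
          IsProbabilityMeasure P ∧ CutPaste.IsPoissonConstruction P χ μ N Y) ∧
        -- and every such process is a version of `X` with initial law `μ`
        ∀ (Ω' : Type*) (_ : MeasurableSpace Ω') (P : Measure Ω')
          (N : Ω' → Set (ℝ≥0 × CutPaste.CosetMap k)) (Y : ℝ≥0 → Ω' → CutPaste.Coloring k),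
          IsProbabilityMeasure P → CutPaste.IsPoissonConstruction P χ μ N Y →
            P.map (fun ω t => Y t ω) = CutPaste.pathLaw Pr X μ := by
  choose hstep p hp using hcons
  have hsemi : ∀ n, CutPaste.IsTransitionSemigroup (p n) := fun n =>
    CutPaste.IsTransitionOf.isTransitionSemigroup hk hX (hp n) (hstep n)
  obtain ⟨χ, _, hcoset, hreg, hrate⟩ :=
    CutPaste.exists_rate_measure_of_process hk hX hexch hp hsemi
  refine ⟨χ, hcoset, hreg, fun μ hμ => ⟨CutPaste.exists_isPoissonConstruction χ hreg μ,
    fun Ω' _ P N Y hP hY => ?_⟩⟩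
  have hYm : Measurable fun ω t => Y t ω := measurable_pi_lambda _ hY.measurable
  have := CutPaste.isProbabilityMeasure_pathLaw hX μ
  have := Measure.isProbabilityMeasure_map (μ := P) hYm.aemeasurable
  -- Both finite-dimensional laws are the initial mass times the same product of values of `p n`.
  refine CutPaste.pathMeasure_ext fun n m t ht ht0 y => ?_
  rw [CutPaste.IsTransitionOf.pathLaw_finDim hX (hp n) μ ht ht0,
    map_measureReal_apply hYm (CutPaste.measurableSet_finDim (m + 1) y)]
  exact hY.measureReal_finDim hreg (hsemi n) (hrate n) ht ht0 m y
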